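/- **Setting.** Let $A=[a_1,\dots,a_m]\in\mathbb R^{n\times m}$, let $W=\mathrm{diag}(w_1,\dots,w_m)$ with all $w_i\neq 0$, and let $1\le k\le \mathrm{rank}(A)$. Put $p_i=w_i^{-2}/\|W^{-1}\|_F^2$, where $\|W^{-1}\|_F^2=\sum_j w_j^{-2}$. For $(s_1,\dots,s_k)\in[m]^k$ (repetitions allowed) let $$f_{s_1,\dots,s_k}(x)=\Big(\prod_{i=1}^k p_{s_i}\Big)\det\Big[xI-\sum_{i=1}^k w_{s_i}^2a_{s_i}a_{s_i}^T\Big],$$ and for $0\le j<k$ let $f_{s_1,\dots,s_j}=\sum_{s_{j+1},\dots,s_k\in[m]}f_{s_1,\dots,s_k}$; for $j=0$ this is the expected characteristic polynomial $f_\emptyset$. For a real-rooted polynomial $p$ let $\lambda_k(p)$ be its $k$-th largest root, counted with multiplicity. For a matrix $M$ let $\sigma_{\min}(M)=\min_{\|x\|_2=1}\|Mx\|_2$. For $S\subseteq[m]$ let $A_S$ be the matrix of the columns of $A$ indexed by $S$, and $W_S=\mathrm{diag}(w_i)_{i\in S}$. **Greedy algorithm.** For $j=1,\dots,k$ choose $$s_j\in\operatorname*{argmax}_{s\in[m]\setminus\{s_1,\dots,s_{j-1}\}}\lambda_k\big(f_{s_1,\dots,s_{j-1},s}\big),$$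 with ties broken arbitrarily, and output $S=\{s_1,\dots,s_k\}$. **Cost model.** A program is a fixed finite text for a random access machine working with natural numbers (indices, addresses) and exact real numbers. Each arithmetic operation, comparison, memory access and assignment costs one step. In addition the machine can compute the $k$-th largest root of a real-rooted polynomial of degree $d$, given by its coefficients, at a price of $d^3$ steps (the price charged for the QR algorithm applied to a companion matrix). **Theorem.** (1) For all $A$, $W$, $k$ as above, every $f_{s_1,\dots,s_j}$ with $0\le j\le k$ is real-rooted of degree $n$, and every possible output $S$ of the greedy algorithm has exactly $k$ elements and satisfies $$\sigma_{\min}(A_SW_S)^2\ \ge\ \lambda_k(f_\emptyset).$$ (2) Let $\theta>2$ be an exponent of matrix multiplication, i.e. some program multiplies any two real $n\times n$ matrices in $O(n^\theta)$ steps. Then there are a single program and a constant $c$ such that, for all $n,m,k$ and all $A$, $W$ as above, the program on input $(A,w_1,\dots,w_m,k)$ outputs a sequence $s_1,\dots,s_k$ chosen according to the rule of the greedy algorithm, after at most $$c\,k\Big(m-\frac k2\Big)n^{\theta+1}$$ steps. -/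

import Mathlib

open Polynomial

noncomputable section

/-! ### Matrices, polynomials and the greedy selection rule -/

namespace WeightedRI

/-- `λ_k(p)`: the `k`-th largest root (`k = 1, 2, …`) of a real-rooted polynomial `p`, roots being
counted with multiplicity. It is only meaningful if `p` is real-rooted and `1 ≤ k ≤ deg p`. -/
def kthLargestRoot (k : ℕ) (p : ℝ[X]) : ℝ :=
  (p.roots.sort (· ≥ ·)).getD (k - 1) 0

/-- The least singular value `σ_min(M) = min_{‖x‖₂ = 1} ‖M x‖₂`. -/
def sigmaMin {n : ℕ} {ι : Type} [Fintype ι] [DecidableEq ι] (M : Matrix (Fin n) ι ℝ) : ℝ :=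
  ⨅ x : {x : EuclideanSpace ℝ ι // ‖x‖ = 1}, ‖Matrix.toEuclideanLin M x.1‖

/-- `A_S`: the columns of `A` with index in `S`. -/
def colsOf {n m : ℕ} (A : Matrix (Fin n) (Fin m) ℝ) (S : Finset (Fin m)) :
    Matrix (Fin n) S ℝ :=
  A.submatrix id Subtype.val

/-- `W_S`: the diagonal matrix `W = diag(w_1, …, w_m)` restricted to rows and columns in `S`. -/
def weightsOf {m : ℕ} (w : Fin m → ℝ) (S : Finset (Fin m)) : Matrix S S ℝ :=
  (Matrix.diagonal w).submatrix Subtype.val Subtype.val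

/-- The probability `p_i = w_i⁻² / ‖W⁻¹‖_F²` of picking the `i`-th column. -/
def colProb {m : ℕ} (w : Fin m → ℝ) (i : Fin m) : ℝ :=
  (w i ^ 2)⁻¹ / ∑ j, (w j ^ 2)⁻¹

/-- The polynomial of a full assignment `s_1, …, s_k`:
`(∏ p_{s_i}) · det [x I - ∑ w_{s_i}² a_{s_i} a_{s_i}ᵀ]`, where `a_s` is column `s` of `A`. -/
def fullPoly {n m : ℕ} (A : Matrix (Fin n) (Fin m) ℝ) (w : Fin m → ℝ) (l : List (Fin m)) : ℝ[X] :=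
  C (l.map (colProb w)).prod *
    ((l.map fun s => w s ^ 2 • Matrix.vecMulVec (A.col s) (A.col s)).sum).charpoly

/-- The polynomial of a partial assignment `l = (s_1, …, s_j)`, `j ≤ k`: the sum of the polynomials
of all its completions `(s_1, …, s_j, s_{j+1}, …, s_k) ∈ [m]^k` (repetitions are allowed).
For `l = []` this is the expected characteristic polynomial `f_∅`. -/
def partialPoly {n m : ℕ} (A : Matrix (Fin n) (Fin m) ℝ) (w : Fin m → ℝ) (k : ℕ)
    (l : List (Fin m)) : ℝ[X] :=
  ∑ t : Fin (k - l.length) → Fin m, fullPoly A w (l ++ List.ofFn t)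

/-- `GreedyRun A w k l`: the greedy algorithm with sampling parameter `k` can have chosen the
indices `l = (s_1, …, s_j)`, in this order, in its first `j` rounds. In each round it appends an
index, not chosen before, at which `λ_k (f_{s_1, …, s_{j-1}, s})` is maximal; ties are broken
arbitrarily. The algorithm stops after `k` rounds. -/
inductive GreedyRun {n m : ℕ} (A : Matrix (Fin n) (Fin m) ℝ) (w : Fin m → ℝ) (k : ℕ) :
    List (Fin m) → Prop
  | nil : GreedyRun A w k []
  | snoc (l : List (Fin m)) (s : Fin m) (hl : GreedyRun A w k l) (hs : s ∉ l)
      (hmax : ∀ t : Fin m, t ∉ l →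
        kthLargestRoot k (partialPoly A w k (l ++ [t])) ≤
          kthLargestRoot k (partialPoly A w k (l ++ [s]))) :
      GreedyRun A w k (l ++ [s])

end WeightedRI

/-! ### A real random access machine with a step count

Programs are finite texts in a small imperative language; one program serves inputs of all sizes.
The memory holds natural-number variables, natural-number arrays (indices and addresses) and
two-dimensional arrays of exact real numbers. -/

namespace RealRAM

structure State where
  /-- natural-number variables -/
  nvar : ℕ → ℕ
  /-- natural-number arrays: `narr a i` is cell `i` of array `a` -/
  narr : ℕ → ℕ → ℕ
  /-- real arrays: `rarr a i j` is cell `(i, j)` of array `a` -/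
  rarr : ℕ → ℕ → ℕ → ℝ

/-- Expressions over the natural numbers (subtraction is truncated). -/
inductive NExp
  | const (c : ℕ)
  | var (x : ℕ)
  | get (a : ℕ) (i : NExp)
  | add (e f : NExp)
  | sub (e f : NExp)

/-- Expressions over the real numbers (division by zero gives zero). -/
inductive RExp
  | ofNat (e : NExp)
  | get (a : ℕ) (i j : NExp)
  | add (e f : RExp)
  | sub (e f : RExp)
  | mul (e f : RExp)
  | div (e f : RExp)

/-- Tests. -/
inductive BExp
  | natLt (e f : NExp)
  | realLe (e f : RExp)
  | not (b : BExp)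
  | and (b c : BExp)

def NExp.eval (σ : State) : NExp → ℕ
  | const c => c
  | var x => σ.nvar x
  | get a i => σ.narr a (i.eval σ)
  | add e f => e.eval σ + f.eval σ
  | sub e f => e.eval σ - f.eval σ

def RExp.eval (σ : State) : RExp → ℝ
  | ofNat e => (e.eval σ : ℝ)
  | get a i j => σ.rarr a (i.eval σ) (j.eval σ)
  | add e f => e.eval σ + f.eval σ
  | sub e f => e.eval σ - f.eval σ
  | mul e f => e.eval σ * f.eval σ
  | div e f => e.eval σ / f.eval σ

def BExp.eval (σ : State) : BExp → Prop
  | natLt e f => e.eval σ < f.eval σ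
  | realLe e f => e.eval σ ≤ f.eval σ
  | not b => ¬ b.eval σ
  | and b c => b.eval σ ∧ c.eval σ

/-- The cost of evaluating an expression: one step per constant, memory access and operation. -/
def NExp.cost : NExp → ℕ
  | const _ => 1
  | var _ => 1
  | get _ i => i.cost + 1
  | add e f => e.cost + f.cost + 1
  | sub e f => e.cost + f.cost + 1

def RExp.cost : RExp → ℕ
  | ofNat e => e.cost + 1
  | get _ i j => i.cost + j.cost + 1
  | add e f => e.cost + f.cost + 1
  | sub e f => e.cost + f.cost + 1
  | mul e f => e.cost + f.cost + 1
  | div e f => e.cost + f.cost + 1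

def BExp.cost : BExp → ℕ
  | natLt e f => e.cost + f.cost + 1
  | realLe e f => e.cost + f.cost + 1
  | not b => b.cost + 1
  | and b c => b.cost + c.cost + 1

/-- Programs. -/
inductive Cmd
  | skip
  /-- `nvar x := e` -/
  | setVar (x : ℕ) (e : NExp)
  /-- `narr a i := e` -/
  | setNat (a : ℕ) (i e : NExp)
  /-- `rarr a i j := e` -/
  | setReal (a : ℕ) (i j : NExp) (e : RExp)
  /-- `rarr a i j :=` the `k`-th largest root of the real-rooted polynomial of degree `d` whose
  coefficients are `rarr b r 0, …, rarr b r d` -/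
  | root (a : ℕ) (i j : NExp) (b : ℕ) (r d k : NExp)
  | seq (c c' : Cmd)
  | ite (b : BExp) (c c' : Cmd)
  | while (b : BExp) (c : Cmd)

def State.setVar (σ : State) (x v : ℕ) : State :=
  { σ with nvar := Function.update σ.nvar x v }

def State.setNat (σ : State) (a i v : ℕ) : State :=
  { σ with narr := Function.update σ.narr a (Function.update (σ.narr a) i v) }

def State.setReal (σ : State) (a i j : ℕ) (v : ℝ) : State :=
  let row := Function.update (σ.rarr a i) j v
  { σ with rarr := Function.update σ.rarr a (Function.update (σ.rarr a) i row) }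

/-- The polynomial of degree at most `d` whose coefficients are stored in row `r` of the real
array `b`. -/
def State.rowPoly (σ : State) (b r d : ℕ) : ℝ[X] :=
  ∑ t ∈ Finset.range (d + 1), C (σ.rarr b r t) * X ^ t

/-- `Exec c σ τ t`: started in state `σ`, the program `c` halts in state `τ` after `t` steps.
Arithmetic operations, comparisons, memory accesses and assignments cost one step each. Computing
the `k`-th largest root of a polynomial of degree `d` is charged `d ^ 3` steps (the price of the
QR algorithm for its companion matrix); it is possible only for real-rooted polynomials. -/
inductive Exec : Cmd → State → State → ℕ → Prop
  | skip (σ : State) : Exec .skip σ σ 1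
  | setVar (σ : State) (x : ℕ) (e : NExp) :
      Exec (.setVar x e) σ (σ.setVar x (e.eval σ)) (e.cost + 1)
  | setNat (σ : State) (a : ℕ) (i e : NExp) :
      Exec (.setNat a i e) σ (σ.setNat a (i.eval σ) (e.eval σ)) (i.cost + e.cost + 1)
  | setReal (σ : State) (a : ℕ) (i j : NExp) (e : RExp) :
      Exec (.setReal a i j e) σ (σ.setReal a (i.eval σ) (j.eval σ) (e.eval σ))
        (i.cost + j.cost + e.cost + 1)
  | root (σ : State) (a : ℕ) (i j : NExp) (b : ℕ) (r d k : NExp)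
      (hlead : σ.rarr b (r.eval σ) (d.eval σ) ≠ 0)
      (hreal : (σ.rowPoly b (r.eval σ) (d.eval σ)).Splits)
      (hk : 1 ≤ k.eval σ) (hkd : k.eval σ ≤ d.eval σ) :
      Exec (.root a i j b r d k) σ
        (σ.setReal a (i.eval σ) (j.eval σ)
          (WeightedRI.kthLargestRoot (k.eval σ) (σ.rowPoly b (r.eval σ) (d.eval σ))))
        (i.cost + j.cost + r.cost + d.cost + k.cost + d.eval σ ^ 3 + 1)
  | seq {c c' : Cmd} {σ τ ρ : State} {t t' : ℕ} (h : Exec c σ τ t) (h' : Exec c' τ ρ t') :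
      Exec (.seq c c') σ ρ (t + t')
  | iteTrue {b : BExp} {c c' : Cmd} {σ τ : State} {t : ℕ} (hb : b.eval σ) (h : Exec c σ τ t) :
      Exec (.ite b c c') σ τ (b.cost + t + 1)
  | iteFalse {b : BExp} {c c' : Cmd} {σ τ : State} {t : ℕ} (hb : ¬ b.eval σ)
      (h : Exec c' σ τ t) :
      Exec (.ite b c c') σ τ (b.cost + t + 1)
  | whileTrue {b : BExp} {c : Cmd} {σ τ ρ : State} {t t' : ℕ} (hb : b.eval σ)
      (h : Exec c σ τ t) (h' : Exec (.while b c) τ ρ t') :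
      Exec (.while b c) σ ρ (b.cost + t + t' + 1)
  | whileFalse {b : BExp} {c : Cmd} {σ : State} (hb : ¬ b.eval σ) :
      Exec (.while b c) σ σ (b.cost + 1)

/-- The value in cell `(i, j)` of a matrix, and `0` outside the matrix. -/
def cell {n m : ℕ} (M : Matrix (Fin n) (Fin m) ℝ) (i j : ℕ) : ℝ :=
  if h : i < n ∧ j < m then M ⟨i, h.1⟩ ⟨j, h.2⟩ else 0

/-- Input of the matrix multiplication problem: variable `0` holds `n`, the real arrays `0` and `1`
hold the two `n × n` matrices; the rest of the memory is zero. -/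
def matMulInput {n : ℕ} (M N : Matrix (Fin n) (Fin n) ℝ) : State where
  nvar x := if x = 0 then n else 0
  narr _ _ := 0
  rarr a := if a = 0 then cell M else if a = 1 then cell N else fun _ _ => 0

/-- `θ` is an admissible exponent of matrix multiplication: some program multiplies any two real
`n × n` matrices within `O(n ^ θ)` steps, leaving the product in the real array `2`. -/
def IsMatMulExponent (θ : ℝ) : Prop :=
  ∃ (P : Cmd) (c : ℝ), ∀ (n : ℕ), 1 ≤ n → ∀ M N : Matrix (Fin n) (Fin n) ℝ,
    ∃ (τ : State) (t : ℕ), Exec P (matMulInput M N) τ t ∧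
      (∀ i j : Fin n, τ.rarr 2 i j = (M * N) i j) ∧ (t : ℝ) ≤ c * (n : ℝ) ^ θ

/-- Input of the column selection problem: the variables `0`, `1`, `2` hold `n`, `m`, `k`, the real
array `0` holds the `n × m` matrix `A`, row `0` of the real array `1` holds the weights
`w_1, …, w_m`; the rest of the memory is zero. -/
def selectInput {n m : ℕ} (A : Matrix (Fin n) (Fin m) ℝ) (w : Fin m → ℝ) (k : ℕ) : State where
  nvar x := if x = 0 then n else if x = 1 then m else if x = 2 then k else 0
  narr _ _ := 0
  rarr a := if a = 0 then cell A
    else if a = 1 then cell (Matrix.of fun (_ : Fin 1) (j : Fin m) => w j)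
    else fun _ _ => 0

/-- The sequence of the first `k` entries of the natural-number array `0`. -/
def State.output (σ : State) (k : ℕ) : List ℕ :=
  (List.range k).map (σ.narr 0)

end RealRAM

end

/-! The probabilities are chosen so that p_s w_s² = c is the same for all s (`colProb_mul_sq`). Put
B = AAᵀ. A rank-one update changes a determinant affinely, so averaging det(N + κ(M + w_s² a_s a_sᵀ)
+ yB) over s amounts to applying 1 + κc d/dy (`expect_pencil`). With κ = -1 and N = xI, the
polynomial of a partial assignment of length j is, up to a nonzero constant, (1 - c ∂_y)^(k-j)
det(xI - M + yB) at y = 0, where M is the sum of the weighted rank-one matrices chosen so far.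

Part (1). The determinant has no zero with Im x > 0 and Im y ≥ 0, and the operator preserves this
(`det_stable`, `diffOp_stable`); real-rootedness follows. One more variable z, along a rank-one
direction, shows that after a rank-one update the quotient of new and old expected polynomial has
nonnegative imaginary part on the upper half-plane (`im_div_expChar_nonneg`). Following arguments
along lines above the real axis, such a quotient f/g forces f to have as many roots above r as g, or
one more (`countP_roots_of_im_div_nonneg`). Together with a comparison of signs this gives an index
s whose λ_k is at least that of the average (`exists_kthLargestRoot_sum_le`). Forbidding repetitions
costs nothing: with a repeated index every completion has rank below k, so λ_k ≤ 0, while λ_k ≥ 0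
always. Hence λ_k never decreases along a greedy run. For a full assignment without repetitions λ_k
is the least eigenvalue of the Gram matrix of A_S W_S, which `kthLargestRoot_le_sigmaMin_sq`
compares with σ_min².

Part (2). Interpolating once in x and once in y writes each coefficient of these polynomials as a
fixed linear combination of the (n+1)² determinants det(1 + iM + rB), 0 ≤ i, r ≤ n
(`coeff_expChar_sub`). These matrices are positive definite. The program stores, for each grid
point, the determinant and the inverse applied to all columns of A. A candidate column then costs
O(n) per grid point by the determinant lemma, and a selected column costs O(mn) per grid point by
the Sherman-Morrison formula. The root computation costs n³ per candidate. In total this is O(k m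
n³), which is within the bound because θ + 1 > 3 and m ≤ 2(m - k/2). -/

noncomputable section

/-! ### Determinants: rank-one updates and Jacobi's formula. -/

namespace Matrix

variable {n : Type*} [Fintype n] [DecidableEq n]

theorem det_add_vecMulVec_of_ne_zero {F : Type*} [Field F] (N : Matrix n n F) (u v : n → F)
    (h : N.det ≠ 0) : (N + vecMulVec u v).det = N.det + v ⬝ᵥ N.adjugate *ᵥ u := by
  have hu : IsUnit N.det := h.isUnit
  rw [vecMulVec_eq Unit, det_add_replicateCol_mul_replicateRow hu, det_unique (n := Unit)]
  have : (1 + replicateRow Unit v * N⁻¹ * replicateCol Unit u : Matrix Unit Unit F) default default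
      = 1 + v ⬝ᵥ N⁻¹ *ᵥ u := by
    rw [add_apply, one_apply_eq, Matrix.mul_assoc, mul_apply]
    simp [dotProduct, mulVec, mul_apply]
  rw [this, inv_def, Ring.inverse_eq_inv', smul_mulVec, dotProduct_smul, smul_eq_mul, mul_add,
    mul_one, mul_inv_cancel_left₀ h]

/-- Both sides are polynomial in N, so invertibility can be forced generically: `charmatrix (-N)` is
X + N, whose determinant is monic and hence nonzero in the fraction field of F[X]. The invertible
case applies there, and X = 0 gives back N. -/
theorem det_add_vecMulVec {F : Type*} [CommRing F] [IsDomain F] (N : Matrix n n F) (u v : n → F) :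
    (N + vecMulVec u v).det = N.det + v ⬝ᵥ N.adjugate *ᵥ u := by
  let g : F[X] →+* FractionRing F[X] := algebraMap _ _
  have hg : Function.Injective g := IsFractionRing.injective _ _
  let N' : Matrix n n F[X] := charmatrix (-N)
  have hN' : N'.det ≠ 0 := (charpoly_monic (-N)).ne_zero
  have h1 : (N' + vecMulVec (C ∘ u) (C ∘ v)).det =
      N'.det + (C ∘ v) ⬝ᵥ N'.adjugate *ᵥ (C ∘ u) := by
    apply hg
    have := det_add_vecMulVec_of_ne_zero (g.mapMatrix N') (g ∘ C ∘ u) (g ∘ C ∘ v)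
      (by rw [← RingHom.map_det]; exact (map_ne_zero_iff g hg).2 hN')
    rw [RingHom.map_det, map_add, map_add, RingHom.map_det]
    have e1 : g.mapMatrix (vecMulVec (C ∘ u) (C ∘ v)) = vecMulVec (g ∘ C ∘ u) (g ∘ C ∘ v) := by
      ext i j; exact map_mul g _ _
    have e2 : g ((C ∘ v) ⬝ᵥ N'.adjugate *ᵥ (C ∘ u)) =
        (g ∘ C ∘ v) ⬝ᵥ (g.mapMatrix N').adjugate *ᵥ (g ∘ C ∘ u) := by
      rw [RingHom.map_dotProduct, ← RingHom.map_adjugate]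
      congr 1; ext i; exact RingHom.map_mulVec _ _ _ _
    rw [e1, e2, this]
  have h2 := congrArg (evalRingHom (0:F)) h1
  rw [map_add, RingHom.map_det, RingHom.map_det, map_add] at h2
  have h3 : (evalRingHom (0:F)).mapMatrix N' = N := by
    ext i j; simp [N', charmatrix_apply, diagonal_apply]; split_ifs <;> simp
  rw [h3] at h2
  convert h2 using 2
  · congr 1; ext i j; simp [vecMulVec_apply]
  · rw [← h3, ← RingHom.map_adjugate]; simp [dotProduct, mulVec, eval_finsetSum]

/-- The product rule differentiates one column at a time. Replacing column i by the i-th column of B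
gives a Cramer determinant, which is the i-th diagonal entry of adjugate times B. -/
theorem derivative_det {R : Type*} [CommRing R] (N B : Matrix n n R) :
    derivative (N.map C + (X : R[X]) • B.map C).det =
      ((N.map C + (X : R[X]) • B.map C).adjugate * B.map C).trace := by
  set Q := N.map C + (X : R[X]) • B.map C with hQ
  have hent (i j) : derivative (Q i j) = C (B i j) := by simp [hQ]
  have h1 : derivative Q.det = ∑ i, (Q.updateCol i ((B.map C).col i)).det := by
    simp_rw [det_apply, Polynomial.derivative_sum]
    rw [Finset.sum_comm]
    refine Finset.sum_congr rfl fun σ _ => ?_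
    rw [derivative_smul, derivative_prod_finset, Finset.smul_sum]
    refine Finset.sum_congr rfl fun i _ => ?_
    congr 1
    rw [hent, ← Finset.prod_erase_mul _ _ (Finset.mem_univ i)]
    congr 1
    · refine Finset.prod_congr rfl fun j hj => ?_
      rw [updateCol_ne (Finset.ne_of_mem_erase hj)]
    · simp
  rw [h1, trace]
  refine Finset.sum_congr rfl fun i _ => ?_
  rw [← cramer_apply, cramer_eq_adjugate_mulVec, diag_apply, mul_apply_eq_vecMul]
  simp [mulVec, vecMul, dotProduct]
end Matrix

namespace WeightedRI

/-! ### Averages over independent increments -/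

section Expect

variable {ι E V V' : Type*} [Fintype ι] [AddCommMonoid E]
  [AddCommMonoid V] [Module ℝ V] [AddCommMonoid V'] [Module ℝ V']

/-- The mean of `F (M + U s₁ + ⋯ + U s_q)` over independent indices `s_i` with weights `p`. -/
def expect (p : ι → ℝ) (U : ι → E) : ℕ → (E → V) → E → V
  | 0, F, M => F M
  | q + 1, F, M => ∑ s, p s • expect p U q F (M + U s)

theorem map_expect (φ : V →ₗ[ℝ] V') (p : ι → ℝ) (U : ι → E) (q : ℕ) (F : E → V) (M : E) :
    φ (expect p U q F M) = expect p U q (fun M => φ (F M)) M := by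
  induction q generalizing M with
  | zero => rfl
  | succ q ih => simp [expect, ih]

theorem expect_add_right (p : ι → ℝ) (U : ι → E) (q : ℕ) (F : E → V) (M L : E) :
    expect p U q F (M + L) = expect p U q (fun M => F (M + L)) M := by
  induction q generalizing M with
  | zero => rfl
  | succ q ih => simp only [expect]; simp_rw [← ih, add_right_comm]

theorem expect_const (p : ι → ℝ) (hp : ∑ s, p s = 1) (U : ι → E) (q : ℕ) (v : V) (M : E) :
    expect p U q (fun _ => v) M = v := by
  induction q generalizing M with
  | zero => rfl
  | succ q ih => simp only [expect, ih, ← Finset.sum_smul, hp, one_smul]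

theorem expect_add (p : ι → ℝ) (U : ι → E) (q : ℕ) (F G : E → V) (M : E) :
    expect p U q (fun M => F M + G M) M = expect p U q F M + expect p U q G M := by
  induction q generalizing M with
  | zero => rfl
  | succ q ih => simp only [expect, ih, smul_add, Finset.sum_add_distrib]

theorem expect_smul (p : ι → ℝ) (U : ι → E) {K : Type*} [CommRing K] [Algebra ℝ K]
    (q : ℕ) (z : K) (F : E → K) (M : E) :
    expect p U q (fun M => z * F M) M = z * expect p U q F M :=
  (map_expect (LinearMap.mulLeft ℝ z) p U q F M).symm

/-- A convex property that holds at all the averaged points holds for the average. -/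
theorem expect_mem {S : V → Prop} {T : E → Prop} (p : ι → ℝ) (U : ι → E)
    (hS : ∀ f : ι → V, (∀ s, S (f s)) → S (∑ s, p s • f s)) (hT : ∀ M, T M → ∀ s, T (M + U s))
    (q : ℕ) (F : E → V) (hF : ∀ M, T M → S (F M)) (M : E) (hM : T M) : S (expect p U q F M) := by
  induction q generalizing M with
  | zero => exact hF M hM
  | succ q ih => exact hS _ fun s => ih _ (hT M hM s)

end Expect

/-! ### The expected determinant as a differential operator -/

section Pencil

variable {n : ℕ} {ι K : Type*} [Fintype ι] [Field K]

/-- `det (N + X B)`. -/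
def pencil (N B : Matrix (Fin n) (Fin n) K) : K[X] :=
  (N.map C + (X : K[X]) • B.map C).det

theorem eval_pencil (N B : Matrix (Fin n) (Fin n) K) (y : K) :
    (pencil N B).eval y = (N + y • B).det := by
  rw [pencil, ← coe_evalRingHom, RingHom.map_det]
  congr 1; ext i j; simp; exact mul_comm _ _

theorem natDegree_pencil_le (N B : Matrix (Fin n) (Fin n) K) : (pencil N B).natDegree ≤ n := by
  rw [pencil, add_comm]
  simpa using natDegree_det_X_add_C_le B N

/-- The dependence on t is affine, so that averaging over rank-one updates only involves the
quadratic forms of the adjugate. -/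
theorem pencil_add_vecMulVec (N B : Matrix (Fin n) (Fin n) K) (t : K) (u : Fin n → K) :
    pencil (N + t • Matrix.vecMulVec u u) B = pencil N B +
      C t * ((C ∘ u) ⬝ᵥ (N.map C + (X : K[X]) • B.map C).adjugate.mulVec (C ∘ u)) := by
  have h := Matrix.det_add_vecMulVec (N.map C + (X : K[X]) • B.map C) (C t • (C ∘ u)) (C ∘ u)
  rw [pencil, pencil]
  convert h using 2
  · ext i j : 2; simp [Matrix.vecMulVec_apply]; ring
  · rw [Matrix.mulVec_smul, dotProduct_smul, smul_eq_mul]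

/-- By Jacobi's formula the derivative in the direction of the sum of all a_s a_sᵀ is made of the
same quadratic forms that appear in `pencil_add_vecMulVec`. -/
theorem derivative_pencil_sum (N : Matrix (Fin n) (Fin n) K) (a : ι → Fin n → K) :
    derivative (pencil N (∑ s, Matrix.vecMulVec (a s) (a s))) =
      ∑ s, (C ∘ a s) ⬝ᵥ (N.map C + (X : K[X]) •
        (∑ s, Matrix.vecMulVec (a s) (a s)).map C).adjugate.mulVec (C ∘ a s) := by
  rw [pencil, Matrix.derivative_det]
  set Q := (N.map C + (X : K[X]) • (∑ s, Matrix.vecMulVec (a s) (a s)).map C).adjugate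
  have : (∑ s, Matrix.vecMulVec (a s) (a s)).map C =
      ∑ s, Matrix.vecMulVec (C ∘ a s) (C ∘ a s) := by
    ext i j : 2; simp [Matrix.sum_apply, Matrix.vecMulVec_apply]
  rw [this, Finset.mul_sum, Matrix.trace_sum]
  refine Finset.sum_congr rfl fun s _ => ?_
  rw [Matrix.mul_vecMulVec, Matrix.trace_vecMulVec, dotProduct_comm]

/-- The differential operator `F ↦ F + b F'`. -/
def diffOp (b : K) : K[X] →ₗ[K] K[X] := LinearMap.id + b • derivative

theorem diffOp_apply (b : K) (F : K[X]) : diffOp b F = F + b • derivative F := rfl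

/-- Binomial expansion of (1 + b d/dX)^q: the d-th derivative at 0 is d! times the d-th coefficient,
and d! times the binomial coefficient is the falling factorial. -/
theorem iterate_diffOp_eval_zero (b : K) (q N : ℕ) (F : K[X]) (hF : F.natDegree ≤ N) :
    ((diffOp b ^ q) F).eval 0 =
      ∑ d ∈ Finset.range (N + 1), (q.descFactorial d : K) * b ^ d * F.coeff d := by
  have h1 : diffOp b ^ q = ∑ d ∈ Finset.range (q + 1),
      (q.choose d : ℕ) • ((b • derivative : K[X] →ₗ[K] K[X]) ^ d) := by
    rw [diffOp, add_comm, Commute.add_pow (show Commute _ LinearMap.id from Commute.one_right _)]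
    refine Finset.sum_congr rfl fun d _ => ?_
    rw [show (LinearMap.id : K[X] →ₗ[K] K[X]) = 1 from rfl, one_pow, mul_one, nsmul_eq_mul,
      Nat.cast_comm]
  have h2 (d : ℕ) : (((q.choose d : ℕ) • ((b • derivative : K[X] →ₗ[K] K[X]) ^ d)) F).eval 0 =
      (q.descFactorial d : K) * b ^ d * F.coeff d := by
    rw [_root_.smul_pow, LinearMap.smul_apply, LinearMap.smul_apply, Module.End.pow_apply,
      eval_smul, eval_smul, ← coeff_zero_eq_eval_zero, coeff_iterate_derivative,
      Nat.descFactorial_eq_factorial_mul_choose q]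
    simp [Nat.descFactorial_self]; ring
  rw [h1, LinearMap.sum_apply, eval_finsetSum]
  simp_rw [h2]
  -- The sums up to q and up to N agree: the surplus terms vanish either through the falling
  -- factorial or through the degree of F.
  rcases le_total q N with h | h
  · refine Finset.sum_subset (by simpa using h) fun d _ hd => ?_
    rw [Nat.descFactorial_of_lt (by simpa using hd)]; simp
  · refine (Finset.sum_subset (by simpa using h) fun d _ hd => ?_).symm
    rw [coeff_eq_zero_of_natDegree_lt (by simp at hd; omega)]; simp

/-- One draw adds κ p_s ω_s times the s-th quadratic form, summed over s. As p_s ω_s = c, this is κc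
times the derivative of the pencil, and linearity of the operator gives the induction. The free κ
and N serve two purposes: κ = -1 over ℂ for stability, and κ = i, N = 1 over ℝ for the computation
of coefficients. -/
theorem expect_pencil [Algebra ℝ K] (p ω : ι → ℝ) (hp : ∑ s, p s = 1) (c : ℝ) (hc : ∀ s, p s * ω s = c)
    (a : ι → Fin n → ℝ) (κ : K) (N : Matrix (Fin n) (Fin n) K) (q : ℕ)
    (M : Matrix (Fin n) (Fin n) ℝ) :
    expect p (fun s => ω s • Matrix.vecMulVec (a s) (a s)) q
      (fun M => pencil (N + κ • M.map (algebraMap ℝ K))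
        ((∑ s, Matrix.vecMulVec (a s) (a s)).map (algebraMap ℝ K))) M =
    (diffOp (κ * algebraMap ℝ K c) ^ q) (pencil (N + κ • M.map (algebraMap ℝ K))
        ((∑ s, Matrix.vecMulVec (a s) (a s)).map (algebraMap ℝ K))) := by
  let a' : ι → Fin n → K := fun s => algebraMap ℝ K ∘ a s
  have hB : (∑ s, Matrix.vecMulVec (a s) (a s)).map (algebraMap ℝ K) =
      ∑ s, Matrix.vecMulVec (a' s) (a' s) := by
    ext i j; simp [Matrix.sum_apply, Matrix.vecMulVec_apply, a']
  rw [hB]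
  induction q generalizing M with
  | zero => rfl
  | succ q ih =>
    simp only [expect, ih]
    have hstep (s) : N + κ • (M + ω s • Matrix.vecMulVec (a s) (a s)).map (algebraMap ℝ K) =
        (N + κ • M.map (algebraMap ℝ K)) +
          (κ * algebraMap ℝ K (ω s)) • Matrix.vecMulVec (a' s) (a' s) := by
      ext i j; simp [Matrix.vecMulVec_apply, a']; ring
    simp_rw [hstep, pencil_add_vecMulVec]
    have hlin (s) (F : K[X]) : p s • (diffOp (κ * algebraMap ℝ K c) ^ q) F =
        (diffOp (κ * algebraMap ℝ K c) ^ q) (p s • F) := by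
      rw [← algebraMap_smul K, ← map_smul, algebraMap_smul]
    simp_rw [hlin]
    rw [← map_sum, pow_succ, Module.End.mul_apply, diffOp_apply, derivative_pencil_sum]
    congr 1
    simp_rw [smul_add]
    rw [Finset.sum_add_distrib, ← Finset.sum_smul, hp, one_smul, Finset.smul_sum]
    congr 1
    refine Finset.sum_congr rfl fun s _ => ?_
    rw [← algebraMap_smul K, smul_eq_C_mul, smul_eq_C_mul, ← hc s]
    simp only [map_mul]
    ring

end Pencil

end WeightedRI

namespace WeightedRI

/-! ### Stability -/

section Stability

variable {n : ℕ} {ι : Type*} [Fintype ι]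

theorem star_dotProduct_vecMulVec_mulVec (a : Fin n → ℝ) (v : Fin n → ℂ) :
    star v ⬝ᵥ ((Matrix.vecMulVec a a).map (algebraMap ℝ ℂ)).mulVec v =
      (Complex.normSq (∑ i, (a i : ℂ) * v i) : ℂ) := by
  rw [Complex.normSq_eq_conj_mul_self, map_sum, Finset.sum_mul_sum, dotProduct]
  refine Finset.sum_congr rfl fun i _ => ?_
  rw [Matrix.mulVec, dotProduct, Finset.mul_sum]
  refine Finset.sum_congr rfl fun j _ => ?_
  simp [Matrix.vecMulVec_apply]; ring

theorem star_dotProduct_self_re_pos {v : Fin n → ℂ} (hv : v ≠ 0) :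
    ∃ r : ℝ, 0 < r ∧ star v ⬝ᵥ v = r := by
  refine ⟨∑ i, Complex.normSq (v i), ?_, ?_⟩
  · obtain ⟨i, hi⟩ := Function.ne_iff.1 hv
    exact Finset.sum_pos' (fun i _ => Complex.normSq_nonneg _)
      ⟨i, Finset.mem_univ _, Complex.normSq_pos.2 hi⟩
  · simp [dotProduct, Complex.normSq_eq_conj_mul_self]

/-- For a null vector v, the imaginary part of v*Qv is Im x · |v|² plus nonnegative terms from y and
z, since the symmetric real M contributes a real number. So it would be positive and zero. -/
theorem det_stable (M : Matrix (Fin n) (Fin n) ℝ) (hM : M.IsHermitian) (a : ι → Fin n → ℝ)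
    (b : Fin n → ℝ) {x y z : ℂ} (hx : 0 < x.im) (hy : 0 ≤ y.im) (hz : 0 ≤ z.im) :
    (x • (1 : Matrix (Fin n) (Fin n) ℂ) + z • (Matrix.vecMulVec b b).map (algebraMap ℝ ℂ)
      + (-1 : ℂ) • M.map (algebraMap ℝ ℂ)
      + y • (∑ s, Matrix.vecMulVec (a s) (a s)).map (algebraMap ℝ ℂ)).det ≠ 0 := by
  intro h0
  obtain ⟨v, hv, hv0⟩ := Matrix.exists_mulVec_eq_zero_iff.2 h0
  have h1 := congrArg (fun u => (star v ⬝ᵥ u).im) hv0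
  obtain ⟨r, hr, hrv⟩ := star_dotProduct_self_re_pos hv
  have hsum : (∑ s, Matrix.vecMulVec (a s) (a s)).map (algebraMap ℝ ℂ) =
      ∑ s, (Matrix.vecMulVec (a s) (a s)).map (algebraMap ℝ ℂ) := by
    ext i j; simp [Matrix.sum_apply]
  have hMv : (star v ⬝ᵥ (M.map (algebraMap ℝ ℂ)).mulVec v).im = 0 := by
    have hH : (M.map (algebraMap ℝ ℂ)).IsHermitian := by
      ext i j
      have := congrFun (congrFun hM i) j
      simp at this
      simp [this]
    exact hH.im_star_dotProduct_mulVec_self v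
  simp only [Matrix.add_mulVec, Matrix.smul_mulVec, dotProduct_add, dotProduct_smul, hsum,
    Matrix.one_mulVec, hrv, Matrix.sum_mulVec, dotProduct_sum, star_dotProduct_vecMulVec_mulVec,
    smul_eq_mul, Complex.add_im, dotProduct_zero, Complex.zero_im, ← Complex.ofReal_sum,
    Complex.im_mul_ofReal] at h1
  have h2 : (-1 * (star v ⬝ᵥ (M.map (algebraMap ℝ ℂ)).mulVec v)).im = 0 := by
    rw [neg_one_mul, Complex.neg_im, hMv, neg_zero]
  rw [h2] at h1
  have h3 := mul_pos hx hr
  have h4 := mul_nonneg hz (Complex.normSq_nonneg (∑ i, (b i : ℂ) * v i))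
  have h5 := mul_nonneg hy (Finset.sum_nonneg fun s (_ : s ∈ Finset.univ) =>
    Complex.normSq_nonneg (∑ i, (a s i : ℂ) * v i))
  linarith

/-- The Gauss-Lucas argument: a zero y of F - cF' has F'(y)/F(y) = 1/c, a real number. But F'/F is
the sum of 1/(y - z) over roots z in the open lower half-plane, and each term has negative imaginary
part. -/
theorem diffOp_stable {F : ℂ[X]} (hF : ∀ y : ℂ, 0 ≤ y.im → F.eval y ≠ 0) {c : ℝ} :
    0 ≤ c → ∀ y : ℂ, 0 ≤ y.im → (diffOp (-1 * (c : ℂ)) F).eval y ≠ 0 := by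
  intro hc y hy h0
  have hy0 := hF y hy
  have hsp : F.Splits := IsAlgClosed.splits F
  have h1 := hsp.eval_derivative_div_eval_of_ne_zero hy0
  have hc0 : (c : ℂ) ≠ 0 := by
    rintro h; apply hy0; simpa [diffOp_apply, h] using h0
  have h2 : F.derivative.eval y / F.eval y = ((c⁻¹ : ℝ) : ℂ) := by
    have : F.eval y = c * F.derivative.eval y := by
      simp [diffOp_apply] at h0; linear_combination h0
    rw [div_eq_iff hy0, this]; push_cast; field_simp
  have him : ∀ z ∈ F.roots, (1 / (y - z)).im < 0 := by
    intro z hz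
    have hz0 : z.im < 0 := by
      by_contra h
      exact hF z (not_lt.1 h) (isRoot_of_mem_roots hz)
    have hne : y - z ≠ 0 := fun h => by
      have := congrArg Complex.im h; simp at this; linarith
    rw [one_div, Complex.inv_im]
    exact div_neg_of_neg_of_pos (by simp; linarith) (Complex.normSq_pos.2 hne)
  rw [h2] at h1
  have h3 := congrArg Complex.im h1
  rw [Complex.ofReal_im] at h3
  have h4 : ∀ S : Multiset ℂ, (∀ z ∈ S, (1 / (y - z)).im < 0) → S ≠ 0 →
      ((S.map fun z => 1 / (y - z)).sum).im < 0 := by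
    intro S
    induction S using Multiset.induction_on with
    | empty => intro _ h; exact absurd rfl h
    | cons z S ih =>
      intro hS _
      rw [Multiset.map_cons, Multiset.sum_cons, Complex.add_im]
      have hz := hS z (Multiset.mem_cons_self _ _)
      rcases eq_or_ne S 0 with rfl | hne
      · simpa using hz
      · exact add_neg hz (ih (fun w hw => hS w (Multiset.mem_cons_of_mem hw)) hne)
  -- Without roots the logarithmic derivative is 0, which is not 1/c.
  rcases eq_or_ne F.roots 0 with hr | hr
  · rw [hr] at h1; simp at h1; exact hc0 (by simp [h1])
  · exact absurd h3.symm (h4 _ him hr).ne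

theorem iterate_diffOp_stable {F : ℂ[X]} (hF : ∀ y : ℂ, 0 ≤ y.im → F.eval y ≠ 0) {c : ℝ}
    (hc : 0 ≤ c) (q : ℕ) : ∀ y : ℂ, 0 ≤ y.im → ((diffOp (-1 * (c : ℂ)) ^ q) F).eval y ≠ 0 := by
  induction q with
  | zero => simpa using hF
  | succ q ih =>
    intro y hy
    rw [pow_succ', Module.End.mul_apply]
    exact diffOp_stable ih hc y hy

/-- Evaluation at `0` as a real-linear map. -/
def evalZero (K : Type*) [Field K] [Algebra ℝ K] : K[X] →ₗ[ℝ] K where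
  toFun F := F.eval 0
  map_add' _ _ := eval_add
  map_smul' r F := by
    rw [RingHom.id_apply, ← algebraMap_smul K r F, eval_smul, smul_eq_mul, Algebra.smul_def]

theorem expect_pencil_eval_zero {K : Type*} [Field K] [Algebra ℝ K] (p ω : ι → ℝ)
    (hp : ∑ s, p s = 1) (c : ℝ) (hc : ∀ s, p s * ω s = c)
    (a : ι → Fin n → ℝ) (κ : K) (N : Matrix (Fin n) (Fin n) K) (q : ℕ)
    (M : Matrix (Fin n) (Fin n) ℝ) :
    expect p (fun s => ω s • Matrix.vecMulVec (a s) (a s)) q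
      (fun M => (N + κ • M.map (algebraMap ℝ K)).det) M =
    ((diffOp (κ * algebraMap ℝ K c) ^ q) (pencil (N + κ • M.map (algebraMap ℝ K))
        ((∑ s, Matrix.vecMulVec (a s) (a s)).map (algebraMap ℝ K)))).eval 0 := by
  rw [← expect_pencil p ω hp c hc a κ N q M]
  refine Eq.trans ?_ (map_expect (evalZero K) _ _ _ _ _).symm
  congr 1; ext M
  exact (by rw [eval_pencil, zero_smul, add_zero] :
    _ = (pencil (N + κ • M.map (algebraMap ℝ K))
        ((∑ s, Matrix.vecMulVec (a s) (a s)).map (algebraMap ℝ K))).eval 0)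

variable (p ω : ι → ℝ) (a : ι → Fin n → ℝ)

theorem expect_det_stable (hp : ∑ s, p s = 1) {c : ℝ} (hc0 : 0 ≤ c) (hc : ∀ s, p s * ω s = c)
    (q : ℕ) {M : Matrix (Fin n) (Fin n) ℝ} (hM : M.IsHermitian) (b : Fin n → ℝ) {x z : ℂ}
    (hx : 0 < x.im) (hz : 0 ≤ z.im) :
    expect p (fun s => ω s • Matrix.vecMulVec (a s) (a s)) q
      (fun M => (x • (1 : Matrix (Fin n) (Fin n) ℂ)
        + z • (Matrix.vecMulVec b b).map (algebraMap ℝ ℂ)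
        + (-1 : ℂ) • M.map (algebraMap ℝ ℂ)).det) M ≠ 0 := by
  have h := expect_pencil_eval_zero (K := ℂ) p ω hp c hc a (-1) (x • (1 : Matrix (Fin n) (Fin n) ℂ)
        + z • (Matrix.vecMulVec b b).map (algebraMap ℝ ℂ)) q M
  rw [h]
  refine iterate_diffOp_stable (fun y hy => ?_) hc0 q 0 le_rfl
  rw [eval_pencil]
  exact det_stable M hM a b hx hy hz

end Stability

/-- Complex roots of a real polynomial come in conjugate pairs, so excluding the upper half-plane
excludes the lower one. -/
theorem splits_of_aeval_ne_zero {P : ℝ[X]} (hP : ∀ x : ℂ, 0 < x.im → aeval x P ≠ 0) :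
    P.Splits := by
  refine Splits.of_splits_map (algebraMap ℝ ℂ) (IsAlgClosed.splits _) fun x hx => ?_
  have hx0 : aeval x P = 0 := by
    rw [aeval_def, ← eval_map]; exact isRoot_of_mem_roots hx
  rcases lt_trichotomy x.im 0 with h | h | h
  · refine absurd ?_ (hP (starRingEnd ℂ x) (by simpa using h))
    rw [aeval_conj, hx0, map_zero]
  · exact ⟨x.re, Complex.ext rfl (by simp [h])⟩
  · exact absurd hx0 (hP x h)

/-! ### Expected characteristic polynomials -/

section ExpChar

variable {n : ℕ} {ι : Type*} [Fintype ι] (p ω : ι → ℝ) (a : ι → Fin n → ℝ)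

/-- The expected characteristic polynomial of `M` plus `q` random rank-one matrices. -/
def expChar (q : ℕ) (M : Matrix (Fin n) (Fin n) ℝ) : ℝ[X] :=
  expect p (fun s => ω s • Matrix.vecMulVec (a s) (a s)) q Matrix.charpoly M

theorem expChar_succ (q : ℕ) (M : Matrix (Fin n) (Fin n) ℝ) :
    expChar p ω a (q + 1) M =
      ∑ s, p s • expChar p ω a q (M + ω s • Matrix.vecMulVec (a s) (a s)) := rfl

theorem coeff_expChar (q : ℕ) (M : Matrix (Fin n) (Fin n) ℝ) (i : ℕ) :
    (expChar p ω a q M).coeff i = expect p (fun s => ω s • Matrix.vecMulVec (a s) (a s)) q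
      (fun M => M.charpoly.coeff i) M :=
  map_expect (Polynomial.lcoeff ℝ i) _ _ _ _ _

theorem natDegree_expChar_le (hp : ∑ s, p s = 1) (q : ℕ) (M : Matrix (Fin n) (Fin n) ℝ) :
    (expChar p ω a q M).natDegree ≤ n := by
  rw [natDegree_le_iff_coeff_eq_zero]
  intro i hi
  rw [coeff_expChar]
  have h (M : Matrix (Fin n) (Fin n) ℝ) : M.charpoly.coeff i = 0 :=
    coeff_eq_zero_of_natDegree_lt (by simpa [Matrix.charpoly_natDegree_eq_dim] using hi)
  simp_rw [h]
  exact expect_const _ hp _ _ _ _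

theorem coeff_expChar_top (hp : ∑ s, p s = 1) (q : ℕ) (M : Matrix (Fin n) (Fin n) ℝ) :
    (expChar p ω a q M).coeff n = 1 := by
  rw [coeff_expChar]
  have h (M : Matrix (Fin n) (Fin n) ℝ) : M.charpoly.coeff n = 1 := by
    have := M.charpoly_monic.coeff_natDegree
    rwa [Matrix.charpoly_natDegree_eq_dim, Fintype.card_fin] at this
  simp_rw [h]
  exact expect_const _ hp _ _ _ _

theorem monic_expChar (hp : ∑ s, p s = 1) (q : ℕ) (M : Matrix (Fin n) (Fin n) ℝ) :
    (expChar p ω a q M).Monic :=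
  monic_of_natDegree_le_of_coeff_eq_one n (natDegree_expChar_le p ω a hp q M)
    (coeff_expChar_top p ω a hp q M)

theorem natDegree_expChar (hp : ∑ s, p s = 1) (q : ℕ) (M : Matrix (Fin n) (Fin n) ℝ) :
    (expChar p ω a q M).natDegree = n :=
  natDegree_eq_of_le_of_coeff_ne_zero (natDegree_expChar_le p ω a hp q M)
    (by rw [coeff_expChar_top p ω a hp]; exact one_ne_zero)

theorem aeval_charpoly {K : Type*} [Field K] [Algebra ℝ K] (M : Matrix (Fin n) (Fin n) ℝ) (x : K) :
    aeval x M.charpoly =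
      (x • (1 : Matrix (Fin n) (Fin n) K) + (-1 : K) • M.map (algebraMap ℝ K)).det := by
  rw [aeval_def, ← eval_map, ← Matrix.charpoly_map, Matrix.eval_charpoly]
  congr 1
  rw [neg_one_smul, ← sub_eq_add_neg, Matrix.smul_one_eq_diagonal, Matrix.scalar_apply]

theorem aeval_expChar {K : Type*} [Field K] [Algebra ℝ K] (q : ℕ) (M : Matrix (Fin n) (Fin n) ℝ)
    (x : K) :
    aeval x (expChar p ω a q M) = expect p (fun s => ω s • Matrix.vecMulVec (a s) (a s)) q
      (fun M => (x • (1 : Matrix (Fin n) (Fin n) K) + (-1 : K) • M.map (algebraMap ℝ K)).det) M := by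
  simp_rw [← aeval_charpoly]
  exact map_expect (aeval x).toLinearMap _ _ _ _ _

variable {p ω a}

theorem aeval_expChar_ne_zero (hp : ∑ s, p s = 1) {c : ℝ} (hc0 : 0 ≤ c)
    (hc : ∀ s, p s * ω s = c) (q : ℕ) {M : Matrix (Fin n) (Fin n) ℝ} (hM : M.IsHermitian) {x : ℂ}
    (hx : 0 < x.im) : aeval x (expChar p ω a q M) ≠ 0 := by
  rw [aeval_expChar]
  simpa using expect_det_stable p ω a hp hc0 hc q hM 0 hx (z := 0) le_rfl

theorem splits_expChar (hp : ∑ s, p s = 1) {c : ℝ} (hc0 : 0 ≤ c)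
    (hc : ∀ s, p s * ω s = c) (q : ℕ) {M : Matrix (Fin n) (Fin n) ℝ} (hM : M.IsHermitian) :
    (expChar p ω a q M).Splits :=
  splits_of_aeval_ne_zero fun _ hx => aeval_expChar_ne_zero hp hc0 hc q hM hx

/-- Under the expectation the determinant is affine in the coefficient z of bbᵀ, say g + zh, and the
update by t bbᵀ is the value at z = -t. The quotient is therefore 1 - t h/g, and stability in z
controls the sign of Im(h/g). -/
theorem im_div_expChar_nonneg (hp : ∑ s, p s = 1) {c : ℝ} (hc0 : 0 ≤ c)
    (hc : ∀ s, p s * ω s = c) (q : ℕ) {M : Matrix (Fin n) (Fin n) ℝ} (hM : M.IsHermitian)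
    {t : ℝ} (ht : 0 ≤ t) (b : Fin n → ℝ) {x : ℂ} (hx : 0 < x.im) :
    0 ≤ (aeval x (expChar p ω a q (M + t • Matrix.vecMulVec b b)) /
      aeval x (expChar p ω a q M)).im := by
  set U := fun s => ω s • Matrix.vecMulVec (a s) (a s) with hU
  let N : Matrix (Fin n) (Fin n) ℝ → Matrix (Fin n) (Fin n) ℂ := fun M =>
    x • (1 : Matrix (Fin n) (Fin n) ℂ) + (-1 : ℂ) • M.map (algebraMap ℝ ℂ)
  let b' : Fin n → ℂ := fun i => (b i : ℂ)
  set g := expect p U q (fun M => (N M).det) M with hg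
  set h := expect p U q (fun M => b' ⬝ᵥ (N M).adjugate.mulVec b') M with hh
  have key (z : ℂ) : expect p U q (fun M => (N M + z • Matrix.vecMulVec b' b').det) M =
      g + z * h := by
    rw [hg, hh, ← expect_smul, ← expect_add]
    congr 1; ext M
    rw [← Matrix.smul_vecMulVec, Matrix.det_add_vecMulVec, Matrix.mulVec_smul, dotProduct_smul,
      smul_eq_mul]
  have hb' : (Matrix.vecMulVec b b).map (algebraMap ℝ ℂ) = Matrix.vecMulVec b' b' := by
    ext i j; simp [Matrix.vecMulVec_apply, b']
  have hne (z : ℂ) (hz : 0 ≤ z.im) : g + z * h ≠ 0 := by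
    rw [← key]
    have := expect_det_stable p ω a hp hc0 hc q hM b hx hz
    rw [hb'] at this
    convert this using 4
    simp only [N]; abel
  have hgM : aeval x (expChar p ω a q M) = g := aeval_expChar _ _ _ _ _ _
  have hfM : aeval x (expChar p ω a q (M + t • Matrix.vecMulVec b b)) = g + (-(t : ℂ)) * h := by
    rw [aeval_expChar, expect_add_right, ← key]
    congr 1; ext M; congr 1
    simp only [N, ← hb']
    ext i j; simp [Matrix.vecMulVec_apply]; ring
  have hg0 : g ≠ 0 := by simpa using hne 0 le_rfl
  rw [hgM, hfM, add_div, div_self hg0, mul_div_assoc]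
  by_contra hlt
  push Not at hlt
  have him : 0 < (h / g).im := by
    have : ((1 : ℂ) + -(t : ℂ) * (h / g)).im = - (t * (h / g).im) := by simp
    rw [this] at hlt
    by_contra h'
    nlinarith
  have hh0 : h ≠ 0 := by rintro h'; simp [h'] at him
  -- This z is the zero of g + zh; it lies in the closed upper half-plane because Im(h/g) > 0.
  refine hne (-(h / g)⁻¹) ?_ ?_
  · rw [Complex.neg_im, Complex.inv_im, neg_div, neg_neg]
    exact div_nonneg him.le (Complex.normSq_nonneg _)
  · field_simp; ring

end ExpChar

end WeightedRI

namespace WeightedRI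

/-! ### Counting roots by their arguments -/

section Count

open Filter Topology

/-- The argument of `t + i ε - a`. -/
def ang (ε t a : ℝ) : ℝ := Real.pi / 2 - Real.arctan ((t - a) / ε)

/-- The sum of the arguments of `t + i ε - a` over the elements `a` of a multiset. -/
def angSum (ε t : ℝ) (S : Multiset ℝ) : ℝ := (S.map (ang ε t)).sum

/-- The arctangent selects the branch of the argument with values in (0, π), which is continuous in
t and tends to 0 as t → ∞. -/
theorem ang_spec {ε : ℝ} (hε : 0 < ε) (t a : ℝ) :
    ∃ r : ℝ, 0 < r ∧ (⟨t, ε⟩ : ℂ) - a = r * Complex.exp (ang ε t a * Complex.I) := by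
  set u := (t - a) / ε with hu
  have hs : 0 < √(1 + u ^ 2) := Real.sqrt_pos.2 (by positivity)
  refine ⟨ε * √(1 + u ^ 2), by positivity, ?_⟩
  have h1 : t - a = ε * u := by rw [hu]; field_simp
  rw [Complex.exp_mul_I, ← Complex.ofReal_cos, ← Complex.ofReal_sin, ang,
    Real.cos_pi_div_two_sub, Real.sin_pi_div_two_sub, ← hu, Real.sin_arctan, Real.cos_arctan]
  apply Complex.ext
  · simp; rw [h1]; field_simp
  · simp; field_simp

theorem prod_spec {ε : ℝ} (hε : 0 < ε) (t : ℝ) (S : Multiset ℝ) :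
    ∃ r : ℝ, 0 < r ∧ (S.map fun a : ℝ => (⟨t, ε⟩ : ℂ) - a).prod =
      r * Complex.exp (angSum ε t S * Complex.I) := by
  induction S using Multiset.induction_on with
  | empty => exact ⟨1, one_pos, by simp [angSum]⟩
  | cons a S ih =>
    obtain ⟨r, hr, h⟩ := ih
    obtain ⟨r', hr', h'⟩ := ang_spec hε t a
    refine ⟨r' * r, by positivity, ?_⟩
    have hcons : angSum ε t (a ::ₘ S) = ang ε t a + angSum ε t S := by simp [angSum]
    rw [Multiset.map_cons, Multiset.prod_cons, h, h', hcons]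
    push_cast
    rw [add_mul, Complex.exp_add]; ring

theorem aeval_spec {f : ℝ[X]} (hf : f.Splits) (hm : f.Monic) {ε : ℝ} (hε : 0 < ε) (t : ℝ) :
    ∃ r : ℝ, 0 < r ∧ aeval (⟨t, ε⟩ : ℂ) f =
      r * Complex.exp (angSum ε t f.roots * Complex.I) := by
  obtain ⟨r, hr, h⟩ := prod_spec hε t f.roots
  refine ⟨r, hr, h ▸ ?_⟩
  conv_lhs => rw [hf.eq_prod_roots_of_monic hm]
  rw [map_multiset_prod, Multiset.map_map]
  congr 1
  refine Multiset.map_congr rfl fun a _ => ?_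
  simp

theorem continuous_angSum (ε : ℝ) (S : Multiset ℝ) :
    Continuous fun t => angSum ε t S := by
  induction S using Multiset.induction_on with
  | empty => simpa [angSum] using continuous_const
  | cons a S ih =>
    simp only [angSum, Multiset.map_cons, Multiset.sum_cons]
    refine Continuous.add ?_ ih
    unfold ang
    exact continuous_const.sub (Real.continuous_arctan.comp (by fun_prop))

theorem tendsto_angSum_atTop {ε : ℝ} (hε : 0 < ε) (S : Multiset ℝ) :
    Tendsto (fun t => angSum ε t S) atTop (𝓝 0) := by
  induction S using Multiset.induction_on with
  | empty => simp [angSum]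
  | cons a S ih =>
    simp only [angSum, Multiset.map_cons, Multiset.sum_cons]
    rw [show (0 : ℝ) = 0 + 0 by simp]
    refine Tendsto.add ?_ ih
    unfold ang
    have h : Tendsto (fun t : ℝ => (t - a) / ε) atTop atTop :=
      (tendsto_atTop_add_const_right _ (-a) tendsto_id).atTop_div_const hε
    have h2 := (tendsto_nhds_of_tendsto_nhdsWithin Real.tendsto_arctan_atTop).comp h
    simpa using h2.const_sub (Real.pi / 2)

/-- As the line descends to the real axis, the argument of r + iε - a tends to π if a > r and to 0
if a < r. -/
theorem tendsto_angSum_zero {r : ℝ} {S : Multiset ℝ} (hS : r ∉ S) :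
    Tendsto (fun ε => angSum ε r S) (𝓝[>] 0) (𝓝 ((S.countP (r < ·)) * Real.pi)) := by
  induction S using Multiset.induction_on with
  | empty => simp [angSum]
  | cons a S ih =>
    rw [Multiset.mem_cons, not_or] at hS
    simp only [angSum, Multiset.map_cons, Multiset.sum_cons, Multiset.countP_cons]
    push_cast
    rw [add_mul, add_comm]
    refine Tendsto.add ?_ (ih hS.2)
    unfold ang
    rcases lt_or_gt_of_ne hS.1 with h | h
    · have h1 : Tendsto (fun ε : ℝ => (r - a) / ε) (𝓝[>] 0) atBot := by
        simp_rw [div_eq_mul_inv]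
        exact tendsto_inv_nhdsGT_zero.const_mul_atTop_of_neg (by linarith)
      have h2 := (tendsto_nhds_of_tendsto_nhdsWithin Real.tendsto_arctan_atBot).comp h1
      simpa [h] using h2.const_sub (Real.pi / 2)
    · have h1 : Tendsto (fun ε : ℝ => (r - a) / ε) (𝓝[>] 0) atTop := by
        simp_rw [div_eq_mul_inv]
        exact tendsto_inv_nhdsGT_zero.const_mul_atTop (by linarith)
      have h2 := (tendsto_nhds_of_tendsto_nhdsWithin Real.tendsto_arctan_atTop).comp h1
      simpa [h.not_gt] using h2.const_sub (Real.pi / 2)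

/-- A nonnegative sine confines φ to the bands [2πj, (2j+1)π]. By continuity φ stays in one band,
and the limit 0 selects j = 0. -/
theorem mem_Icc_of_sin_nonneg {φ : ℝ → ℝ} (hφ : Continuous φ) (h0 : Tendsto φ atTop (𝓝 0))
    (hsin : ∀ t, 0 ≤ Real.sin (φ t)) (t : ℝ) : φ t ∈ Set.Icc 0 Real.pi := by
  have hpi := Real.pi_pos
  obtain ⟨T, hT, hT1, hT2⟩ := ((eventually_ge_atTop t).and
    ((h0.eventually_lt_const (show (0 : ℝ) < 1 by norm_num)).and
      (h0.eventually_const_lt (show (-1 : ℝ) < 0 by norm_num)))).exists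
  have hpi3 := Real.pi_gt_three
  by_contra hn
  rw [Set.mem_Icc, not_and_or, not_le, not_le] at hn
  rcases hn with hn | hn
  · -- a value in `(-π, 0)` would be attained
    have hv : max (φ t) (-1) ∈ Set.Icc (φ t) (φ T) ∨ φ T < max (φ t) (-1) := by
      rcases le_or_gt (max (φ t) (-1)) (φ T) with h | h
      · exact Or.inl ⟨le_max_left _ _, h⟩
      · exact Or.inr h
    rcases hv with hv | hv
    · obtain ⟨u, -, hu⟩ := intermediate_value_Icc hT hφ.continuousOn hv
      have := hsin u
      rw [hu] at this
      exact absurd this (not_le.2 (Real.sin_neg_of_neg_of_neg_pi_lt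
        (max_lt hn (by norm_num)) (lt_max_of_lt_right (by linarith))))
    · have hneg : φ T < 0 := hv.trans (max_lt hn (by norm_num))
      exact absurd (hsin T) (not_le.2 (Real.sin_neg_of_neg_of_neg_pi_lt hneg (by linarith)))
  -- This intermediate value lies in (π, 2π), where the sine is negative.
  · have hv : min (φ t) (Real.pi + 1) ∈ Set.Icc (φ T) (φ t) :=
      ⟨le_min (by linarith) (by linarith), min_le_left _ _⟩
    obtain ⟨u, -, hu⟩ := intermediate_value_Icc' hT hφ.continuousOn hv
    have h1 := hsin u
    rw [hu] at h1
    have h2 : Real.sin (min (φ t) (Real.pi + 1) - Real.pi) ≤ 0 := by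
      rw [Real.sin_sub_pi]; linarith
    have h3 : 0 < min (φ t) (Real.pi + 1) - Real.pi := by
      rw [sub_pos]; exact lt_min hn (by linarith)
    exact absurd h2 (not_le.2 (Real.sin_pos_of_pos_of_lt_pi h3
      (by linarith [min_le_right (φ t) (Real.pi + 1)])))

/-- The sign of Im(f/g) is that of the sine of the difference of arguments, so on every line Im x =
ε this difference lies in [0, π]. As ε → 0 it tends to π times the difference of the numbers of
roots above r, which is thus 0 or 1. -/
theorem countP_roots_of_im_div_nonneg {f g : ℝ[X]} (hf : f.Splits) (hfm : f.Monic)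
    (hg : g.Splits) (hgm : g.Monic)
    (h : ∀ x : ℂ, 0 < x.im → 0 ≤ (aeval x f / aeval x g).im) {r : ℝ} (hrf : r ∉ f.roots)
    (hrg : r ∉ g.roots) :
    g.roots.countP (r < ·) ≤ f.roots.countP (r < ·) ∧
      f.roots.countP (r < ·) ≤ g.roots.countP (r < ·) + 1 := by
  have key : ∀ ε : ℝ, 0 < ε →
      angSum ε r f.roots - angSum ε r g.roots ∈ Set.Icc 0 Real.pi := by
    intro ε hε
    refine mem_Icc_of_sin_nonneg (φ := fun t => angSum ε t f.roots - angSum ε t g.roots)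
      ((continuous_angSum ε _).sub (continuous_angSum ε _))
      (by simpa using (tendsto_angSum_atTop hε _).sub (tendsto_angSum_atTop hε _)) ?_ r
    intro t
    obtain ⟨r₁, hr₁, h₁⟩ := aeval_spec hf hfm hε t
    obtain ⟨r₂, hr₂, h₂⟩ := aeval_spec hg hgm hε t
    have := h ⟨t, ε⟩ hε
    rw [h₁, h₂, mul_div_mul_comm, ← Complex.exp_sub, ← sub_mul, ← Complex.ofReal_sub,
      ← Complex.ofReal_div, Complex.im_ofReal_mul, Complex.exp_ofReal_mul_I_im] at this
    exact nonneg_of_mul_nonneg_right this (div_pos hr₁ hr₂)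
  have hlim := (tendsto_angSum_zero hrf).sub (tendsto_angSum_zero hrg)
  have hmem := isClosed_Icc.mem_of_tendsto hlim
    (eventually_nhdsWithin_of_forall fun ε hε => key ε hε)
  rw [← sub_mul] at hmem
  have hpi := Real.pi_pos
  constructor
  · have := nonneg_of_mul_nonneg_left hmem.1 hpi
    exact_mod_cast sub_nonneg.1 this
  · have : ((f.roots.countP (r < ·) : ℝ) - g.roots.countP (r < ·)) ≤ 1 := by
      by_contra hlt; nlinarith [hmem.2]
    rw [sub_le_iff_le_add, add_comm] at this
    exact_mod_cast this

theorem neg_one_pow_countP_mul_eval_pos {f : ℝ[X]} (hf : f.Splits) (hm : f.Monic) {r : ℝ}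
    (hr : r ∉ f.roots) : 0 < (-1) ^ f.roots.countP (r < ·) * f.eval r := by
  have h : ∀ S : Multiset ℝ, r ∉ S →
      0 < (-1) ^ S.countP (r < ·) * (S.map fun a => r - a).prod := by
    intro S
    induction S using Multiset.induction_on with
    | empty => simp
    | cons a S ih =>
      intro hS
      rw [Multiset.mem_cons, not_or] at hS
      have := ih hS.2
      rw [Multiset.countP_cons, Multiset.map_cons, Multiset.prod_cons]
      rcases lt_or_gt_of_ne hS.1 with h | h
      · rw [if_pos h, pow_succ]
        nlinarith [mul_pos this (sub_pos.2 h)]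
      · rw [if_neg h.not_gt, add_zero]
        nlinarith [mul_pos this (sub_pos.2 h)]
  rw [hf.eval_eq_prod_roots_of_monic hm]
  exact h _ hr

end Count

/-! ### The `k`-th largest root -/

theorem lt_getD_iff_le_countP (x : ℝ) (L : List ℝ) (hL : L.Pairwise (· ≥ ·)) (k : ℕ)
    (hk : k < L.length) : x < L.getD k 0 ↔ k + 1 ≤ L.countP (x < ·) := by
  induction L generalizing k with
  | nil => simp at hk
  | cons a L ih =>
    rw [List.pairwise_cons] at hL
    rw [List.countP_cons]
    cases k with
    | zero =>
      rw [List.getD_cons_zero]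
      by_cases h : x < a
      · simp [h]
      · have : L.countP (x < ·) = 0 := by
          rw [List.countP_eq_zero]
          intro b hb; have := hL.1 b hb; simp; linarith [not_lt.1 h]
        simp [h, this]
    | succ k =>
      rw [List.length_cons] at hk
      rw [List.getD_cons_succ, ih hL.2 k (by omega)]
      by_cases h : x < a
      · simp [h]
      · have : L.countP (x < ·) = 0 := by
          rw [List.countP_eq_zero]
          intro b hb; have := hL.1 b hb; simp; linarith [not_lt.1 h]
        simp [h, this]

/-- Turns comparisons of k-th roots into root counting; the bound on k rules out the default value
0. -/
theorem lt_kthLargestRoot_iff {p : ℝ[X]} {k : ℕ} (hk : 1 ≤ k) (hkp : k ≤ p.roots.card) (x : ℝ) :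
    x < kthLargestRoot k p ↔ k ≤ p.roots.countP (x < ·) := by
  rw [kthLargestRoot, lt_getD_iff_le_countP x _ (Multiset.pairwise_sort _ _) (k - 1)
    (by rw [Multiset.length_sort]; omega), Nat.sub_add_cancel hk]
  conv_rhs => rw [← Multiset.sort_eq p.roots (· ≥ ·), Multiset.coe_countP]

theorem kthLargestRoot_C_mul {c : ℝ} (hc : c ≠ 0) (k : ℕ) (p : ℝ[X]) :
    kthLargestRoot k (C c * p) = kthLargestRoot k p := by
  rw [kthLargestRoot, kthLargestRoot, roots_C_mul _ hc]

/-- If all quotients `f s / g` map the upper half-plane to its closure, then the `k`-th largest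
root of an average of the `f s` is at most the maximum of their `k`-th largest roots. -/
theorem exists_kthLargestRoot_sum_le {ι : Type*} [Fintype ι] [Nonempty ι] {p : ι → ℝ}
    (hp0 : ∀ s, 0 < p s) {f : ι → ℝ[X]} {F g : ℝ[X]} (hF : F = ∑ s, p s • f s) {k : ℕ} (hk : 1 ≤ k)
    (hf : ∀ s, (f s).Splits) (hfm : ∀ s, (f s).Monic) (hfk : ∀ s, k ≤ (f s).natDegree)
    (hFs : F.Splits) (hFm : F.Monic) (hFk : k ≤ F.natDegree) (hg : g.Splits) (hgm : g.Monic)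
    (h : ∀ s, ∀ x : ℂ, 0 < x.im → 0 ≤ (aeval x (f s) / aeval x g).im) :
    ∃ s, kthLargestRoot k F ≤ kthLargestRoot k (f s) := by
  by_contra! hlt
  -- The half-plane condition passes to nonnegative combinations, so F can be compared with the same
  -- g.
  have hFim : ∀ x : ℂ, 0 < x.im → 0 ≤ (aeval x F / aeval x g).im := by
    intro x hx
    rw [hF, map_sum, Finset.sum_div, Complex.im_sum]
    refine Finset.sum_nonneg fun s _ => ?_
    rw [map_smul, smul_div_assoc, Complex.smul_im]
    exact mul_nonneg (hp0 s).le (h s x hx)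
  obtain ⟨s₀, -, hs₀⟩ := Finset.exists_max_image Finset.univ (fun s => kthLargestRoot k (f s))
    Finset.univ_nonempty
  let Z : Set ℝ := {r | r ∈ F.roots} ∪ {r | r ∈ g.roots} ∪ ⋃ s, {r | r ∈ (f s).roots}
  have hZ : Z.Finite := by
    refine ((Multiset.finite_toSet _).union (Multiset.finite_toSet _)).union
      (Set.finite_iUnion fun s => Multiset.finite_toSet _)
  -- A point r above all λ_k(f_s), below λ_k(F), and not a root of any polynomial involved.
  obtain ⟨r, ⟨hr1, hr2⟩, hrZ⟩ := ((Set.Ioo_infinite (hlt s₀)).sdiff hZ).nonempty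
  simp only [Z, Set.mem_union, Set.mem_iUnion, Set.mem_ofPred_eq, not_or, not_exists] at hrZ
  obtain ⟨⟨hrF, hrg⟩, hrf⟩ := hrZ
  have hcF := (lt_kthLargestRoot_iff hk (hFs.natDegree_eq_card_roots ▸ hFk) r).1 hr2
  have hcf (s) : (f s).roots.countP (r < ·) < k := by
    by_contra hn
    have := (lt_kthLargestRoot_iff hk ((hf s).natDegree_eq_card_roots ▸ hfk s) r).2 (not_lt.1 hn)
    linarith [hs₀ s (Finset.mem_univ _)]
  have hIF := countP_roots_of_im_div_nonneg hFs hFm hg hgm hFim hrF hrg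
  have hIf (s) := countP_roots_of_im_div_nonneg (hf s) (hfm s) hg hgm (h s) (hrf s) hrg
  -- Above r, F has at least k roots and each f_s at most k - 1. Comparison with g allows only k for
  -- F and k - 1 for all f_s. Thus all f_s(r) have the sign of (-1)^(k-1), and so has their weighted
  -- sum F(r), whose sign should be that of (-1)^k.
  have hFeq : F.roots.countP (r < ·) = (k - 1) + 1 := by
    have := hcf s₀; have := hIf s₀; omega
  have hfeq (s) : (f s).roots.countP (r < ·) = k - 1 := by
    have := hcf s; have := hIf s; omega
  have hsF := neg_one_pow_countP_mul_eval_pos hFs hFm hrF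
  have hsf (s) := neg_one_pow_countP_mul_eval_pos (hf s) (hfm s) (hrf s)
  rw [hFeq, hF, pow_succ, eval_finsetSum] at hsF
  have : 0 ≤ (-1) ^ (k - 1) * ∑ s, eval r (p s • f s) := by
    rw [Finset.mul_sum]
    refine Finset.sum_nonneg fun s _ => ?_
    have := hsf s
    rw [hfeq] at this
    rw [eval_smul, smul_eq_mul, mul_left_comm]
    exact mul_nonneg (hp0 s).le this.le
  linarith

end WeightedRI

namespace WeightedRI

/-! ### Real-rootedness and the greedy bound -/

section Greedy

variable {n m : ℕ} (A : Matrix (Fin n) (Fin m) ℝ) (w : Fin m → ℝ)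

/-- The sum of the weighted rank-one matrices of a list of columns. -/
def listMat (l : List (Fin m)) : Matrix (Fin n) (Fin n) ℝ :=
  (l.map fun s => w s ^ 2 • Matrix.vecMulVec (A.col s) (A.col s)).sum

/-- The monic multiple of `partialPoly A w k l`. -/
def monicPoly (k : ℕ) (l : List (Fin m)) : ℝ[X] :=
  expChar (colProb w) (fun s => w s ^ 2) A.col (k - l.length) (listMat A w l)

theorem listMat_append_singleton (l : List (Fin m)) (s : Fin m) :
    listMat A w (l ++ [s]) =
      listMat A w l + w s ^ 2 • Matrix.vecMulVec (A.col s) (A.col s) := by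
  simp [listMat]

/-- Splitting off the first free index matches the recursion of `expect`; its probability goes into
the product in front. -/
theorem sum_fullPoly (q : ℕ) (l : List (Fin m)) :
    ∑ t : Fin q → Fin m, fullPoly A w (l ++ List.ofFn t) =
      C (l.map (colProb w)).prod *
        expChar (colProb w) (fun s => w s ^ 2) A.col q (listMat A w l) := by
  induction q generalizing l with
  | zero => simp [fullPoly, expChar, expect, listMat]
  | succ q ih =>
    rw [expChar_succ, Finset.mul_sum, ← (Fin.consEquiv fun _ => Fin m).sum_comp,
      Fintype.sum_prod_type]
    refine Finset.sum_congr rfl fun s _ => ?_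
    have h (t : Fin q → Fin m) : l ++ List.ofFn ((Fin.consEquiv fun _ => Fin m) (s, t)) =
        (l ++ [s]) ++ List.ofFn t := by
      simp [Fin.consEquiv, List.ofFn_succ]
    simp_rw [h]
    rw [ih, listMat_append_singleton, smul_eq_C_mul, ← mul_assoc, ← C_mul]
    simp

theorem partialPoly_eq (k : ℕ) (l : List (Fin m)) :
    partialPoly A w k l = C (l.map (colProb w)).prod * monicPoly A w k l :=
  sum_fullPoly A w _ l

theorem posSemidef_listMat (l : List (Fin m)) : (listMat A w l).PosSemidef := by
  induction l with
  | nil => exact Matrix.PosSemidef.zero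
  | cons s l ih =>
    rw [listMat, List.map_cons, List.sum_cons]
    exact ((by simpa using Matrix.posSemidef_vecMulVec_self_star (A.col s) :
      (Matrix.vecMulVec (A.col s) (A.col s)).PosSemidef).smul (sq_nonneg (w s))).add ih

variable {w}

theorem sum_inv_sq_pos [Nonempty (Fin m)] (hw : ∀ i, w i ≠ 0) : 0 < ∑ j, (w j ^ 2)⁻¹ :=
  Finset.sum_pos (fun i _ => by have := hw i; positivity) Finset.univ_nonempty

theorem colProb_pos (hw : ∀ i, w i ≠ 0) (i : Fin m) : 0 < colProb w i := by
  have : Nonempty (Fin m) := ⟨i⟩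
  have := hw i
  exact div_pos (by positivity) (sum_inv_sq_pos hw)

theorem sum_colProb [Nonempty (Fin m)] (hw : ∀ i, w i ≠ 0) : ∑ s, colProb w s = 1 := by
  simp only [colProb]
  rw [← Finset.sum_div, div_self (sum_inv_sq_pos hw).ne']

/-- The reason for this choice of probabilities: the constant c of `expect_pencil`. -/
theorem colProb_mul_sq (hw : ∀ i, w i ≠ 0) (i : Fin m) :
    colProb w i * w i ^ 2 = (∑ j, (w j ^ 2)⁻¹)⁻¹ := by
  have := hw i
  rw [colProb]; field_simp

theorem prod_colProb_ne_zero (hw : ∀ i, w i ≠ 0) (l : List (Fin m)) :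
    (l.map (colProb w)).prod ≠ 0 := by
  refine List.prod_ne_zero ?_
  simp only [List.mem_map, not_exists, not_and]
  exact fun i _ => (colProb_pos hw i).ne'

theorem kthLargestRoot_partialPoly (hw : ∀ i, w i ≠ 0) (j k : ℕ) (l : List (Fin m)) :
    kthLargestRoot j (partialPoly A w k l) = kthLargestRoot j (monicPoly A w k l) := by
  rw [partialPoly_eq, kthLargestRoot_C_mul (prod_colProb_ne_zero hw l)]

section Nonempty

variable [Nonempty (Fin m)]

theorem splits_monicPoly (hw : ∀ i, w i ≠ 0) (k : ℕ) (l : List (Fin m)) :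
    (monicPoly A w k l).Splits :=
  splits_expChar (sum_colProb hw) (inv_nonneg.2 (sum_inv_sq_pos hw).le) (colProb_mul_sq hw) _
    (posSemidef_listMat A w l).isHermitian

theorem monic_monicPoly (hw : ∀ i, w i ≠ 0) (k : ℕ) (l : List (Fin m)) :
    (monicPoly A w k l).Monic :=
  monic_expChar _ _ _ (sum_colProb hw) _ _

theorem natDegree_monicPoly (hw : ∀ i, w i ≠ 0) (k : ℕ) (l : List (Fin m)) :
    (monicPoly A w k l).natDegree = n :=
  natDegree_expChar _ _ _ (sum_colProb hw) _ _

theorem splits_partialPoly (hw : ∀ i, w i ≠ 0) (k : ℕ) (l : List (Fin m)) :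
    (partialPoly A w k l).Splits := by
  rw [partialPoly_eq]
  exact (splits_monicPoly A hw k l).C_mul _

theorem natDegree_partialPoly (hw : ∀ i, w i ≠ 0) (k : ℕ) (l : List (Fin m)) :
    (partialPoly A w k l).natDegree = n := by
  rw [partialPoly_eq, natDegree_C_mul (prod_colProb_ne_zero hw l), natDegree_monicPoly A hw]

theorem card_roots_monicPoly (hw : ∀ i, w i ≠ 0) (k : ℕ) (l : List (Fin m)) :
    (monicPoly A w k l).roots.card = n := by
  rw [← (splits_monicPoly A hw k l).natDegree_eq_card_roots, natDegree_monicPoly A hw]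

/-- The common comparison polynomial g has one random draw fewer and no new column. Each candidate's
polynomial arises from it by a rank-one update. -/
theorem exists_kthLargestRoot_le (hw : ∀ i, w i ≠ 0) {j k : ℕ} (hj : 1 ≤ j) (hjn : j ≤ n)
    (l : List (Fin m)) (hl : l.length < k) :
    ∃ s, kthLargestRoot j (monicPoly A w k l) ≤ kthLargestRoot j (monicPoly A w k (l ++ [s])) := by
  have hlen : k - l.length = (k - l.length - 1) + 1 := by omega
  have hlen' (s : Fin m) : k - (l ++ [s]).length = k - l.length - 1 := by simp; omega
  refine exists_kthLargestRoot_sum_le (colProb_pos hw) (f := fun s => monicPoly A w k (l ++ [s]))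
    (g := expChar (colProb w) (fun s => w s ^ 2) A.col (k - l.length - 1) (listMat A w l))
    ?_ hj (fun s => splits_monicPoly A hw k _) (fun s => monic_monicPoly A hw k _)
    (fun s => hjn.trans (natDegree_monicPoly A hw k _).ge) (splits_monicPoly A hw k _)
    (monic_monicPoly A hw k _) (hjn.trans (natDegree_monicPoly A hw k _).ge)
    (splits_expChar (sum_colProb hw) (inv_nonneg.2 (sum_inv_sq_pos hw).le) (colProb_mul_sq hw) _
      (posSemidef_listMat A w l).isHermitian)
    (monic_expChar _ _ _ (sum_colProb hw) _ _) ?_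
  · rw [monicPoly, hlen, expChar_succ]
    refine Finset.sum_congr rfl fun s _ => ?_
    rw [monicPoly, listMat_append_singleton, hlen']
  · intro s x hx
    rw [monicPoly, listMat_append_singleton, hlen']
    exact im_div_expChar_nonneg (sum_colProb hw) (inv_nonneg.2 (sum_inv_sq_pos hw).le)
      (colProb_mul_sq hw) _ (posSemidef_listMat A w l).isHermitian (sq_nonneg _) _ hx

/-- For M positive semidefinite, (-1)^n det(x - M) = det(-x + M) > 0 when x < 0, and positivity
survives averaging. Hence there are no negative roots. -/
theorem eval_monicPoly_pos (hw : ∀ i, w i ≠ 0) (k : ℕ) (l : List (Fin m)) {x : ℝ} (hx : x < 0) :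
    0 < (-1) ^ n * (monicPoly A w k l).eval x := by
  let φ : ℝ[X] →ₗ[ℝ] ℝ := ((-1 : ℝ) ^ n) • Polynomial.leval x
  have h : φ (monicPoly A w k l) = _ := map_expect φ _ _ _ _ _
  have h0 : φ (monicPoly A w k l) = (-1) ^ n * (monicPoly A w k l).eval x := rfl
  rw [← h0, h]
  refine expect_mem (S := fun v : ℝ => 0 < v) (T := Matrix.PosSemidef) _ _ ?_ ?_ _ _ ?_ _
    (posSemidef_listMat A w l)
  · exact fun f hf => Finset.sum_pos (fun s _ => mul_pos (colProb_pos hw s) (hf s))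
      Finset.univ_nonempty
  · exact fun M hM s => hM.add ((by simpa using Matrix.posSemidef_vecMulVec_self_star (A.col s) :
      (Matrix.vecMulVec (A.col s) (A.col s)).PosSemidef).smul (sq_nonneg (w s)))
  · intro M hM
    change 0 < (-1) ^ n * M.charpoly.eval x
    rw [Matrix.eval_charpoly]
    have h1 : ((-x) • (1 : Matrix (Fin n) (Fin n) ℝ) + M).PosDef :=
      (Matrix.PosDef.one.smul (neg_pos.2 hx)).add_posSemidef hM
    have h2 := h1.det_pos
    have h3 : (-x) • (1 : Matrix (Fin n) (Fin n) ℝ) + M = -(Matrix.scalar (Fin n) x - M) := by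
      rw [Matrix.scalar_apply, ← Matrix.smul_one_eq_diagonal, neg_smul]; abel
    rwa [h3, Matrix.det_neg, Fintype.card_fin] at h2

theorem kthLargestRoot_monicPoly_nonneg (hw : ∀ i, w i ≠ 0) {j : ℕ} (k : ℕ) (hj : 1 ≤ j) (hjn : j ≤ n)
    (l : List (Fin m)) : 0 ≤ kthLargestRoot j (monicPoly A w k l) := by
  have hmem : kthLargestRoot j (monicPoly A w k l) ∈ (monicPoly A w k l).roots := by
    have hlt : j - 1 < ((monicPoly A w k l).roots.sort (· ≥ ·)).length := by
      rw [Multiset.length_sort, card_roots_monicPoly A hw]; omega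
    rw [kthLargestRoot, List.getD_eq_getElem _ _ hlt, ← Multiset.mem_sort (r := (· ≥ ·))]
    exact List.getElem_mem hlt
  by_contra hlt
  have h1 := eval_monicPoly_pos A hw k l (not_le.1 hlt)
  rw [isRoot_of_mem_roots hmem, mul_zero] at h1
  exact lt_irrefl _ h1

end Nonempty

theorem listMat_eq_mul (l : List (Fin m)) :
    ∃ V : Matrix l.toFinset (Fin n) ℝ, listMat A w l = colsOf A l.toFinset * V := by
  refine ⟨Matrix.of fun s i => (l.count s.1 : ℝ) * w s ^ 2 * A i s, ?_⟩
  rw [listMat, Finset.sum_list_map_count]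
  ext i j
  rw [Matrix.sum_apply, Matrix.mul_apply, ← Finset.sum_coe_sort]
  refine Finset.sum_congr rfl fun s _ => ?_
  simp [Matrix.vecMulVec_apply, colsOf]; ring

/-- The matrix factors through the fewer than k distinct columns, and exchanging the two factors
changes the characteristic polynomial by a power of X. -/
theorem X_pow_dvd_charpoly_listMat {k : ℕ} (hkn : k ≤ n) (l : List (Fin m))
    (hl : l.toFinset.card < k) : X ^ (n + 1 - k) ∣ (listMat A w l).charpoly := by
  obtain ⟨V, hV⟩ := listMat_eq_mul A (w := w) l
  rw [hV, Matrix.charpoly_mul_comm_of_le _ _ (by rw [Fintype.card_coe, Fintype.card_fin]; omega)]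
  refine Dvd.dvd.mul_right (pow_dvd_pow _ ?_) _
  rw [Fintype.card_coe, Fintype.card_fin]; omega

/-- Every completion of a list with a repetition has fewer than k distinct columns, so 0 is a root
of multiplicity at least n + 1 - k of the sum. At most k - 1 positive roots remain. -/
theorem kthLargestRoot_nonpos_of_not_nodup [Nonempty (Fin m)] (hw : ∀ i, w i ≠ 0) {k : ℕ}
    (hk : 1 ≤ k) (hkn : k ≤ n) (l : List (Fin m)) (hl : l.length ≤ k) (hnd : ¬ l.Nodup) :
    kthLargestRoot k (monicPoly A w k l) ≤ 0 := by
  have hdvd : X ^ (n + 1 - k) ∣ partialPoly A w k l := by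
    refine Finset.dvd_sum fun t _ => Dvd.dvd.mul_left ?_ _
    refine X_pow_dvd_charpoly_listMat A hkn _ ?_
    have h1 : ¬ (l ++ List.ofFn t).Nodup := fun h => hnd (List.nodup_append.1 h).1
    have h2 := List.toFinset_card_le (l ++ List.ofFn t)
    have h3 : (l ++ List.ofFn t).length = k := by simp; omega
    refine lt_of_le_of_ne (h2.trans h3.le) fun h => h1 ?_
    rw [List.card_toFinset] at h
    rw [← (List.dedup_sublist _).eq_of_length (h.trans h3.symm)]
    exact List.nodup_dedup _
  rw [partialPoly_eq, (isUnit_C.2 (prod_colProb_ne_zero hw l).isUnit).dvd_mul_left] at hdvd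
  have hne := (monic_monicPoly A hw k l).ne_zero
  have hcount : n + 1 - k ≤ (monicPoly A w k l).roots.count 0 := by
    rw [count_roots, le_rootMultiplicity_iff hne]
    simpa using hdvd
  by_contra hlt
  have hk2 := (lt_kthLargestRoot_iff hk (by rw [card_roots_monicPoly A hw]; exact hkn) 0).1
    (not_le.1 hlt)
  have hle : (monicPoly A w k l).roots.countP (0 < ·) + (monicPoly A w k l).roots.count 0 ≤
      (monicPoly A w k l).roots.card := by
    rw [Multiset.card_eq_countP_add_countP (0 < ·), Multiset.count]
    refine Nat.add_le_add_left ?_ _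
    rw [Multiset.countP_eq_card_filter, Multiset.countP_eq_card_filter]
    exact Multiset.card_le_card (Multiset.monotone_filter_right _ fun x hx => by simp [← hx])
  rw [card_roots_monicPoly A hw] at hle
  omega

theorem listMat_eq_mul_transpose {l : List (Fin m)} (hl : l.Nodup) :
    listMat A w l = (colsOf A l.toFinset * weightsOf w l.toFinset) *
      (colsOf A l.toFinset * weightsOf w l.toFinset).transpose := by
  have hB : ∀ i (s : l.toFinset), (colsOf A l.toFinset * weightsOf w l.toFinset) i s =
      A i s * w s := by
    intro i s
    have : weightsOf w l.toFinset = Matrix.diagonal (w ∘ Subtype.val) :=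
      Matrix.submatrix_diagonal _ _ Subtype.val_injective
    rw [this, Matrix.mul_diagonal]; rfl
  rw [listMat, ← List.sum_toFinset _ hl]
  ext i j
  rw [Matrix.sum_apply, Matrix.mul_apply, ← Finset.sum_coe_sort]
  refine Finset.sum_congr rfl fun s _ => ?_
  rw [Matrix.transpose_apply, hB, hB]
  rw [Matrix.smul_apply, Matrix.vecMulVec_apply, smul_eq_mul, Matrix.col_apply, Matrix.col_apply]
  ring

end Greedy

/-! ### The least singular value -/

section Sigma

variable {n : ℕ} {ι : Type} [Fintype ι] [DecidableEq ι]

/-- Expansion in an eigenbasis; passing through the least eigenvalue keeps the inequality strict. -/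
theorem mul_norm_sq_lt_of_lt_eigenvalues {G : Matrix ι ι ℝ} (hG : G.IsHermitian) {μ : ℝ}
    (h : ∀ i, μ < hG.eigenvalues i) {x : EuclideanSpace ℝ ι} (hx : ‖x‖ = 1) :
    μ < inner ℝ x (Matrix.toEuclideanLin G x) := by
  have hne : Nonempty ι := by
    by_contra hemp
    rw [not_nonempty_iff] at hemp
    have : x = 0 := Subsingleton.elim _ _
    simp [this] at hx
  have hsymm := Matrix.isSymmetric_toEuclideanLin_iff.2 hG
  have h1 := hG.eigenvectorBasis.sum_inner_mul_inner x (Matrix.toEuclideanLin G x)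
  have h2 (i) : inner ℝ (hG.eigenvectorBasis i) (Matrix.toEuclideanLin G x) =
      hG.eigenvalues i * inner ℝ (hG.eigenvectorBasis i) x := by
    rw [← hsymm, ← real_inner_smul_left]
    congr 1
    have := hG.mulVec_eigenvectorBasis i
    ext j
    exact congrFun this j
  have h3 := hG.eigenvectorBasis.sum_inner_mul_inner x x
  rw [real_inner_self_eq_norm_sq, hx, one_pow] at h3
  simp_rw [h2, real_inner_comm x (hG.eigenvectorBasis _)] at h1
  simp_rw [real_inner_comm x (hG.eigenvectorBasis _)] at h3
  rw [← h1]
  obtain ⟨i₀, -, hi₀⟩ := Finset.exists_min_image Finset.univ hG.eigenvalues Finset.univ_nonempty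
  calc μ < hG.eigenvalues i₀ := h i₀
    _ = ∑ i, hG.eigenvalues i₀ *
        (inner ℝ x (hG.eigenvectorBasis i) * inner ℝ x (hG.eigenvectorBasis i)) := by
      rw [← Finset.mul_sum, h3, mul_one]
    _ ≤ _ := by
      refine Finset.sum_le_sum fun i _ => ?_
      nlinarith [hi₀ i (Finset.mem_univ _),
        mul_self_nonneg (inner ℝ x (hG.eigenvectorBasis i))]

/-- The polynomials of BBᵀ and BᵀB differ by a power of X, whose roots 0 do not exceed ‖Bx‖². If the
root in question exceeded ‖Bx‖² for a unit vector x, then so would all eigenvalues of BᵀB, and hence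
the Rayleigh quotient at x, which equals ‖Bx‖². -/
theorem kthLargestRoot_le_sigmaMin_sq [Nonempty ι] (B : Matrix (Fin n) ι ℝ)
    (hn : Fintype.card ι ≤ n) :
    kthLargestRoot (Fintype.card ι) (B * B.transpose).charpoly ≤ sigmaMin B ^ 2 := by
  set r := kthLargestRoot (Fintype.card ι) (B * B.transpose).charpoly with hr
  have hH : (B.transpose * B).IsHermitian := by
    simpa using Matrix.isHermitian_conjTranspose_mul_self B
  have hH' : (B * B.transpose).IsHermitian := by
    simpa using Matrix.isHermitian_mul_conjTranspose_self B
  have hle : ∀ x : EuclideanSpace ℝ ι, ‖x‖ = 1 → r ≤ ‖Matrix.toEuclideanLin B x‖ ^ 2 := by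
    intro x hx
    by_contra hlt
    rw [not_le, hr, lt_kthLargestRoot_iff Fintype.card_pos
      (by rw [← hH'.splits_charpoly.natDegree_eq_card_roots, Matrix.charpoly_natDegree_eq_dim,
        Fintype.card_fin]; exact hn),
      Matrix.charpoly_mul_comm_of_le _ _ (by simpa using hn), roots_mul
        (mul_ne_zero (pow_ne_zero _ X_ne_zero) (Matrix.charpoly_monic _).ne_zero),
      roots_X_pow, Multiset.countP_add, Multiset.countP_nsmul] at hlt
    have h0 : Multiset.countP (fun y => ‖Matrix.toEuclideanLin B x‖ ^ 2 < y) {0} = 0 := by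
      rw [Multiset.countP_eq_zero]
      intro y hy
      rw [Multiset.mem_singleton.1 hy]
      exact not_lt.2 (sq_nonneg _)
    have hcard : (B.transpose * B).charpoly.roots.card = Fintype.card ι := by
      rw [← hH.splits_charpoly.natDegree_eq_card_roots, Matrix.charpoly_natDegree_eq_dim]
    rw [h0, mul_zero, zero_add, ← hcard] at hlt
    have hall := Multiset.countP_eq_card.1 (le_antisymm (Multiset.countP_le_card _ _) hlt)
    have := mul_norm_sq_lt_of_lt_eigenvalues hH (μ := ‖Matrix.toEuclideanLin B x‖ ^ 2)
      (fun i => hall _ (by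
        rw [hH.roots_charpoly_eq_eigenvalues]
        exact Multiset.mem_map.2 ⟨i, Finset.mem_univ _, rfl⟩)) hx
    refine lt_irrefl _ (this.trans_eq ?_)
    rw [← real_inner_self_eq_norm_sq]
    simp only [EuclideanSpace.inner_eq_star_dotProduct, Matrix.toEuclideanLin, Matrix.ofLp_toLpLin,
      Matrix.toLin'_apply]
    simp [← Matrix.mulVec_mulVec, Matrix.dotProduct_mulVec,
      dotProduct_comm, Matrix.mulVec_transpose]
  have : Nonempty {x : EuclideanSpace ℝ ι // ‖x‖ = 1} :=
    ⟨⟨EuclideanSpace.single (Classical.arbitrary ι) 1, by simp⟩⟩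
  rcases lt_or_ge r 0 with h | h
  · exact h.le.trans (sq_nonneg _)
  · have h1 : √r ≤ sigmaMin B := le_ciInf fun x => Real.sqrt_le_iff.2
      ⟨norm_nonneg _, hle x.1 x.2⟩
    calc r = √r ^ 2 := (Real.sq_sqrt h).symm
      _ ≤ _ := pow_le_pow_left₀ (Real.sqrt_nonneg _) h1 2

end Sigma

/-! ### The bound along a greedy run. -/

theorem GreedyRun.nodup {n m k : ℕ} {A : Matrix (Fin n) (Fin m) ℝ} {w : Fin m → ℝ}
    {l : List (Fin m)} (h : GreedyRun A w k l) : l.Nodup := by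
  induction h with
  | nil => exact List.nodup_nil
  | snoc l s _ hs _ ih => exact List.nodup_append.2 ⟨ih, by simp, by
      intro a ha b hb; rw [List.mem_singleton.1 hb]; exact fun h => hs (h ▸ ha)⟩

theorem GreedyRun.kthLargestRoot_le {n m k : ℕ} {A : Matrix (Fin n) (Fin m) ℝ} {w : Fin m → ℝ}
    [Nonempty (Fin m)] (hw : ∀ i, w i ≠ 0) (hk : 1 ≤ k) (hkn : k ≤ n)
    {l : List (Fin m)} (h : GreedyRun A w k l) (hl : l.length ≤ k) :
    kthLargestRoot k (partialPoly A w k []) ≤ kthLargestRoot k (partialPoly A w k l) := by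
  induction h with
  | nil => exact le_rfl
  | snoc l s hr hs hmax ih =>
    rw [List.length_append, List.length_singleton] at hl
    refine (ih (by omega)).trans ?_
    obtain ⟨t, ht⟩ := exists_kthLargestRoot_le A hw hk hkn l (show l.length < k by omega)
    by_cases htl : t ∈ l
    · rw [kthLargestRoot_partialPoly A hw, kthLargestRoot_partialPoly A hw]
      refine (ht.trans (kthLargestRoot_nonpos_of_not_nodup A hw hk hkn _ (by simp; omega) ?_)).trans
        (kthLargestRoot_monicPoly_nonneg A hw k hk hkn _)
      intro hnd
      exact (List.nodup_append.1 hnd).2.2 t htl t (by simp) rfl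
    · refine le_trans ?_ (hmax t htl)
      rwa [kthLargestRoot_partialPoly A hw, kthLargestRoot_partialPoly A hw]

theorem GreedyRun.bound {n m k : ℕ} {A : Matrix (Fin n) (Fin m) ℝ} {w : Fin m → ℝ}
    (hw : ∀ i, w i ≠ 0) (hk : 1 ≤ k) (hkn : k ≤ n)
    {l : List (Fin m)} (h : GreedyRun A w k l) (hl : l.length = k) :
    l.toFinset.card = k ∧ kthLargestRoot k (partialPoly A w k []) ≤
      sigmaMin (colsOf A l.toFinset * weightsOf w l.toFinset) ^ 2 := by
  have hcard : l.toFinset.card = k := by rw [List.toFinset_card_of_nodup h.nodup, hl]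
  refine ⟨hcard, ?_⟩
  have hne : l.toFinset.Nonempty := Finset.card_pos.1 (by omega)
  have : Nonempty (Fin m) := ⟨hne.choose⟩
  have : Nonempty l.toFinset := hne.to_subtype
  refine (h.kthLargestRoot_le hw hk hkn hl.le).trans ?_
  have hc : Fintype.card l.toFinset = k := by rw [Fintype.card_coe, hcard]
  rw [kthLargestRoot_partialPoly A hw, monicPoly, hl, Nat.sub_self]
  have := kthLargestRoot_le_sigmaMin_sq (colsOf A l.toFinset * weightsOf w l.toFinset)
    (hc.le.trans hkn)
  rwa [hc, ← listMat_eq_mul_transpose A h.nodup] at this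

end WeightedRI

namespace RealRAM

/-! ### Reasoning about programs -/

@[simp] theorem State.nvar_setVar (σ : State) (x v y : ℕ) :
    (σ.setVar x v).nvar y = if y = x then v else σ.nvar y := by
  simp [State.setVar, Function.update_apply]

@[simp] theorem State.rarr_setVar (σ : State) (x v : ℕ) : (σ.setVar x v).rarr = σ.rarr := rfl

@[simp] theorem State.nvar_setNat (σ : State) (a i v : ℕ) : (σ.setNat a i v).nvar = σ.nvar := rfl

theorem State.narr_setNat (σ : State) (a i v a' i' : ℕ) :
    (σ.setNat a i v).narr a' i' = if a' = a ∧ i' = i then v else σ.narr a' i' := by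
  by_cases h : a' = a
  · subst h; by_cases h' : i' = i <;> simp [State.setNat, h']
  · simp [State.setNat, h]

@[simp] theorem State.nvar_setReal (σ : State) (a i j : ℕ) (v : ℝ) :
    (σ.setReal a i j v).nvar = σ.nvar := rfl

theorem State.rarr_setReal (σ : State) (a i j : ℕ) (v : ℝ) (a' i' j' : ℕ) :
    (σ.setReal a i j v).rarr a' i' j' =
      if a' = a ∧ i' = i ∧ j' = j then v else σ.rarr a' i' j' := by
  by_cases h : a' = a
  · subst h
    by_cases h' : i' = i
    · subst h'; by_cases h'' : j' = j <;> simp [State.setReal, h'']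
    · simp [State.setReal, h']
  · simp [State.setReal, h]

/-- `Frame V N R σ τ`: the states `σ` and `τ` agree outside the variables `V`, the natural-number
arrays `N` and the real arrays `R`. -/
structure Frame (V N R : List ℕ) (σ τ : State) : Prop where
  nvar : ∀ x, x ∉ V → τ.nvar x = σ.nvar x
  narr : ∀ a, a ∉ N → τ.narr a = σ.narr a
  rarr : ∀ a, a ∉ R → τ.rarr a = σ.rarr a

section Frame

variable {V N R V' N' R' : List ℕ} {σ τ ρ : State}

theorem Frame.refl (V N R : List ℕ) (σ : State) : Frame V N R σ σ :=
  ⟨fun _ _ => rfl, fun _ _ => rfl, fun _ _ => rfl⟩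

theorem Frame.trans (h : Frame V N R σ τ) (h' : Frame V N R τ ρ) : Frame V N R σ ρ :=
  ⟨fun x hx => (h'.nvar x hx).trans (h.nvar x hx), fun x hx => (h'.narr x hx).trans (h.narr x hx),
    fun x hx => (h'.rarr x hx).trans (h.rarr x hx)⟩

theorem Frame.mono (h : Frame V N R σ τ) (hV : V ⊆ V') (hN : N ⊆ N') (hR : R ⊆ R') :
    Frame V' N' R' σ τ :=
  ⟨fun x hx => h.nvar x fun h => hx (hV h), fun x hx => h.narr x fun h => hx (hN h),
    fun x hx => h.rarr x fun h => hx (hR h)⟩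

theorem Frame.setVar (h : Frame V N R σ τ) {x : ℕ} (hx : x ∈ V) (v : ℕ) :
    Frame V N R σ (τ.setVar x v) :=
  ⟨fun y hy => by
    rw [State.nvar_setVar, if_neg (show y ≠ x from fun e => hy (e ▸ hx))]; exact h.nvar y hy,
    h.narr, h.rarr⟩

theorem Frame.setNat (h : Frame V N R σ τ) {a : ℕ} (ha : a ∈ N) (i v : ℕ) :
    Frame V N R σ (τ.setNat a i v) :=
  ⟨h.nvar, fun b hb => by
    rw [← h.narr b hb]; funext i'
    rw [State.narr_setNat, if_neg (fun e : b = a ∧ i' = i => hb (e.1 ▸ ha))], h.rarr⟩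

theorem Frame.setReal (h : Frame V N R σ τ) {a : ℕ} (ha : a ∈ R) (i j : ℕ) (v : ℝ) :
    Frame V N R σ (τ.setReal a i j v) :=
  ⟨h.nvar, h.narr, fun b hb => by
    rw [← h.rarr b hb]; funext i' j'
    rw [State.rarr_setReal, if_neg (fun e : b = a ∧ i' = i ∧ j' = j => hb (e.1 ▸ ha))]⟩

end Frame

/-- Started in `σ`, the program halts after at most `T` steps in a state satisfying `Q`. -/
def Runs (c : Cmd) (σ : State) (T : ℕ) (Q : State → Prop) : Prop :=
  ∃ τ t, Exec c σ τ t ∧ t ≤ T ∧ Q τ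

section Runs

variable {c c' : Cmd} {σ τ : State} {T T' : ℕ} {Q Q' : State → Prop}

theorem Runs.mono (h : Runs c σ T Q) (hT : T ≤ T') (hQ : ∀ τ, Q τ → Q' τ) : Runs c σ T' Q' := by
  obtain ⟨τ, t, he, ht, hq⟩ := h
  exact ⟨τ, t, he, ht.trans hT, hQ τ hq⟩

theorem Runs.le (h : Runs c σ T Q) (hT : T ≤ T') : Runs c σ T' Q := h.mono hT fun _ h => h

theorem Runs.seq (h : Runs c σ T fun τ => Runs c' τ T' Q) : Runs (.seq c c') σ (T + T') Q := by
  obtain ⟨τ, t, he, ht, ρ, t', he', ht', hq⟩ := h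
  exact ⟨ρ, t + t', .seq he he', by omega, hq⟩

theorem Runs.skip (h : Q σ) : Runs .skip σ 1 Q := ⟨σ, 1, .skip σ, le_rfl, h⟩

theorem Runs.setVar {x : ℕ} {e : NExp} (h : Q (σ.setVar x (e.eval σ))) :
    Runs (.setVar x e) σ (e.cost + 1) Q := ⟨_, _, .setVar σ x e, le_rfl, h⟩

theorem Runs.setNat {a : ℕ} {i e : NExp} (h : Q (σ.setNat a (i.eval σ) (e.eval σ))) :
    Runs (.setNat a i e) σ (i.cost + e.cost + 1) Q := ⟨_, _, .setNat σ a i e, le_rfl, h⟩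

theorem Runs.setReal {a : ℕ} {i j : NExp} {e : RExp}
    (h : Q (σ.setReal a (i.eval σ) (j.eval σ) (e.eval σ))) :
    Runs (.setReal a i j e) σ (i.cost + j.cost + e.cost + 1) Q :=
  ⟨_, _, .setReal σ a i j e, le_rfl, h⟩

theorem Runs.ite {b : BExp} (h : b.eval σ → Runs c σ T Q) (h' : ¬ b.eval σ → Runs c' σ T Q) :
    Runs (.ite b c c') σ (b.cost + T + 1) Q := by
  by_cases hb : b.eval σ
  · obtain ⟨τ, t, he, ht, hq⟩ := h hb
    exact ⟨τ, _, .iteTrue hb he, by omega, hq⟩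
  · obtain ⟨τ, t, he, ht, hq⟩ := h' hb
    exact ⟨τ, _, .iteFalse hb he, by omega, hq⟩

/-- `for x = 0, …, e - 1 do c`. -/
def forLoop (x : ℕ) (e : NExp) (c : Cmd) : Cmd :=
  .seq (.setVar x (.const 0)) (.while (.natLt (.var x) e)
    (.seq c (.setVar x (.add (.var x) (.const 1)))))

/-- The bound e is evaluated again before each pass, so its value is part of what the invariant must
yield. The 10 steps per pass cover test, increment and loop overhead. -/
theorem Runs.forLoop {x : ℕ} {e : NExp} (he : e.cost ≤ 3) {N : ℕ} (I : ℕ → State → Prop)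
    (h0 : I 0 (σ.setVar x 0)) (hN : ∀ i τ, i ≤ N → I i τ → e.eval τ = N)
    (hstep : ∀ i τ, i < N → I i τ → τ.nvar x = i →
      Runs c τ T fun τ' => τ'.nvar x = i ∧ I (i + 1) (τ'.setVar x (i + 1))) :
    Runs (forLoop x e c) σ (N * (T + 10) + 10) (I N) := by
  have key : ∀ d i τ, i + d = N → I i τ → τ.nvar x = i →
      Runs (.while (.natLt (.var x) e) (.seq c (.setVar x (.add (.var x) (.const 1))))) τ
        (d * (T + 10) + 6) (I N) := by
    intro d
    induction d with
    | zero =>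
      intro i τ hi hI hx
      have hiN : i = N := by omega
      subst hiN
      refine ⟨τ, _, .whileFalse ?_, ?_, hI⟩
      · simp [BExp.eval, NExp.eval, hx, hN _ τ le_rfl hI]
      · simp [BExp.cost, NExp.cost]; omega
    | succ d ih =>
      intro i τ hi hI hx
      obtain ⟨τ', t', hex, ht', hx', hI'⟩ := hstep i τ (by omega) hI hx
      obtain ⟨ρ, t'', hex', ht'', hq⟩ := ih (i + 1) (τ'.setVar x (i + 1)) (by omega) hI' (by simp)
      have hset := Exec.setVar τ' x (.add (.var x) (.const 1))
      simp only [NExp.eval, hx'] at hset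
      refine ⟨ρ, _, .whileTrue ?_ (.seq hex hset) hex', ?_, hq⟩
      · simp [BExp.eval, NExp.eval, hx, hN _ τ (by omega) hI]; omega
      · simp only [BExp.cost, NExp.cost]; rw [add_mul, one_mul]; omega
  have := key N 0 (σ.setVar x 0) (by omega) h0 (by simp)
  refine (Runs.seq (Runs.setVar (e := .const 0) this)).le ?_
  simp only [NExp.cost]; omega

/-- `acc := ∑ x < e, f`, with the accumulator in cell `(0, 0)` of the real array `a`. -/
def sumLoop (x : ℕ) (e : NExp) (a : ℕ) (f : RExp) : Cmd :=
  .seq (.setReal a (.const 0) (.const 0) (.ofNat (.const 0)))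
    (forLoop x e (.setReal a (.const 0) (.const 0)
      (.add (.get a (.const 0) (.const 0)) f)))

theorem Runs.sumLoop {x : ℕ} {e : NExp} (he : e.cost ≤ 3) {a : ℕ} {f : RExp} {N K : ℕ}
    (hK : f.cost ≤ K) (v : ℕ → ℝ)
    (hN : ∀ τ, Frame [x] [] [a] σ τ → e.eval τ = N)
    (hv : ∀ i τ, i < N → Frame [x] [] [a] σ τ → τ.nvar x = i → f.eval τ = v i) :
    Runs (sumLoop x e a f) σ (N * (K + 20) + 20) fun τ => Frame [x] [] [a] σ τ ∧
      τ.rarr a 0 0 = ∑ i ∈ Finset.range N, v i := by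
  have := Runs.seq (c := .setReal a (.const 0) (.const 0) (.ofNat (.const 0))) (σ := σ)
    (c' := RealRAM.forLoop x e (.setReal a (.const 0) (.const 0)
      (.add (.get a (.const 0) (.const 0)) f)))
    (Runs.setReal (Runs.forLoop (x := x) (T := K + 10) he (N := N) (fun i τ => Frame [x] [] [a] σ τ ∧
      τ.rarr a 0 0 = ∑ i ∈ Finset.range i, v i)
      (c := .setReal a (.const 0) (.const 0) (.add (.get a (.const 0) (.const 0)) f)) ?_ ?_ ?_))
  · refine this.le ?_
    simp only [NExp.cost, RExp.cost]; ring_nf; omega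
  · refine ⟨((Frame.refl _ _ _ _).setReal (by simp) _ _ _).setVar (by simp) _, ?_⟩
    simp [State.rarr_setReal, NExp.eval, RExp.eval]
  · exact fun i τ _ h => hN τ h.1
  · intro i τ hi h hx
    refine (Runs.setReal ?_).le (by simp only [NExp.cost, RExp.cost]; omega)
    refine ⟨by simpa using hx, (h.1.setReal (by simp) _ _ _).setVar (by simp) _, ?_⟩
    simp [State.rarr_setReal, NExp.eval, RExp.eval, h.2, hv i τ hi h.1 hx, Finset.sum_range_succ]

/-- `for x < e do a[i][j] := f`. -/
def fillLoop (x : ℕ) (e : NExp) (a : ℕ) (i j : NExp) (f : RExp) : Cmd :=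
  forLoop x e (.setReal a i j f)

/-- The row `i₀` of array `a` is being filled at the columns `J t`, `t < x`. -/
structure Filled (σ τ : State) (a i₀ : ℕ) (J : ℕ → ℕ) (v : ℕ → ℝ) (x : ℕ) : Prop where
  done : ∀ t < x, τ.rarr a i₀ (J t) = v t
  rest : ∀ i j, (∀ t < x, i = i₀ → j ≠ J t) → τ.rarr a i j = σ.rarr a i j

theorem Filled.row {a i₀ x : ℕ} {J : ℕ → ℕ} {v : ℕ → ℝ} (h : Filled σ τ a i₀ J v x) {i : ℕ}
    (hi : i ≠ i₀) (j : ℕ) : τ.rarr a i j = σ.rarr a i j := h.rest i j fun _ _ e => absurd e hi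

theorem Filled.zero (σ : State) (a i₀ : ℕ) (J : ℕ → ℕ) (v : ℕ → ℝ) (x y : ℕ) :
    Filled σ (σ.setVar x y) a i₀ J v 0 := ⟨by simp, by simp⟩

/-- Injectivity of J ensures that a new entry overwrites none of the earlier ones. -/
theorem Filled.step {a i₀ x : ℕ} {J : ℕ → ℕ} {v : ℕ → ℝ} (h : Filled σ τ a i₀ J v x) {N : ℕ}
    (hJ : Set.InjOn J {t | t < N}) (hx : x < N) {τ' : State}
    (hτ' : ∀ i j, τ'.rarr a i j = if i = i₀ ∧ j = J x then v x else τ.rarr a i j) :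
    Filled σ τ' a i₀ J v (x + 1) := by
  constructor
  · intro t ht
    rw [hτ']
    rcases Nat.lt_succ_iff_lt_or_eq.1 ht with h' | h'
    · rw [if_neg fun e => h'.ne (hJ (h'.trans hx) hx e.2)]; exact h.done t h'
    · subst h'; simp
  · intro i j hij
    rw [hτ', if_neg fun e => hij x (Nat.lt_succ_self x) e.1 e.2]
    exact h.rest i j fun t ht => hij t (ht.trans (Nat.lt_succ_self x))

/-- The condition on f may use the entries already written, which permits rows defined by recursion.
-/
theorem Runs.fillLoop {x : ℕ} {e : NExp} (he : e.cost ≤ 3) {a : ℕ} {i j : NExp} {f : RExp}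
    {N K : ℕ} (hK : i.cost + j.cost + f.cost + 1 ≤ K) (i₀ : ℕ) (J : ℕ → ℕ) (v : ℕ → ℝ)
    (hJ : Set.InjOn J {t | t < N})
    (hN : ∀ τ, Frame [x] [] [a] σ τ → e.eval τ = N)
    (hv : ∀ t τ, t < N → Frame [x] [] [a] σ τ → Filled σ τ a i₀ J v t → τ.nvar x = t →
      i.eval τ = i₀ ∧ j.eval τ = J t ∧ f.eval τ = v t) :
    Runs (fillLoop x e a i j f) σ (N * (K + 10) + 10) fun τ => Frame [x] [] [a] σ τ ∧
      Filled σ τ a i₀ J v N := by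
  refine Runs.forLoop he (fun t τ => Frame [x] [] [a] σ τ ∧ Filled σ τ a i₀ J v t)
    ⟨(Frame.refl _ _ _ _).setVar (by simp) _, Filled.zero _ _ _ _ _ _ _⟩
    (fun i τ _ h => hN τ h.1) ?_
  intro t τ ht h hx
  obtain ⟨h1, h2, h3⟩ := hv t τ ht h.1 h.2 hx
  refine (Runs.setReal ?_).le hK
  refine ⟨by simpa using hx, (h.1.setReal (by simp) _ _ _).setVar (by simp) _, ?_⟩
  refine h.2.step hJ ht fun i' j' => ?_
  simp [State.rarr_setReal, h1, h2, h3]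

/-- `for y < e' do a[i][j] := g (∑ x < e, f)`, where `g` reads the sum from `acc[0][0]`. -/
def sumFillLoop (y : ℕ) (e' : NExp) (a : ℕ) (i j : NExp) (x : ℕ) (e : NExp) (acc : ℕ)
    (f g : RExp) : Cmd :=
  forLoop y e' (.seq (sumLoop x e acc f) (.setReal a i j g))

theorem Runs.sumFillLoop {y : ℕ} {e' : NExp} (he' : e'.cost ≤ 3) {a : ℕ} {i j : NExp} {x : ℕ}
    {e : NExp} (he : e.cost ≤ 3) {acc : ℕ} {f g : RExp} {N N' K : ℕ} (hf : f.cost ≤ K)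
    (hK : i.cost + j.cost + g.cost + 1 ≤ K) (i₀ : ℕ) (J : ℕ → ℕ) (u : ℕ → ℕ → ℝ) (v : ℕ → ℝ)
    (hJ : Set.InjOn J {t | t < N'}) (hyx : y ≠ x) (haacc : a ≠ acc)
    (hN' : ∀ τ, Frame [y, x] [] [a, acc] σ τ → e'.eval τ = N')
    (hN : ∀ τ, Frame [y, x] [] [a, acc] σ τ → e.eval τ = N)
    (hf' : ∀ t s τ, t < N' → s < N → Frame [y, x] [] [a, acc] σ τ → Filled σ τ a i₀ J v t →
      τ.nvar y = t → τ.nvar x = s → f.eval τ = u t s)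
    (hg : ∀ t τ, t < N' → Frame [y, x] [] [a, acc] σ τ → Filled σ τ a i₀ J v t →
      τ.nvar y = t → τ.rarr acc 0 0 = ∑ s ∈ Finset.range N, u t s →
      i.eval τ = i₀ ∧ j.eval τ = J t ∧ g.eval τ = v t) :
    Runs (sumFillLoop y e' a i j x e acc f g) σ (N' * (N * (K + 20) + K + 30) + 10) fun τ =>
      Frame [y, x] [] [a, acc] σ τ ∧ Filled σ τ a i₀ J v N' := by
  have := Runs.forLoop (σ := σ) (x := y) (T := N * (K + 20) + 20 + K) he'
    (fun t τ => Frame [y, x] [] [a, acc] σ τ ∧ Filled σ τ a i₀ J v t)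
    ⟨(Frame.refl _ _ _ _).setVar (by simp) _, Filled.zero _ _ _ _ _ _ _⟩
    (c := .seq (RealRAM.sumLoop x e acc f) (.setReal a i j g)) (fun i τ _ h => hN' τ h.1) ?_
  · refine this.le (le_of_eq (by ring))
  intro t τ ht h hy
  have hfill : ∀ τ', Frame [x] [] [acc] τ τ' → Filled σ τ' a i₀ J v t := by
    intro τ' h'
    have := h'.rarr a (by simpa using haacc)
    exact ⟨by simpa [this] using h.2.done, by simpa [this] using h.2.rest⟩
  have hfr : ∀ τ', Frame [x] [] [acc] τ τ' → Frame [y, x] [] [a, acc] σ τ' :=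
    fun τ' h' => h.1.trans (h'.mono (by simp) (by simp) (by simp))
  refine Runs.seq ((Runs.sumLoop he hf (u t) (fun τ' h' => hN τ' (hfr τ' h')) ?_).mono le_rfl ?_)
  · intro s τ' hs h' hx'
    exact hf' t s τ' ht hs (hfr τ' h') (hfill τ' h')
      (by rw [h'.nvar y (by simpa using hyx)]; exact hy) hx'
  · rintro τ' ⟨h', hsum⟩
    have hy' : τ'.nvar y = t := by rw [h'.nvar y (by simpa using hyx)]; exact hy
    obtain ⟨h1, h2, h3⟩ := hg t τ' ht (hfr τ' h') (hfill τ' h') hy' hsum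
    refine (Runs.setReal ?_).le hK
    refine ⟨by simpa using hy', ((hfr τ' h').setReal (by simp) _ _ _).setVar (by simp) _, ?_⟩
    refine (hfill τ' h').step hJ ht fun i' j' => ?_
    simp [State.rarr_setReal, h1, h2, h3]

end Runs

end RealRAM

/-! ### Rank-one updates of stored vectors, and loops over the grid. -/

namespace RealRAM

/-- Rank-one update of the vectors in the rows `base + s`, `s < cnt`, of the array `arr`. -/
def rankOneUpdate (arr base cnt al : ℕ) : Cmd :=
  .seq (sumLoop 8 (.var 0) 2 (.mul (.get 10 (.const 0) (.var 8)) (.get 11 (.const 0) (.var 8))))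
  (.seq (.setReal 12 (.const 0) (.const 0)
    (.add (.ofNat (.const 1)) (.mul (.ofNat (.var al)) (.get 2 (.const 0) (.const 0)))))
  (forLoop 5 (.var cnt)
    (.seq (sumLoop 8 (.var 0) 2
      (.mul (.get 10 (.const 0) (.var 8)) (.get arr (.add (.var base) (.var 5)) (.var 8))))
    (.seq (.setReal 12 (.const 0) (.const 1)
      (.div (.mul (.ofNat (.var al)) (.get 2 (.const 0) (.const 0)))
        (.get 12 (.const 0) (.const 0))))
    (fillLoop 8 (.var 0) arr (.add (.var base) (.var 5)) (.var 8)
      (.sub (.get arr (.add (.var base) (.var 5)) (.var 8))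
        (.mul (.get 12 (.const 0) (.const 1)) (.get 11 (.const 0) (.var 8)))))))))

/-- If row 0 of array `10` is u and row 0 of array `11` is R⁻¹u, this is the Sherman-Morrison step
from R⁻¹z to (R + α uuᵀ)⁻¹z for each stored vector, at cost O(n) per vector. The denominator 1 + αg
is left in array `12`, being also the factor of the determinant. -/
theorem Runs.rankOneUpdate {arr base cnt al n M p α : ℕ} (hn : 1 ≤ n) (hM : 1 ≤ M)
    (h2 : arr ≠ 2) (h10 : arr ≠ 10) (h11 : arr ≠ 11) (h12 : arr ≠ 12)
    (hb5 : base ≠ 5) (hb8 : base ≠ 8) (hc5 : cnt ≠ 5) (hc8 : cnt ≠ 8) (ha5 : al ≠ 5)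
    (ha8 : al ≠ 8) {σ : State} (hσn : σ.nvar 0 = n) (hσM : σ.nvar cnt = M) (hσp : σ.nvar base = p)
    (hσα : σ.nvar al = α) {g : ℝ}
    (hg : g = ∑ x ∈ Finset.range n, σ.rarr 10 0 x * σ.rarr 11 0 x) :
    Runs (rankOneUpdate arr base cnt al) σ (200 * (M * n)) fun τ =>
      Frame [5, 8] [] [2, 12, arr] σ τ ∧ τ.rarr 12 0 0 = 1 + α * g ∧
      (∀ s < M, ∀ x < n, τ.rarr arr (p + s) x = σ.rarr arr (p + s) x -
        α * (∑ y ∈ Finset.range n, σ.rarr 10 0 y * σ.rarr arr (p + s) y) / (1 + α * g) *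
          σ.rarr 11 0 x) ∧
      (∀ i, (i < p ∨ p + M ≤ i) → τ.rarr arr i = σ.rarr arr i) := by
  have hMn : M ≤ M * n := Nat.le_mul_of_pos_right _ hn
  have hnM : n ≤ M * n := Nat.le_mul_of_pos_left _ hM
  refine (Runs.seq ((Runs.sumLoop (by simp [NExp.cost]) (N := n) (K := 7)
    (by simp [NExp.cost, RExp.cost]) (fun x => σ.rarr 10 0 x * σ.rarr 11 0 x) ?_ ?_).mono le_rfl
      ?_)).le (T := (n * (7 + 20) + 20) + (12 + (M * (100 * n + 10) + 10)))
      (by have : M * (100 * n + 10) = 100 * (M * n) + 10 * M := by ring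
          omega)
  · intro τ h; simp [NExp.eval, h.nvar, hσn]
  · intro i τ _ h hx
    simp [NExp.eval, RExp.eval, h.rarr, hx]
  rintro τ ⟨hτ, hsum⟩
  rw [← hg] at hsum
  refine Runs.seq ((Runs.setReal ?_).le (T' := 12) (by simp [NExp.cost, RExp.cost]))
  simp only [NExp.eval, RExp.eval, hsum, hτ.nvar al (by simpa using ha8), hσα, Nat.cast_one]
  set τ₁ := τ.setReal 12 0 0 (1 + α * g) with hτ₁
  have f1 : Frame [5, 8] [] [2, 12, arr] σ τ₁ :=
    (hτ.mono (by simp) (by simp) (by simp)).setReal (by simp) _ _ _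
  have harr1 : τ₁.rarr arr = σ.rarr arr := by
    funext i j; rw [hτ₁, State.rarr_setReal, if_neg (by simp [h12]), hτ.rarr arr (by simpa using h2)]
  let I : ℕ → State → Prop := fun s τ => Frame [5, 8] [] [2, 12, arr] σ τ ∧
      τ.rarr 12 0 0 = 1 + α * g ∧
      (∀ s' < s, ∀ x < n, τ.rarr arr (p + s') x = σ.rarr arr (p + s') x -
        α * (∑ y ∈ Finset.range n, σ.rarr 10 0 y * σ.rarr arr (p + s') y) / (1 + α * g) *
          σ.rarr 11 0 x) ∧
      (∀ i, (i < p ∨ p + s ≤ i) → τ.rarr arr i = σ.rarr arr i)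
  refine (Runs.forLoop (N := M) (T := 100 * n) (by simp [NExp.cost]) I ?_ ?_ ?_).le (by omega)
  · refine ⟨f1.setVar (by simp) _, by simp [hτ₁, State.rarr_setReal], by simp, fun i _ => ?_⟩
    rw [State.rarr_setVar, harr1]
  · intro s τ' _ h
    simp [NExp.eval, h.1.nvar, hc5, hc8, hσM]
  intro s τ' hs h hx
  obtain ⟨hf, hden, hdone, hrest⟩ := h
  refine (Runs.seq ((Runs.sumLoop (by simp [NExp.cost]) (N := n) (K := 9)
    (by simp [NExp.cost, RExp.cost]) (fun x => σ.rarr 10 0 x * σ.rarr arr (p + s) x) ?_ ?_).mono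
      le_rfl ?_)).le (T := (n * (9 + 20) + 20) + (13 + (n * 28 + 10))) (by omega)
  · intro τ h; simp [NExp.eval, h.nvar, hf.nvar, hσn]
  · intro i τ _ h hx'
    simp [NExp.eval, RExp.eval, h.rarr, hf.rarr, h.nvar, hf.nvar, hx, hx', hb5, hb8, hσp, h2, h10.symm,
      hrest (p + s) (by omega)]
  rintro τ₂ ⟨hτ₂, hsum₂⟩
  refine Runs.seq ((Runs.setReal ?_).le (T' := 13) (by simp [NExp.cost, RExp.cost]))
  simp only [NExp.eval, RExp.eval, hsum₂, hτ₂.nvar al (by simpa using ha8),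
    hf.nvar al (by simpa using ⟨ha5, ha8⟩), hσα, hτ₂.rarr 12 (by simp), hden]
  set dot := ∑ y ∈ Finset.range n, σ.rarr 10 0 y * σ.rarr arr (p + s) y with hdot
  set τ₃ := τ₂.setReal 12 0 1 (α * dot / (1 + α * g)) with hτ₃
  have f3 : Frame [8] [] [2, 12] τ' τ₃ :=
    (hτ₂.mono (by simp) (by simp) (by simp)).setReal (by simp) _ _ _
  refine (Runs.fillLoop (by simp [NExp.cost]) (N := n) (K := 18) (by simp [NExp.cost, RExp.cost])
    (p + s) id (fun x => σ.rarr arr (p + s) x - α * dot / (1 + α * g) * σ.rarr 11 0 x)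
    (fun _ _ _ _ h => h) ?_ ?_).mono le_rfl ?_
  · intro τ h; simp [NExp.eval, h.nvar, f3.nvar, hf.nvar, hσn]
  · intro x τ₄ hx' h hfill hx''
    have hbase : τ₄.nvar base = p := by
      rw [h.nvar _ (by simpa using hb8), f3.nvar _ (by simpa using hb8),
        hf.nvar _ (by simpa using ⟨hb5, hb8⟩), hσp]
    have h5 : τ₄.nvar 5 = s := by simp [h.nvar, f3.nvar, hx]
    -- The row is overwritten in place, but entry x is read before being written, and the inner
    -- product was computed beforehand.
    have hA : τ₄.rarr arr (p + s) x = σ.rarr arr (p + s) x := by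
      rw [hfill.rest _ _ (by intro t ht _; simp; omega), f3.rarr _ (by simpa using ⟨h2, h12⟩),
        hrest _ (by omega)]
    have h11' : τ₄.rarr 11 = σ.rarr 11 := by
      rw [h.rarr _ (by simpa using h11.symm), f3.rarr _ (by simp),
        hf.rarr _ (by simpa using h11.symm)]
    have h12' : τ₄.rarr 12 0 1 = α * dot / (1 + α * g) := by
      rw [h.rarr _ (by simpa using h12.symm), hτ₃, State.rarr_setReal]; simp
    simp [NExp.eval, RExp.eval, hbase, h5, hx'', hA, h11', h12']
  · rintro τ₅ ⟨hτ₅, hfill⟩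
    have harr3 (i) : τ₃.rarr arr i = τ'.rarr arr i := by rw [f3.rarr _ (by simpa using ⟨h2, h12⟩)]
    refine ⟨by simp [hτ₅.nvar, f3.nvar, hx], ?_, ?_, ?_, ?_⟩
    · exact ((hf.trans (f3.mono (by simp) (by simp) (by simp))).trans
        (hτ₅.mono (by simp) (by simp) (by simp))).setVar (by simp) _
    · rw [State.rarr_setVar, hτ₅.rarr _ (by simpa using h12.symm), hτ₃, State.rarr_setReal,
        if_neg (by simp), hτ₂.rarr _ (by simp), hden]
    · intro s' hs' x hx'
      rw [State.rarr_setVar]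
      rcases Nat.lt_succ_iff_lt_or_eq.1 hs' with h' | h'
      · rw [hfill.row (by omega), harr3, hdone s' h' x hx']
      · subst h'; exact hfill.done x hx'
    · intro i hi
      rw [State.rarr_setVar]
      funext j
      rw [hfill.row (by omega), harr3, hrest i (by omega)]

/-- Run `c` for all `r, i < e`, where `e` is variable `3`; variable `10` holds
`(r e + i) m`, where `m` is variable `1`. -/
def gridLoop (c : Cmd) : Cmd :=
  .seq (.setVar 10 (.const 0)) (forLoop 7 (.var 3) (forLoop 6 (.var 3)
    (.seq c (.setVar 10 (.add (.var 10) (.var 1))))))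

/-- Natural-number expressions have no product, so the block address (rN + i)m is maintained by
repeated addition. -/
theorem Runs.gridLoop {c : Cmd} {σ : State} {N m T : ℕ} (I : ℕ → State → Prop)
    (hI : ∀ e τ x v, x ∈ [6, 7, 10] → I e τ → I e (τ.setVar x v))
    (hN : ∀ e τ, I e τ → τ.nvar 3 = N ∧ τ.nvar 1 = m) (h0 : I 0 σ)
    (hstep : ∀ r i τ, r < N → i < N → I (r * N + i) τ → τ.nvar 7 = r → τ.nvar 6 = i →
      τ.nvar 10 = (r * N + i) * m → Runs c τ T fun τ' => τ'.nvar 7 = r ∧ τ'.nvar 6 = i ∧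
        τ'.nvar 10 = (r * N + i) * m ∧ I (r * N + i + 1) τ') :
    Runs (gridLoop c) σ (N * (N * (T + 14) + 20) + 12) fun τ => I (N * N) τ := by
  refine (Runs.seq ((Runs.setVar ?_).le (T' := 2) (by simp [NExp.cost]))).le
    (T := 2 + (N * (N * (T + 4 + 10) + 10 + 10) + 10)) (by ring_nf; omega)
  refine (Runs.forLoop (N := N) (by simp [NExp.cost])
    (fun r τ => I (r * N) τ ∧ τ.nvar 10 = r * N * m) ?_ ?_ ?_).mono le_rfl (fun τ h => h.1)
  · refine ⟨hI _ _ _ _ (by simp) (hI _ _ _ _ (by simp) (by simpa using h0)), by simp [NExp.eval]⟩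
  · exact fun r τ _ h => (hN _ _ h.1).1
  intro r τ hr h h7
  refine (Runs.forLoop (N := N) (T := T + 4) (by simp [NExp.cost])
    (fun i τ => I (r * N + i) τ ∧ τ.nvar 10 = (r * N + i) * m ∧ τ.nvar 7 = r) ?_ ?_ ?_).mono
      (by ring_nf; omega) ?_
  · exact ⟨hI _ _ _ _ (by simp) h.1, by simpa using h.2, by simpa using h7⟩
  · exact fun i τ _ h => (hN _ _ h.1).1
  · rintro i τ hi ⟨h, h10, h7⟩ h6
    refine (Runs.seq ((hstep r i τ hr hi h h7 h6 h10).mono le_rfl ?_))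
    rintro τ' ⟨h7', h6', h10', h'⟩
    refine (Runs.setVar ?_).le (by simp [NExp.cost])
    refine ⟨by simpa using h6', hI _ _ _ _ (by simp) (hI _ _ _ _ (by simp) h'), ?_, by simpa using h7'⟩
    simp [NExp.eval, h10', (hN _ _ h').2]; ring
  · rintro τ' ⟨h', h10', h7'⟩
    refine ⟨h7', hI _ _ _ _ (by simp) (by rwa [add_mul, one_mul]), ?_⟩
    rw [State.nvar_setVar, if_neg (by decide), h10']; ring

end RealRAM

/-! ### Rank-one updates of inverses -/

theorem Matrix.PosDef.add_smul_vecMulVec {n : ℕ} {R : Matrix (Fin n) (Fin n) ℝ} (hR : R.PosDef)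
    (u : Fin n → ℝ) {α : ℝ} (hα : 0 ≤ α) : (R + α • Matrix.vecMulVec u u).PosDef :=
  hR.add_posSemidef ((by simpa using Matrix.posSemidef_vecMulVec_self_star u :
      (Matrix.vecMulVec u u).PosSemidef).smul hα)

theorem Matrix.PosDef.one_add_mul_pos {n : ℕ} {R : Matrix (Fin n) (Fin n) ℝ} (hR : R.PosDef)
    (u : Fin n → ℝ) {α : ℝ} (hα : 0 ≤ α) : 0 < 1 + α * (u ⬝ᵥ R⁻¹.mulVec u) := by
  have := hR.inv.posSemidef.dotProduct_mulVec_nonneg u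
  rw [star_trivial] at this
  positivity

theorem Matrix.PosDef.det_add_smul_vecMulVec {n : ℕ} {R : Matrix (Fin n) (Fin n) ℝ}
    (hR : R.PosDef) (u : Fin n → ℝ) (α : ℝ) :
    (R + α • Matrix.vecMulVec u u).det = R.det * (1 + α * (u ⬝ᵥ R⁻¹.mulVec u)) := by
  have hdet := hR.det_pos.ne'
  rw [← Matrix.smul_vecMulVec, Matrix.det_add_vecMulVec, Matrix.mulVec_smul, dotProduct_smul,
    Matrix.inv_def, Ring.inverse_eq_inv', Matrix.smul_mulVec, dotProduct_smul]
  simp only [smul_eq_mul]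
  field_simp

/-- The Sherman-Morrison formula, checked by multiplying with the updated matrix. Positive
definiteness makes the denominator positive. -/
theorem Matrix.PosDef.inv_add_smul_vecMulVec_mulVec {n : ℕ} {R : Matrix (Fin n) (Fin n) ℝ}
    (hR : R.PosDef) (u : Fin n → ℝ) {α : ℝ} (hα : 0 ≤ α) (z : Fin n → ℝ) :
    (R + α • Matrix.vecMulVec u u)⁻¹.mulVec z = R⁻¹.mulVec z -
      (α * (u ⬝ᵥ R⁻¹.mulVec z) / (1 + α * (u ⬝ᵥ R⁻¹.mulVec u))) • R⁻¹.mulVec u := by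
  have hR' := hR.add_smul_vecMulVec u hα
  have hden := (hR.one_add_mul_pos u hα).ne'
  have hu : IsUnit R.det := hR.det_pos.ne'.isUnit
  have hu' : IsUnit (R + α • Matrix.vecMulVec u u).det := hR'.det_pos.ne'.isUnit
  have hRi (y : Fin n → ℝ) : R.mulVec (R⁻¹.mulVec y) = y := by
    rw [Matrix.mulVec_mulVec, Matrix.mul_nonsing_inv _ hu, Matrix.one_mulVec]
  have key : (R + α • Matrix.vecMulVec u u).mulVec (R⁻¹.mulVec z -
      (α * (u ⬝ᵥ R⁻¹.mulVec z) / (1 + α * (u ⬝ᵥ R⁻¹.mulVec u))) • R⁻¹.mulVec u) = z := by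
    rw [Matrix.add_mulVec, Matrix.mulVec_sub, Matrix.mulVec_smul, hRi, hRi, Matrix.smul_mulVec,
      Matrix.vecMulVec_mulVec, dotProduct_sub, dotProduct_smul]
    ext i
    simp only [Pi.add_apply, Pi.sub_apply, Pi.smul_apply, smul_eq_mul, MulOpposite.smul_eq_mul_unop,
      MulOpposite.unop_op]
    field_simp
    ring
  conv_lhs => rw [← key]
  rw [Matrix.mulVec_mulVec, Matrix.nonsing_inv_mul _ hu', Matrix.one_mulVec]

namespace RealRAM

/-! ### Tables -/

/-- The product of the factors `(X + h) / (h - i)`, `h < N`, `h ≠ i`. -/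
def lagrangePart (i : ℕ) : ℕ → ℝ[X]
  | 0 => 1
  | h + 1 => if h = i then lagrangePart i h
      else C (((h : ℝ) - i)⁻¹) * ((X + C (h : ℝ)) * lagrangePart i h)

theorem coeff_lagrangePart_succ {i h : ℕ} (hi : h ≠ i) (d : ℕ) :
    (lagrangePart i (h + 1)).coeff d =
      ((if d = 0 then 0 else (lagrangePart i h).coeff (d - 1)) +
        h * (lagrangePart i h).coeff d) / ((h : ℝ) - i) := by
  rw [lagrangePart, if_neg hi, coeff_C_mul, add_mul, coeff_add, coeff_C_mul, div_eq_inv_mul]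
  congr 2
  cases d <;> simp

theorem lagrangePart_eq_basis (i N : ℕ) :
    lagrangePart i N = ∏ h ∈ (Finset.range N).erase i,
      Lagrange.basisDivisor (-(i : ℝ)) (-(h : ℝ)) := by
  induction N with
  | zero => simp [lagrangePart]
  | succ N ih =>
    rw [lagrangePart, ih, Finset.range_add_one]
    split_ifs with h
    · subst h; rw [Finset.erase_insert (by simp), Finset.erase_eq_of_notMem (by simp)]
    · rw [Finset.erase_insert_of_ne (by omega), Finset.prod_insert (by simp), ← mul_assoc]
      congr 1
      rw [Lagrange.basisDivisor]
      simp [sub_eq_add_neg, add_comm]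

/-- Compute the coefficients of the Lagrange basis of the nodes `0, -1, …, -n` in array `4`. -/
def lagrangeTable : Cmd :=
  .seq (.setReal 5 (.const 0) (.const 1) (.ofNat (.const 1)))
  (forLoop 6 (.var 3)
    (.seq (forLoop 17 (.var 3)
      (.ite (.and (.not (.natLt (.var 17) (.var 6))) (.not (.natLt (.var 6) (.var 17))))
        (fillLoop 15 (.var 3) 5 (.add (.var 17) (.const 1)) (.add (.var 15) (.const 1))
          (.get 5 (.var 17) (.add (.var 15) (.const 1))))
        (fillLoop 15 (.var 3) 5 (.add (.var 17) (.const 1)) (.add (.var 15) (.const 1))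
          (.div (.add (.get 5 (.var 17) (.var 15))
            (.mul (.ofNat (.var 17)) (.get 5 (.var 17) (.add (.var 15) (.const 1)))))
            (.sub (.ofNat (.var 17)) (.ofNat (.var 6)))))))
    (fillLoop 15 (.var 3) 4 (.var 6) (.var 15) (.get 5 (.var 3) (.add (.var 15) (.const 1))))))

/-- Cell (h, d + 1) of array `5` holds the d-th coefficient of the partial product with h factors.
The shift lets column 0 stay zero, so multiplication by X needs no special case at d = 0. Row 0 is
the polynomial 1 for every i. -/
theorem Runs.lagrangeTable {σ : State} {N : ℕ} (hN1 : 1 ≤ N) (hN : σ.nvar 3 = N)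
    (h5 : ∀ i j, σ.rarr 5 i j = 0) :
    Runs lagrangeTable σ (200 * (N * N * N)) fun τ => Frame [6, 15, 17] [] [4, 5] σ τ ∧
      ∀ i < N, ∀ d < N, τ.rarr 4 i d = (lagrangePart i N).coeff d := by
  let T0 : State → Prop := fun τ => (∀ h, τ.rarr 5 h 0 = 0) ∧
    ∀ d, τ.rarr 5 0 (d + 1) = (1 : ℝ[X]).coeff d
  have hb : N ≤ N * N := Nat.le_mul_of_pos_left _ hN1
  have hc : N * N ≤ N * N * N := Nat.le_mul_of_pos_right _ hN1
  refine (Runs.seq ((Runs.setReal ?_).le (T' := 10) (by simp [NExp.cost, RExp.cost]))).le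
    (T := 10 + (N * ((N * ((N * (25 + 10) + 10) + 10 + 10) + 10) + (N * (8 + 10) + 10) + 10) + 10))
    (by ring_nf at *; omega)
  set σ₁ := σ.setReal 5 ((NExp.const 0).eval σ) ((NExp.const 1).eval σ)
    ((RExp.ofNat (.const 1)).eval σ) with hσ₁
  have f1 : Frame [6, 15, 17] [] [4, 5] σ σ₁ := (Frame.refl _ _ _ _).setReal (by simp) _ _ _
  have hT0 : T0 σ₁ := by
    refine ⟨fun h => ?_, fun d => ?_⟩
    · rw [hσ₁, State.rarr_setReal, if_neg (by simp [NExp.eval]), h5]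
    · rw [hσ₁, State.rarr_setReal, h5, coeff_one]
      simp [NExp.eval, RExp.eval]
  refine (Runs.forLoop (N := N) (by simp [NExp.cost]) (fun i τ => Frame [6, 15, 17] [] [4, 5] σ τ ∧
    T0 τ ∧ ∀ i' < i, ∀ d < N, τ.rarr 4 i' d = (lagrangePart i' N).coeff d)
    ⟨f1.setVar (by simp) _, hT0, by simp⟩ ?_ ?_).mono le_rfl fun τ h => ⟨h.1, h.2.2⟩
  · rintro i τ - ⟨h, -⟩; simp [NExp.eval, h.nvar, hN]
  rintro i τ hi ⟨hf, hT, hL⟩ h6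
  refine Runs.seq ((Runs.forLoop (N := N) (by simp [NExp.cost])
    (fun h τ' => Frame [15, 17] [] [5] τ τ' ∧ T0 τ' ∧
      ∀ d < N, τ'.rarr 5 h (d + 1) = (lagrangePart i h).coeff d)
    ⟨(Frame.refl _ _ _ _).setVar (by simp) _, hT, fun d _ => hT.2 d⟩ ?_ ?_).mono le_rfl ?_)
  · rintro h τ - ⟨h, -⟩; simp [NExp.eval, h.nvar, hf.nvar, hN]
  · rintro h τ' hh ⟨hf', hT', hrow⟩ h17
    have hpost : ∀ τ'', (Frame [15] [] [5] τ' τ'' ∧ Filled τ' τ'' 5 (h + 1) (· + 1)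
        (fun d => (lagrangePart i (h + 1)).coeff d) N) → τ''.nvar 17 = h ∧
        (fun h τ' => Frame [15, 17] [] [5] τ τ' ∧ T0 τ' ∧
          ∀ d < N, τ'.rarr 5 h (d + 1) = (lagrangePart i h).coeff d) (h + 1)
          (τ''.setVar 17 (h + 1)) := by
      rintro τ'' ⟨hf'', hfill⟩
      refine ⟨by simp [hf''.nvar, h17], (hf'.trans (hf''.mono (by simp) (by simp)
        (by simp))).setVar (by simp) _, ⟨fun h' => ?_, fun d => ?_⟩, fun d hd => hfill.done d hd⟩
      · rw [State.rarr_setVar, hfill.rest _ _ (by simp), hT'.1]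
      · rw [State.rarr_setVar, hfill.row (by omega), hT'.2]
    have hev : ∀ τ'' t, Frame [15] [] [5] τ' τ'' → Filled τ' τ'' 5 (h + 1) (· + 1)
        (fun d => (lagrangePart i (h + 1)).coeff d) t → t < N →
        τ''.nvar 17 = h ∧ τ''.nvar 6 = i ∧
        τ''.rarr 5 h t = (if t = 0 then 0 else (lagrangePart i h).coeff (t - 1)) ∧
        τ''.rarr 5 h (t + 1) = (lagrangePart i h).coeff t := by
      intro τ'' t hf'' hfill ht
      refine ⟨by simp [hf''.nvar, h17], by simp [hf''.nvar, hf'.nvar, h6], ?_, ?_⟩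
      · rw [hfill.row (by omega)]
        split_ifs with h0
        · rw [h0, hT'.1]
        · obtain ⟨t', rfl⟩ := Nat.exists_eq_succ_of_ne_zero h0
          exact hrow t' (by omega)
      · rw [hfill.row (by omega)]; exact hrow t ht
    have h6' : τ'.nvar 6 = i := by simp [hf'.nvar, h6]
    refine (Runs.ite (T := N * (25 + 10) + 10) (fun hb => ?_) (fun hb => ?_)).le (by simp [BExp.cost, NExp.cost]; omega)
    · have hhi : h = i := by
        simp only [BExp.eval, NExp.eval, h17, h6'] at hb; omega
      refine (Runs.fillLoop (by simp [NExp.cost]) (N := N) (K := 25) (by simp [NExp.cost, RExp.cost])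
        (h + 1) (· + 1) (fun d => (lagrangePart i (h + 1)).coeff d)
        (fun _ _ _ _ h => by simpa using h) ?_ ?_).mono le_rfl hpost
      · intro τ'' hf''; simp [NExp.eval, hf''.nvar, hf'.nvar, hf.nvar, hN]
      · intro t τ'' ht hf'' hfill h15
        obtain ⟨e1, e2, e3, e4⟩ := hev τ'' t hf'' hfill ht
        subst hhi
        simp [NExp.eval, RExp.eval, e1, h15, e4, lagrangePart]
    · have hhi : h ≠ i := by
        simp only [BExp.eval, NExp.eval, h17, h6'] at hb; omega
      refine (Runs.fillLoop (by simp [NExp.cost]) (N := N) (K := 25) (by simp [NExp.cost, RExp.cost])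
        (h + 1) (· + 1) (fun d => (lagrangePart i (h + 1)).coeff d)
        (fun _ _ _ _ h => by simpa using h) ?_ ?_).mono le_rfl hpost
      · intro τ'' hf''; simp [NExp.eval, hf''.nvar, hf'.nvar, hf.nvar, hN]
      · intro t τ'' ht hf'' hfill h15
        obtain ⟨e1, e2, e3, e4⟩ := hev τ'' t hf'' hfill ht
        simp [NExp.eval, RExp.eval, e1, e2, h15, e3, e4, coeff_lagrangePart_succ hhi]
  · rintro τ' ⟨hf', hT', hrow⟩
    refine (Runs.fillLoop (by simp [NExp.cost]) (N := N) (K := 8) (by simp [NExp.cost, RExp.cost])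
      i id (fun d => (lagrangePart i N).coeff d) (fun _ _ _ _ h => h) ?_ ?_).mono le_rfl ?_
    · intro τ'' hf''; simp [NExp.eval, hf''.nvar, hf'.nvar, hf.nvar, hN]
    · intro t τ'' ht hf'' hfill h15
      simp [NExp.eval, RExp.eval, hf''.nvar, hf''.rarr, hf'.nvar, hf.nvar, hN, h6, h15, hrow t ht]
    · rintro τ'' ⟨hf'', hfill⟩
      refine ⟨by simp [hf''.nvar, hf'.nvar, h6], ((hf.trans (hf'.mono (by simp) (by simp)
        (by simp))).trans (hf''.mono (by simp) (by simp) (by simp))).setVar (by simp) _, ?_, ?_⟩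
      · simpa [T0, hf''.rarr] using hT'
      · intro i' hi' d hd
        rw [State.rarr_setVar]
        rcases Nat.lt_succ_iff_lt_or_eq.1 hi' with h' | h'
        · rw [hfill.row (by omega), hf'.rarr _ (by simp), hL i' h' d hd]
        · subst h'; exact hfill.done d hd

/-- Set variable `3` to `n + 1` and cell `(0, 0)` of array `3` to `1 / ∑ w_j⁻²`. -/
def constants : Cmd :=
  .seq (.setVar 3 (.add (.var 0) (.const 1)))
  (.seq (sumLoop 5 (.var 1) 2 (.div (.ofNat (.const 1))
    (.mul (.get 1 (.const 0) (.var 5)) (.get 1 (.const 0) (.var 5)))))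
  (.setReal 3 (.const 0) (.const 0) (.div (.ofNat (.const 1)) (.get 2 (.const 0) (.const 0)))))

theorem Runs.constants {σ : State} {n m : ℕ} (hm : 1 ≤ m) (hn : σ.nvar 0 = n) (hσm : σ.nvar 1 = m) :
    Runs constants σ (100 * m) fun τ => Frame [3, 5] [] [2, 3] σ τ ∧ τ.nvar 3 = n + 1 ∧
      τ.rarr 3 0 0 = (∑ s ∈ Finset.range m, (σ.rarr 1 0 s ^ 2)⁻¹)⁻¹ := by
  refine (Runs.seq ((Runs.setVar ?_).le (T' := 4) (by simp [NExp.cost]))).le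
    (T := 4 + ((m * (10 + 20) + 20) + 9)) (by omega)
  set σ₁ := σ.setVar 3 ((NExp.add (.var 0) (.const 1)).eval σ) with hσ₁
  have f1 : Frame [3, 5] [] [2, 3] σ σ₁ := (Frame.refl _ _ _ _).setVar (by simp) _
  have h3 : σ₁.nvar 3 = n + 1 := by simp [hσ₁, NExp.eval, hn]
  refine Runs.seq ((Runs.sumLoop (by simp [NExp.cost]) (N := m) (K := 10)
    (by simp [NExp.cost, RExp.cost]) (fun s => (σ.rarr 1 0 s ^ 2)⁻¹) ?_ ?_).mono le_rfl ?_)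
  · intro τ h; simp [NExp.eval, h.nvar, f1.nvar, hσm]
  · intro s τ _ h hs
    simp [NExp.eval, RExp.eval, h.rarr, f1.rarr, hs, pow_two]
  · rintro τ ⟨h, hsum⟩
    refine (Runs.setReal ?_).le (by simp [NExp.cost, RExp.cost])
    refine ⟨(f1.trans (h.mono (by simp) (by simp) (by simp))).setReal (by simp) _ _ _, ?_, ?_⟩
    · simp [h.nvar, h3]
    · simp [State.rarr_setReal, NExp.eval, RExp.eval, hsum]

end RealRAM

/-- By symmetry row s of R⁻¹ is R⁻¹ applied to the s-th unit vector, so a stored inverse is updated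
by the rule for vectors. -/
theorem Matrix.PosDef.inv_add_smul_vecMulVec_apply {n : ℕ} {R : Matrix (Fin n) (Fin n) ℝ}
    (hR : R.PosDef) (u : Fin n → ℝ) {α : ℝ} (hα : 0 ≤ α) (s x : Fin n) :
    (R + α • Matrix.vecMulVec u u)⁻¹ s x = R⁻¹ s x -
      α * (∑ y, u y * R⁻¹ s y) / (1 + α * ∑ y, u y * R⁻¹.mulVec u y) * R⁻¹.mulVec u x := by
  have hsymm {R : Matrix (Fin n) (Fin n) ℝ} (hR : R.PosDef) (i j) : R⁻¹ i j = R⁻¹ j i := by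
    have := hR.inv.isHermitian.apply i j
    simpa using this.symm
  have h := congrFun (hR.inv_add_smul_vecMulVec_mulVec u hα (Pi.single s 1)) x
  simp only [Matrix.mulVec_single_one, Pi.sub_apply, Pi.smul_apply, Matrix.col_apply,
    smul_eq_mul] at h
  rw [hsymm (hR.add_smul_vecMulVec u hα), h, hsymm hR x s]
  simp only [dotProduct, Matrix.col_apply]
  simp_rw [hsymm hR _ s]

/-! ### Inversion of 1 + r AAᵀ. -/

namespace RealRAM

variable {n m : ℕ}

/-- Column `s` of `A`, and `0` if `m ≤ s`. -/
def colVec (A : Matrix (Fin n) (Fin m) ℝ) (s : ℕ) : Fin n → ℝ := fun x => cell A x s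

@[simp] theorem cell_val (A : Matrix (Fin n) (Fin m) ℝ) (i : Fin n) (j : Fin m) :
    cell A i j = A i j := by simp [cell]

theorem colVec_val (A : Matrix (Fin n) (Fin m) ℝ) (s : Fin m) : colVec A s = A.col s := by
  ext x; simp [colVec]

/-- The sum of the first `t` of the matrices `a aᵀ`, for the columns `a` of `A`. -/
def gramSum (A : Matrix (Fin n) (Fin m) ℝ) (t : ℕ) : Matrix (Fin n) (Fin n) ℝ :=
  ∑ s ∈ Finset.range t, Matrix.vecMulVec (colVec A s) (colVec A s)

theorem gramSum_eq (A : Matrix (Fin n) (Fin m) ℝ) :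
    gramSum A m = ∑ s, Matrix.vecMulVec (A.col s) (A.col s) := by
  rw [gramSum, Finset.sum_range]
  simp_rw [colVec_val]

theorem gramSum_succ (A : Matrix (Fin n) (Fin m) ℝ) (t : ℕ) :
    gramSum A (t + 1) = gramSum A t + Matrix.vecMulVec (colVec A t) (colVec A t) :=
  Finset.sum_range_succ _ _

theorem posSemidef_gramSum (A : Matrix (Fin n) (Fin m) ℝ) (t : ℕ) :
    (gramSum A t).PosSemidef :=
  Matrix.posSemidef_sum _ fun s _ => by
    simpa using Matrix.posSemidef_vecMulVec_self_star (colVec A s)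

theorem posDef_one_add {M : Matrix (Fin n) (Fin n) ℝ} (hM : M.PosSemidef) (r : ℕ) :
    (1 + (r : ℝ) • M).PosDef :=
  Matrix.PosDef.one.add_posSemidef (hM.smul (Nat.cast_nonneg r))

/-- Compute `(1 + r A Aᵀ)⁻¹` in array `6` and `det (1 + r A Aᵀ)` in cell `(0, 0)` of array `18`,
where `r` is the value of variable `7`. -/
def invert : Cmd :=
  .seq (forLoop 18 (.var 0) (.seq
    (fillLoop 8 (.var 0) 6 (.var 18) (.var 8) (.ofNat (.const 0)))
    (.setReal 6 (.var 18) (.var 18) (.ofNat (.const 1)))))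
  (.seq (.setReal 18 (.const 0) (.const 0) (.ofNat (.const 1)))
  (forLoop 16 (.var 1)
    (.seq (fillLoop 8 (.var 0) 10 (.const 0) (.var 8) (.get 0 (.var 8) (.var 16)))
    (.seq (sumFillLoop 18 (.var 0) 11 (.const 0) (.var 18) 8 (.var 0) 2
      (.mul (.get 6 (.var 18) (.var 8)) (.get 10 (.const 0) (.var 8)))
      (.get 2 (.const 0) (.const 0)))
    (.seq (rankOneUpdate 6 19 0 7)
    (.setReal 18 (.const 0) (.const 0)
      (.mul (.get 18 (.const 0) (.const 0)) (.get 12 (.const 0) (.const 0)))))))))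

/-- Starting from the identity, the m columns are added one by one; each rank-one update of the n
rows costs O(n²). -/
theorem Runs.invert {σ : State} {r : ℕ} (hn1 : 1 ≤ n) (hm1 : 1 ≤ m) (h0 : σ.nvar 0 = n)
    (h1 : σ.nvar 1 = m) (h7 : σ.nvar 7 = r) (h19 : σ.nvar 19 = 0)
    (A : Matrix (Fin n) (Fin m) ℝ) (hA : σ.rarr 0 = cell A) :
    Runs invert σ (500 * (m * (n * n))) fun τ =>
      Frame [5, 8, 16, 18] [] [2, 6, 10, 11, 12, 18] σ τ ∧
      (∀ y x : Fin n, τ.rarr 6 y x = (1 + (r : ℝ) • gramSum A m)⁻¹ y x) ∧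
      τ.rarr 18 0 0 = (1 + (r : ℝ) • gramSum A m).det := by
  have hnn : n ≤ n * n := Nat.le_mul_of_pos_left _ hn1
  have hmnn : n * n ≤ m * (n * n) := Nat.le_mul_of_pos_left _ hm1
  have hm' : m ≤ m * (n * n) := Nat.le_mul_of_pos_right _ (by positivity)
  have hmn : m * n ≤ m * (n * n) := Nat.mul_le_mul_left _ hnn
  refine (Runs.seq (Runs.forLoop (N := n) (T := (n * (5 + 10) + 10) + 5) (by simp [NExp.cost])
    (fun y τ => Frame [8, 18] [] [6] σ τ ∧ ∀ y' < y, ∀ x < n, τ.rarr 6 y' x = if y' = x then 1 else 0)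
    ⟨(Frame.refl _ _ _ _).setVar (by simp) _, by simp⟩ ?_ ?_ |>.mono le_rfl ?_)).le
    (T := (n * (((n * (5 + 10) + 10) + 5) + 10) + 10) + (5 + (m * ((n * (6 + 10) + 10) +
      ((n * (n * (7 + 20) + 7 + 30) + 10) + (200 * (n * n) + 10)) + 10) + 10)))
    (by ring_nf at *; omega)
  · rintro y τ - ⟨h, -⟩; simp [NExp.eval, h.nvar, h0]
  · rintro y τ hy ⟨hf, hY⟩ h18
    refine Runs.seq ((Runs.fillLoop (by simp [NExp.cost]) (N := n) (K := 5)
      (by simp [NExp.cost, RExp.cost]) y id (fun _ => 0) (fun _ _ _ _ h => h) ?_ ?_).mono le_rfl ?_)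
    · intro τ' hf'; simp [NExp.eval, hf'.nvar, hf.nvar, h0]
    · intro t τ' _ hf' _ h8; simp [NExp.eval, RExp.eval, hf'.nvar, h18, h8]
    · rintro τ' ⟨hf', hfill⟩
      have h18' : τ'.nvar 18 = y := by simp [hf'.nvar, h18]
      refine (Runs.setReal ?_).le (by simp [NExp.cost, RExp.cost])
      refine ⟨by simpa using h18', ((hf.trans (hf'.mono (by simp) (by simp) (by simp))).setReal
        (by simp) _ _ _).setVar (by simp) _, ?_⟩
      intro y' hy' x hx
      simp only [State.rarr_setVar, State.rarr_setReal, NExp.eval, RExp.eval, h18', Nat.cast_one,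
        true_and]
      rcases Nat.lt_succ_iff_lt_or_eq.1 hy' with h' | h'
      · rw [if_neg (by omega), hfill.row (by omega), hY y' h' x hx]
      · subst h'
        by_cases hxy : x = y'
        · simp [hxy]
        · rw [if_neg (by omega), if_neg (by omega)]; exact hfill.done x hx
  rintro τ ⟨hf, hY⟩
  refine Runs.seq ((Runs.setReal ?_).le (T' := 5) (by simp [NExp.cost, RExp.cost]))
  set σ₁ := τ.setReal 18 ((NExp.const 0).eval τ) ((NExp.const 0).eval τ)
    ((RExp.ofNat (.const 1)).eval τ) with hσ₁
  have f1 : Frame [5, 8, 16, 18] [] [2, 6, 10, 11, 12, 18] σ σ₁ :=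
    (hf.mono (by simp) (by simp) (by simp)).setReal (by simp) _ _ _
  have hd1 : σ₁.rarr 18 0 0 = 1 := by simp [hσ₁, State.rarr_setReal, NExp.eval, RExp.eval]
  have hY1 : ∀ y < n, ∀ x < n, σ₁.rarr 6 y x = if y = x then 1 else 0 := by
    intro y hy x hx; rw [hσ₁, State.rarr_setReal, if_neg (by simp), hY y hy x hx]
  clear_value σ₁
  refine (Runs.forLoop (N := m) (by simp [NExp.cost]) (fun t τ =>
    Frame [5, 8, 16, 18] [] [2, 6, 10, 11, 12, 18] σ τ ∧
      (∀ y x : Fin n, τ.rarr 6 y x = (1 + (r : ℝ) • gramSum A t)⁻¹ y x) ∧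
      τ.rarr 18 0 0 = (1 + (r : ℝ) • gramSum A t).det) ?_ ?_ ?_)
  · refine ⟨f1.setVar (by simp) _, fun y x => ?_, ?_⟩
    · rw [State.rarr_setVar, hY1 y y.2 x x.2]
      simp [gramSum, Matrix.one_apply, Fin.ext_iff]
    · simp [hd1, gramSum]
  · rintro t τ - ⟨h, -⟩; simp [NExp.eval, h.nvar, h1]
  clear hY1 hd1 f1 hY hf
  rintro t τ ht ⟨hf, hY, hdet⟩ h16
  set R := 1 + (r : ℝ) • gramSum A t with hR
  set u := colVec A t with hu
  have hRpos : R.PosDef := posDef_one_add (posSemidef_gramSum A t) r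
  have hR' : 1 + (r : ℝ) • gramSum A (t + 1) = R + (r : ℝ) • Matrix.vecMulVec u u := by
    rw [gramSum_succ, smul_add, ← add_assoc]
  refine Runs.seq ((Runs.fillLoop (by simp [NExp.cost]) (N := n) (K := 6)
      (by simp [NExp.cost, RExp.cost]) 0 id (fun x => cell A x t) (fun _ _ _ _ h => h) ?_ ?_).mono
      le_rfl ?_)
  · intro τ' hf'; simp [NExp.eval, hf'.nvar, hf.nvar, h0]
  · intro x τ' _ hf' _ h8
    simp [NExp.eval, RExp.eval, hf'.nvar, hf'.rarr, hf.rarr, hA, h16, h8]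
  rintro τ₁ ⟨hf₁, hb⟩
  refine Runs.seq ((Runs.sumFillLoop (by simp [NExp.cost]) (by simp [NExp.cost]) (N := n) (N' := n)
    (K := 7) (by simp [NExp.cost, RExp.cost]) (by simp [NExp.cost, RExp.cost]) 0 id
    (fun y x => τ.rarr 6 y x * cell A x t) (fun y => ∑ x ∈ Finset.range n, τ.rarr 6 y x * cell A x t)
    (fun _ _ _ _ h => h) (by simp) (by simp) ?_ ?_ ?_ ?_).mono le_rfl ?_)
  · intro τ' hf'; simp [NExp.eval, hf'.nvar, hf₁.nvar, hf.nvar, h0]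
  · intro τ' hf'; simp [NExp.eval, hf'.nvar, hf₁.nvar, hf.nvar, h0]
  · intro y x τ' hy hx hf' _ h18 h8
    have := hb.done x hx
    simp only [id] at this
    simp [NExp.eval, RExp.eval, hf'.rarr, hf₁.rarr, h18, h8, this]
  · intro y τ' hy hf' _ h18 hsum
    simp [NExp.eval, RExp.eval, h18, hsum]
  rintro τ₂ ⟨hf₂, hv⟩
  have hf02 : Frame [5, 8, 16, 18] [] [2, 6, 10, 11, 12, 18] σ τ₂ :=
    (hf.trans (hf₁.mono (by simp) (by simp) (by simp))).trans
      (hf₂.mono (by simp) (by simp) (by simp))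
  have hb2 (x : Fin n) : τ₂.rarr 10 0 x = u x := by
    rw [hf₂.rarr _ (by simp)]; exact hb.done x x.2
  have hv2 (y : Fin n) : τ₂.rarr 11 0 y = R⁻¹.mulVec u y := by
    rw [show τ₂.rarr 11 0 y = _ from hv.done y y.2, Finset.sum_range]
    simp [Matrix.mulVec, dotProduct, hY, hu, colVec]
  have hY2 : τ₂.rarr 6 = τ.rarr 6 := by simp [hf₂.rarr, hf₁.rarr]
  refine Runs.seq ((Runs.rankOneUpdate (n := n) (M := n) (p := 0) (α := r)
    (g := ∑ y, u y * R⁻¹.mulVec u y) hn1 hn1 (by simp) (by simp) (by simp) (by simp) (by simp)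
    (by simp) (by simp) (by simp) (by simp) (by simp) ?_ ?_ ?_ ?_ ?_).mono le_rfl ?_)
  · simp [hf02.nvar, h0]
  · simp [hf02.nvar, h0]
  · simp [hf02.nvar, h19]
  · simp [hf02.nvar, h7]
  · rw [Finset.sum_range]; simp [hb2, hv2]
  rintro τ₃ ⟨hf₃, hden, hnew, -⟩
  refine (Runs.setReal ?_).le (by simp [NExp.cost, RExp.cost])
  refine ⟨by simp [hf₃.nvar, hf₂.nvar, hf₁.nvar, h16], ((hf02.trans (hf₃.mono (by simp) (by simp)
    (by simp))).setReal (by simp) _ _ _).setVar (by simp) _, ?_, ?_⟩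
  · intro s x
    have h := hnew s s.2 x x.2
    rw [zero_add] at h
    rw [State.rarr_setVar, State.rarr_setReal, if_neg (by simp), h, hR',
      hRpos.inv_add_smul_vecMulVec_apply u (Nat.cast_nonneg r), hY2, hY, Finset.sum_range]
    simp_rw [hb2, hv2, hY]
  · have h18 : τ₃.rarr 18 0 0 = R.det := by simp [hf₃.rarr, hf₂.rarr, hf₁.rarr, hdet]
    rw [hR', hRpos.det_add_smul_vecMulVec]
    simp [State.rarr_setReal, NExp.eval, RExp.eval, h18, hden, dotProduct]

end RealRAM

/-! ### The tables of determinants and solution vectors on the grid. -/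

namespace RealRAM

variable {n m : ℕ}

/-- The matrix `1 + i M + r A Aᵀ` of the grid point `e = r N + i`, where `M` is the sum of the
weighted rank-one matrices of the columns in `l`. -/
def gridMat (A : Matrix (Fin n) (Fin m) ℝ) (w : Fin m → ℝ) (l : List (Fin m)) (N e : ℕ) :
    Matrix (Fin n) (Fin n) ℝ :=
  1 + ((e % N : ℕ) : ℝ) • WeightedRI.listMat A w l + ((e / N : ℕ) : ℝ) • gramSum A m

/-- The entries for grid point `e` in the arrays `7` and `8` are those of the matrix `R`. -/
def GridAt (A : Matrix (Fin n) (Fin m) ℝ) (R : Matrix (Fin n) (Fin n) ℝ) (N e : ℕ)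
    (σ : State) : Prop :=
  (∀ (s : Fin m) (x : Fin n), σ.rarr 7 (e * m + s) x = R⁻¹.mulVec (A.col s) x) ∧
    σ.rarr 8 (e / N) (e % N) = R.det

theorem posDef_gridMat (A : Matrix (Fin n) (Fin m) ℝ) (w : Fin m → ℝ) (l : List (Fin m))
    (N e : ℕ) : (gridMat A w l N e).PosDef :=
  (posDef_one_add (WeightedRI.posSemidef_listMat A w l) _).add_posSemidef
    ((posSemidef_gramSum A m).smul (Nat.cast_nonneg _))

theorem GridAt.congr {A : Matrix (Fin n) (Fin m) ℝ} {R : Matrix (Fin n) (Fin n) ℝ} {N e : ℕ}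
    {σ τ : State} (h : GridAt A R N e σ)
    (h7 : ∀ s < m, τ.rarr 7 (e * m + s) = σ.rarr 7 (e * m + s))
    (h8 : τ.rarr 8 (e / N) (e % N) = σ.rarr 8 (e / N) (e % N)) : GridAt A R N e τ :=
  ⟨fun s x => by rw [h7 s s.2, h.1], by rw [h8, h.2]⟩

theorem mul_add_lt_mul {e e' s : ℕ} (hs : s < m) (he : e < e') : e * m + s < e' * m :=
  calc e * m + s < (e + 1) * m := by rw [add_mul, one_mul]; omega
    _ ≤ e' * m := Nat.mul_le_mul_right _ he

theorem div_mod_ne {N r i e : ℕ} (he : e ≠ r * N + i) : ¬ (e / N = r ∧ e % N = i) := by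
  rintro ⟨rfl, rfl⟩
  exact he (by rw [mul_comm]; exact (Nat.div_add_mod e N).symm)

theorem add_div_of_lt {N r i : ℕ} (hi : i < N) : (r * N + i) / N = r ∧ (r * N + i) % N = i := by
  constructor
  · rw [mul_comm, Nat.mul_add_div (by omega), Nat.div_eq_of_lt hi, add_zero]
  · rw [mul_comm, Nat.mul_add_mod, Nat.mod_eq_of_lt hi]

/-- Copy the array `19` to the rows of array `7` from row `p` on, `p` being in variable `10`. -/
def copyBlock : Cmd :=
  forLoop 5 (.var 1) (fillLoop 8 (.var 0) 7 (.add (.var 10) (.var 5)) (.var 8)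
    (.get 19 (.var 5) (.var 8)))

theorem Runs.copyBlock {σ : State} {p : ℕ} (h0 : σ.nvar 0 = n) (h1 : σ.nvar 1 = m)
    (h10 : σ.nvar 10 = p) :
    Runs copyBlock σ (m * (n * 18 + 20) + 10) fun τ => Frame [5, 8] [] [7] σ τ ∧
      (∀ s < m, ∀ x < n, τ.rarr 7 (p + s) x = σ.rarr 19 s x) ∧
      ∀ i < p, τ.rarr 7 i = σ.rarr 7 i := by
  refine (Runs.forLoop (N := m) (T := n * (8 + 10) + 10) (by simp [NExp.cost]) (fun s τ =>
    Frame [5, 8] [] [7] σ τ ∧ (∀ s' < s, ∀ x < n, τ.rarr 7 (p + s') x = σ.rarr 19 s' x) ∧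
      ∀ i < p, τ.rarr 7 i = σ.rarr 7 i)
    ⟨(Frame.refl _ _ _ _).setVar (by simp) _, by simp, by simp⟩ ?_ ?_).le (by ring_nf; omega)
  · rintro s τ - ⟨h, -⟩; simp [NExp.eval, h.nvar, h1]
  · rintro s τ hs ⟨hf, hd, hr⟩ h5
    refine (Runs.fillLoop (by simp [NExp.cost]) (N := n) (K := 8) (by simp [NExp.cost, RExp.cost])
      (p + s) id (fun x => σ.rarr 19 s x) (fun _ _ _ _ h => h) ?_ ?_).mono le_rfl ?_
    · intro τ' hf'; simp [NExp.eval, hf'.nvar, hf.nvar, h0]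
    · intro x τ' _ hf' _ h8
      simp [NExp.eval, RExp.eval, hf'.nvar, hf'.rarr, hf.nvar, hf.rarr, h5, h8, h10]
    · rintro τ' ⟨hf', hfill⟩
      refine ⟨by simp [hf'.nvar, h5], (hf.trans (hf'.mono (by simp) (by simp) (by simp))).setVar
        (by simp) _, fun s' hs' x hx => ?_, fun i hi => ?_⟩
      · rw [State.rarr_setVar]
        rcases Nat.lt_succ_iff_lt_or_eq.1 hs' with h' | h'
        · rw [hfill.row (by omega), hd s' h' x hx]
        · subst h'; exact hfill.done x hx
      · rw [State.rarr_setVar, ← hr i hi]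
        funext j; exact hfill.row (by omega) j

/-- Fill the arrays `7` and `8` at the start, when no column has been selected. -/
def initGrid : Cmd :=
  .seq (.setVar 10 (.const 0)) (forLoop 7 (.var 3)
    (.seq invert
    (.seq (forLoop 5 (.var 1) (sumFillLoop 18 (.var 0) 19 (.var 5) (.var 18) 8 (.var 0) 2
      (.mul (.get 6 (.var 18) (.var 8)) (.get 0 (.var 8) (.var 5)))
      (.get 2 (.const 0) (.const 0))))
    (forLoop 6 (.var 3)
      (.seq (.setReal 8 (.var 7) (.var 6) (.get 18 (.const 0) (.const 0)))
      (.seq copyBlock (.setVar 10 (.add (.var 10) (.var 1)))))))))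

/-- For the empty list the grid matrix depends on r only, so N inversions suffice and each block is
copied to all i. This keeps the initialization within m N³. -/
theorem Runs.initGrid {σ : State} {N : ℕ} (hn1 : 1 ≤ n) (hm1 : 1 ≤ m) (hnN : n ≤ N)
    (h0 : σ.nvar 0 = n) (h1 : σ.nvar 1 = m) (h3 : σ.nvar 3 = N) (h19 : σ.nvar 19 = 0)
    (A : Matrix (Fin n) (Fin m) ℝ) (w : Fin m → ℝ) (hA : σ.rarr 0 = cell A) :
    Runs initGrid σ (1000 * (m * (N * N * N))) fun τ =>
      Frame [5, 6, 7, 8, 10, 16, 18] [] [2, 6, 7, 8, 10, 11, 12, 18, 19] σ τ ∧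
      ∀ e < N * N, GridAt A (gridMat A w [] N e) N e τ := by
  refine (Runs.seq ((Runs.setVar ?_).le (T' := 2) (by simp [NExp.cost]))).le
    (T := 2 + (N * (500 * (m * (n * n)) + ((m * ((n * (n * (7 + 20) + 7 + 30) + 10) + 10) + 10) +
      (N * (6 + ((m * (n * 18 + 20) + 10) + 4) + 10) + 10)) + 10) + 10)) ?_
  swap
  · have b1 : n * n ≤ N * N := Nat.mul_le_mul hnN hnN
    have hN1 : 1 ≤ N := hn1.trans hnN
    have c0 : 1 ≤ N * N := Nat.mul_pos hN1 hN1
    have c1 : m * (n * n) ≤ m * (N * N) := Nat.mul_le_mul_left _ b1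
    have c2 : m * n ≤ m * (N * N) := Nat.mul_le_mul_left _ ((Nat.le_mul_of_pos_left _ hn1).trans b1)
    have c3 : m ≤ m * (N * N) := Nat.le_mul_of_pos_right _ c0
    have c4 : N * N ≤ m * (N * N) := Nat.le_mul_of_pos_left _ hm1
    have c5 : N ≤ N * N := Nat.le_mul_of_pos_left _ hN1
    have c6 : N * (m * n) ≤ N * (m * N) := Nat.mul_le_mul_left _ (Nat.mul_le_mul_left _ hnN)
    have c7 : N * m ≤ N * (m * N) := Nat.mul_le_mul_left _ (Nat.le_mul_of_pos_right _ hN1)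
    have key : 500 * (m * (n * n)) + ((m * ((n * (n * (7 + 20) + 7 + 30) + 10) + 10) + 10) +
      (N * (6 + ((m * (n * 18 + 20) + 10) + 4) + 10) + 10)) + 10 ≤ 900 * (m * (N * N)) := by
      have e1 : m * ((n * (n * (7 + 20) + 7 + 30) + 10) + 10) =
        27 * (m * (n * n)) + 37 * (m * n) + 20 * m := by ring
      have e2 : N * (6 + ((m * (n * 18 + 20) + 10) + 4) + 10) =
        18 * (N * (m * n)) + 20 * (N * m) + 30 * N := by ring
      have e3 : N * (m * N) = m * (N * N) := by ring
      omega
    have d1 := Nat.mul_le_mul_left N key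
    have d2 : N * (900 * (m * (N * N))) = 900 * (m * (N * N * N)) := by ring
    have d3 : 1 ≤ m * (N * N * N) := Nat.mul_pos hm1 (Nat.mul_pos c0 hN1)
    omega
  set σ₁ := σ.setVar 10 ((NExp.const 0).eval σ) with hσ₁
  have f1 : Frame [5, 6, 7, 8, 10, 16, 18] [] [2, 6, 7, 8, 10, 11, 12, 18, 19] σ σ₁ :=
    (Frame.refl _ _ _ _).setVar (by simp) _
  refine (Runs.forLoop (N := N) (by simp [NExp.cost]) (fun r τ =>
    (Frame [5, 6, 7, 8, 10, 16, 18] [] [2, 6, 7, 8, 10, 11, 12, 18, 19] σ τ ∧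
      ∀ e < r * N, GridAt A (gridMat A w [] N e) N e τ) ∧ τ.nvar 10 = r * N * m)
    ⟨⟨f1.setVar (by simp) _, by simp⟩, by simp [hσ₁, NExp.eval]⟩ ?_ ?_).mono le_rfl fun τ h => h.1
  · rintro r τ - ⟨⟨h, -⟩, -⟩; simp [NExp.eval, h.nvar, h3]
  clear_value σ₁
  rintro r τ hr ⟨⟨hf, hG⟩, h10⟩ h7
  refine Runs.seq ((Runs.invert (r := r) hn1 hm1 (by simp [hf.nvar, h0]) (by simp [hf.nvar, h1]) h7
    (by simp [hf.nvar, h19]) A (by simp [hf.rarr, hA])).mono le_rfl ?_)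
  rintro τ₁ ⟨hf₁, hY, hdet⟩
  have hf01 : Frame [5, 6, 7, 8, 10, 16, 18] [] [2, 6, 7, 8, 10, 11, 12, 18, 19] σ τ₁ :=
    hf.trans (hf₁.mono (by simp) (by simp) (by simp))
  set R := 1 + (r : ℝ) • gramSum A m with hR
  have hRe (i) (hi : i < N) : gridMat A w [] N (r * N + i) = R := by
    simp [gridMat, add_div_of_lt hi, WeightedRI.listMat, hR]
  refine Runs.seq ((Runs.forLoop (N := m) (T := n * (n * (7 + 20) + 7 + 30) + 10)
    (by simp [NExp.cost]) (fun s τ => Frame [5, 8, 18] [] [2, 19] τ₁ τ ∧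
    ∀ s' : Fin m, s'.1 < s → ∀ x : Fin n, τ.rarr 19 s' x = R⁻¹.mulVec (A.col s') x)
    ⟨(Frame.refl _ _ _ _).setVar (by simp) _, by simp⟩ ?_ ?_).mono le_rfl ?_)
  · rintro s τ - ⟨h, -⟩; simp [NExp.eval, h.nvar, hf01.nvar, h1]
  · rintro s τ₂ hs ⟨hf₂, hX⟩ h5
    refine (Runs.sumFillLoop (by simp [NExp.cost]) (by simp [NExp.cost]) (N := n) (N' := n)
      (K := 7) (by simp [NExp.cost, RExp.cost]) (by simp [NExp.cost, RExp.cost]) s id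
      (fun y x => τ₁.rarr 6 y x * cell A x s)
      (fun y => ∑ x ∈ Finset.range n, τ₁.rarr 6 y x * cell A x s)
      (fun _ _ _ _ h => h) (by simp) (by simp) ?_ ?_ ?_ ?_).mono le_rfl ?_
    · intro τ' hf'; simp [NExp.eval, hf'.nvar, hf₂.nvar, hf01.nvar, h0]
    · intro τ' hf'; simp [NExp.eval, hf'.nvar, hf₂.nvar, hf01.nvar, h0]
    · intro y x τ' hy hx hf' _ h18 h8
      simp [NExp.eval, RExp.eval, hf'.rarr, hf₂.rarr, hf01.rarr, hf'.nvar, h18, h8, h5, hA]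
    · intro y τ' hy hf' _ h18 hsum
      simp [NExp.eval, RExp.eval, hf'.nvar, h18, h5, hsum]
    · rintro τ' ⟨hf', hfill⟩
      refine ⟨by simp [hf'.nvar, h5], (hf₂.trans (hf'.mono (by simp) (by simp) (by simp))).setVar
        (by simp) _, ?_⟩
      intro s' hs' x
      rw [State.rarr_setVar]
      rcases Nat.lt_succ_iff_lt_or_eq.1 hs' with h' | h'
      · rw [hfill.row (by omega), hX s' h' x]
      · rw [h', show τ'.rarr 19 s x = _ from hfill.done x x.2, Finset.sum_range]
        subst h'
        simp [Matrix.mulVec, dotProduct, hY]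
  rintro τ₂ ⟨hf₂, hX⟩
  have hf02 : Frame [5, 6, 7, 8, 10, 16, 18] [] [2, 6, 7, 8, 10, 11, 12, 18, 19] σ τ₂ :=
    hf01.trans (hf₂.mono (by simp) (by simp) (by simp))
  refine (Runs.forLoop (N := N) (T := 6 + ((m * (n * 18 + 20) + 10) + 4)) (by simp [NExp.cost])
    (fun i τ => Frame [5, 6, 8, 10] [] [7, 8] τ₂ τ ∧
      (∀ e < r * N + i, GridAt A (gridMat A w [] N e) N e τ) ∧ τ.nvar 10 = (r * N + i) * m)
    ⟨(Frame.refl _ _ _ _).setVar (by simp) _, fun e he => (hG e he).congr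
      (fun s _ => by simp [hf₂.rarr, hf₁.rarr]) (by simp [hf₂.rarr, hf₁.rarr]),
      by simp [hf₂.nvar, hf₁.nvar, h10]⟩ ?_ ?_).mono le_rfl ?_
  · rintro i τ - ⟨h, -⟩; simp [NExp.eval, h.nvar, hf02.nvar, h3]
  · rintro i τ₃ hi ⟨hf₃, hG₃, h10₃⟩ h6
    have h7₃ : τ₃.nvar 7 = r := by simp [hf₃.nvar, hf₂.nvar, hf₁.nvar, h7]
    have hd₃ : τ₃.rarr 18 0 0 = R.det := by simp [hf₃.rarr, hf₂.rarr, hdet]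
    refine Runs.seq ((Runs.setReal ?_).le (T' := 6) (by simp [NExp.cost, RExp.cost]))
    simp only [NExp.eval, RExp.eval, h7₃, h6, hd₃]
    set τ₄ := τ₃.setReal 8 r i R.det with hτ₄
    have hf₄ : Frame [5, 6, 8, 10] [] [7, 8] τ₂ τ₄ := hf₃.setReal (by simp) _ _ _
    refine Runs.seq ((Runs.copyBlock (n := n) (m := m) (p := (r * N + i) * m)
      (by simp [hf₄.nvar, hf02.nvar, h0]) (by simp [hf₄.nvar, hf02.nvar, h1])
      (by simp [hτ₄, h10₃])).mono le_rfl ?_)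
    rintro τ₅ ⟨hf₅, hnew, hold⟩
    have h6₅ : τ₅.nvar 6 = i := by simp [hf₅.nvar, hτ₄, h6]
    refine (Runs.setVar ?_).le (by simp [NExp.cost])
    refine ⟨by simpa using h6₅, ((hf₄.trans (hf₅.mono (by simp) (by simp) (by simp))).setVar
      (by simp) _).setVar (by simp) _, ?_, ?_⟩
    · intro e he
      rcases Nat.lt_succ_iff_lt_or_eq.1 (show e < r * N + i + 1 from he) with h' | h'
      · refine (hG₃ e h').congr (fun s hs => ?_) ?_
        · rw [State.rarr_setVar, State.rarr_setVar, hold _ (mul_add_lt_mul hs h'), hτ₄]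
          funext x; rw [State.rarr_setReal, if_neg (by simp)]
        · rw [State.rarr_setVar, State.rarr_setVar, hf₅.rarr _ (by simp), hτ₄, State.rarr_setReal,
            if_neg (by simpa using div_mod_ne h'.ne)]
      · subst h'
        rw [hRe i hi]
        refine ⟨fun s x => ?_, ?_⟩
        · rw [State.rarr_setVar, State.rarr_setVar, hnew s s.2 x x.2, hτ₄, State.rarr_setReal,
            if_neg (by simp), hf₃.rarr _ (by simp), hX s s.2]
        · rw [State.rarr_setVar, State.rarr_setVar, hf₅.rarr _ (by simp), hτ₄, State.rarr_setReal,
            (add_div_of_lt hi).1, (add_div_of_lt hi).2, if_pos (by simp)]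
    · simp [NExp.eval, hf₅.nvar, hτ₄, h10₃, hf₃.nvar, hf02.nvar, h1]; ring
  · rintro τ₃ ⟨hf₃, hG₃, h10₃⟩
    refine ⟨by simp [hf₃.nvar, hf₂.nvar, hf₁.nvar, h7], ⟨(hf02.trans (hf₃.mono (by simp) (by simp)
      (by simp))).setVar (by simp) _, fun e he => (hG₃ e (by rwa [add_mul, one_mul] at he)).congr
        (fun _ _ => rfl) rfl⟩, ?_⟩
    rw [State.nvar_setVar, if_neg (by decide), h10₃]; ring

end RealRAM

namespace RealRAM

/-! ### The coefficients of the polynomials from determinants at the grid points -/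

theorem coeff_eq_sum_lagrangePart {F : ℝ[X]} {N : ℕ} (hF : F.degree < N) (d : ℕ) :
    F.coeff d = ∑ i ∈ Finset.range N, F.eval (-(i : ℝ)) * (lagrangePart i N).coeff d := by
  have h := Lagrange.eq_interpolate_of_eval_eq (s := Finset.range N) (v := fun i : ℕ => -(i : ℝ))
    (fun i => F.eval (-(i : ℝ))) (fun i _ j _ h => by simpa using h) (by simpa using hF)
    (fun i _ => rfl)
  conv_lhs => rw [h, Lagrange.interpolate_apply, finsetSum_coeff]
  simp_rw [coeff_C_mul, lagrangePart_eq_basis, Lagrange.basis]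

/-- The reversed characteristic polynomial is det(1 - XM). At the node -i its value is det(1 + iM),
so for positive semidefinite M the sampled matrices are positive definite. -/
theorem coeff_charpoly_sub {n : ℕ} (M : Matrix (Fin n) (Fin n) ℝ) {t : ℕ} (ht : t ≤ n) :
    M.charpoly.coeff (n - t) = ∑ i ∈ Finset.range (n + 1),
      (lagrangePart i (n + 1)).coeff t * (1 + (i : ℝ) • M).det := by
  have hdeg : M.charpoly.natDegree = n := by rw [Matrix.charpoly_natDegree_eq_dim, Fintype.card_fin]
  have h1 : M.charpolyRev.coeff t = M.charpoly.coeff (n - t) := by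
    rw [← Matrix.reverse_charpoly, coeff_reverse, hdeg, revAt_le ht]
  rw [← h1, coeff_eq_sum_lagrangePart (N := n + 1)]
  · refine Finset.sum_congr rfl fun i _ => ?_
    rw [mul_comm, Matrix.charpolyRev, ← coe_evalRingHom, RingHom.map_det]
    congr 2
    ext x y
    simp [Matrix.one_apply]
    split_ifs <;> simp [mul_comm]
  · rw [← Matrix.reverse_charpoly]
    refine lt_of_le_of_lt degree_le_natDegree ?_
    exact_mod_cast Nat.lt_succ_of_le ((reverse_natDegree_le _).trans hdeg.le)

/-- The weight of the determinant at the grid point `(r, i)` if `q` columns are still to be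
drawn. -/
def gridWeight (N q : ℕ) (c : ℝ) (i r : ℕ) : ℝ :=
  ∑ d ∈ Finset.range N, q.descFactorial d * (-(i : ℝ) * c) ^ d * (lagrangePart r N).coeff d

/-- Replacing X by -X lets the nodes -r sample the pencil at r ≥ 0. The resulting sign (-1)^d
explains the minus in `gridWeight`. -/
theorem sum_coeff_pencil {n : ℕ} (q i : ℕ) (c : ℝ) (R B : Matrix (Fin n) (Fin n) ℝ) :
    ∑ d ∈ Finset.range (n + 1), (q.descFactorial d : ℝ) * (i * c) ^ d *
        (WeightedRI.pencil R B).coeff d =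
      ∑ r ∈ Finset.range (n + 1), gridWeight (n + 1) q c i r * (R + (r : ℝ) • B).det := by
  have h (d : ℕ) : (WeightedRI.pencil R B).coeff d = (-1) ^ d * ∑ r ∈ Finset.range (n + 1),
      (R + (r : ℝ) • B).det * (lagrangePart r (n + 1)).coeff d := by
    have h1 := coeff_eq_sum_lagrangePart (F := (WeightedRI.pencil R B).comp (-X)) (N := n + 1) ?_ d
    · have hX : (-X : ℝ[X]) = C (-1) * X := by simp
      rw [hX, comp_C_mul_X_coeff, ← hX] at h1
      simp only [eval_comp, eval_neg, eval_X, neg_neg, WeightedRI.eval_pencil] at h1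
      rw [← h1, mul_comm, mul_assoc, ← mul_pow]; simp
    · refine lt_of_le_of_lt degree_le_natDegree ?_
      rw [natDegree_comp, natDegree_neg, natDegree_X, mul_one]
      exact_mod_cast Nat.lt_succ_of_le (WeightedRI.natDegree_pencil_le R B)
  simp_rw [h, gridWeight, Finset.mul_sum, Finset.sum_mul]
  rw [Finset.sum_comm]
  refine Finset.sum_congr rfl fun r _ => Finset.sum_congr rfl fun d _ => ?_
  rw [neg_mul, neg_pow ((i : ℝ) * c)]
  ring

/-- Interpolation in i is linear, hence commutes with the expectation. The mean of det(1 + iM) is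
then a differential operator applied to a pencil in B, whose coefficients are interpolated in r.
Only weights independent of M remain in front of the grid determinants. -/
theorem coeff_expChar_sub {n : ℕ} {ι : Type*} [Fintype ι] {p ω : ι → ℝ} (hp : ∑ s, p s = 1) {c : ℝ}
    (hc : ∀ s, p s * ω s = c) (a : ι → Fin n → ℝ) (q : ℕ) (M : Matrix (Fin n) (Fin n) ℝ) {t : ℕ}
    (ht : t ≤ n) :
    (WeightedRI.expChar p ω a q M).coeff (n - t) = ∑ i ∈ Finset.range (n + 1),
      (∑ r ∈ Finset.range (n + 1), gridWeight (n + 1) q c i r *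
        (1 + (i : ℝ) • M + (r : ℝ) • ∑ s, Matrix.vecMulVec (a s) (a s)).det) *
      (lagrangePart i (n + 1)).coeff t := by
  let U := fun s => ω s • Matrix.vecMulVec (a s) (a s)
  let F : Matrix (Fin n) (Fin n) ℝ → ℕ → ℝ := fun M i => (1 + (i : ℝ) • M).det
  let φ : (ℕ → ℝ) →ₗ[ℝ] ℝ :=
    ∑ i ∈ Finset.range (n + 1), (lagrangePart i (n + 1)).coeff t • LinearMap.proj i
  have hφ (v : ℕ → ℝ) : φ v = ∑ i ∈ Finset.range (n + 1), (lagrangePart i (n + 1)).coeff t * v i := by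
    simp [φ, LinearMap.sum_apply]
  rw [WeightedRI.coeff_expChar]
  have h1 (M : Matrix (Fin n) (Fin n) ℝ) : M.charpoly.coeff (n - t) = φ (F M) := by
    rw [hφ, coeff_charpoly_sub M ht]
  simp_rw [h1]
  rw [← WeightedRI.map_expect φ p U q F M, hφ]
  refine Finset.sum_congr rfl fun i _ => ?_
  have h2 : WeightedRI.expect p U q F M i = WeightedRI.expect p U q (fun M => F M i) M :=
    WeightedRI.map_expect (LinearMap.proj i : (ℕ → ℝ) →ₗ[ℝ] ℝ) p U q F M
  have h3 := WeightedRI.expect_pencil_eval_zero p ω hp c hc a (i : ℝ) 1 q M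
  rw [WeightedRI.iterate_diffOp_eval_zero _ _ n _ (WeightedRI.natDegree_pencil_le _ _)] at h3
  have hid (B : Matrix (Fin n) (Fin n) ℝ) : B.map (algebraMap ℝ ℝ) = B := by ext; rfl
  simp only [hid] at h3
  rw [mul_comm, h2, ← sum_coeff_pencil]
  exact congrArg (· * _) h3

end RealRAM

namespace RealRAM

/-! ### Evaluation of a candidate column -/

/-- Store the weights of the grid points in array `13`; variable `14` is the number of columns that
are still to be drawn. -/
def weights : Cmd :=
  forLoop 6 (.var 3)
    (.seq (.setReal 14 (.const 0) (.const 0) (.ofNat (.const 1)))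
    (.seq (fillLoop 15 (.var 3) 14 (.const 0) (.add (.var 15) (.const 1))
      (.mul (.mul (.get 14 (.const 0) (.var 15)) (.ofNat (.sub (.var 14) (.var 15))))
        (.mul (.sub (.ofNat (.const 0)) (.ofNat (.var 6))) (.get 3 (.const 0) (.const 0)))))
    (sumFillLoop 7 (.var 3) 13 (.var 6) (.var 7) 15 (.var 3) 2
      (.mul (.get 14 (.const 0) (.var 15)) (.get 4 (.var 7) (.var 15)))
      (.get 2 (.const 0) (.const 0)))))

theorem Runs.weights {σ : State} {N q : ℕ} {c : ℝ} (hN1 : 1 ≤ N) (h3 : σ.nvar 3 = N)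
    (h14 : σ.nvar 14 = q) (hc : σ.rarr 3 0 0 = c)
    (hL : ∀ i < N, ∀ d < N, σ.rarr 4 i d = (lagrangePart i N).coeff d) :
    Runs weights σ (300 * (N * N * N)) fun τ => Frame [6, 7, 15] [] [2, 13, 14] σ τ ∧
      ∀ i < N, ∀ r < N, τ.rarr 13 i r = gridWeight N q c i r := by
  have hb : N ≤ N * N := Nat.le_mul_of_pos_left _ hN1
  have hb' : N * N ≤ N * N * N := Nat.le_mul_of_pos_right _ hN1
  refine (Runs.forLoop (N := N) (T := 5 + ((N * (30 + 10) + 10) + (N * (N * (8 + 20) + 8 + 30) + 10)))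
    (by simp [NExp.cost]) (fun i τ => Frame [6, 7, 15] [] [2, 13, 14] σ τ ∧
      ∀ i' < i, ∀ r < N, τ.rarr 13 i' r = gridWeight N q c i' r)
    ⟨(Frame.refl _ _ _ _).setVar (by simp) _, by simp⟩ ?_ ?_).le (by ring_nf at *; omega)
  · rintro i τ - ⟨h, -⟩; simp [NExp.eval, h.nvar, h3]
  rintro i τ hi ⟨hf, hW⟩ h6
  refine Runs.seq ((Runs.setReal ?_).le (T' := 5) (by simp [NExp.cost, RExp.cost]))
  simp only [NExp.eval, RExp.eval, Nat.cast_one]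
  set τ₁ := τ.setReal 14 0 0 1 with hτ₁
  have hf₁ : Frame [6, 7, 15] [] [2, 13, 14] σ τ₁ := hf.setReal (by simp) _ _ _
  refine Runs.seq ((Runs.fillLoop (by simp [NExp.cost]) (N := N) (K := 30)
    (by simp [NExp.cost, RExp.cost]) 0 (· + 1)
    (fun d => (q.descFactorial (d + 1) : ℝ) * (-(i : ℝ) * c) ^ (d + 1))
    (fun _ _ _ _ h => by simpa using h) ?_ ?_).mono le_rfl ?_)
  · intro τ' hf'; simp [NExp.eval, hf'.nvar, hf₁.nvar, h3]
  · intro d τ' hd hf' hfill h15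
    have hprev : τ'.rarr 14 0 d = (q.descFactorial d : ℝ) * (-(i : ℝ) * c) ^ d := by
      rcases d with - | d
      · rw [hfill.rest _ _ (by simp), hτ₁, State.rarr_setReal]; simp
      · exact hfill.done d (by omega)
    have h6' : τ'.nvar 6 = i := by simp [hf'.nvar, hτ₁, h6]
    have hc' : τ'.rarr 3 0 0 = c := by simp [hf'.rarr, hf₁.rarr, hc]
    have h14' : τ'.nvar 14 = q := by simp [hf'.nvar, hf₁.nvar, h14]
    -- The truncated subtraction q - d yields 0 once d ≥ q, exactly as in the recursion of the
    -- falling factorial.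
    refine ⟨rfl, by simp [NExp.eval, h15], ?_⟩
    simp only [NExp.eval, RExp.eval, h15, hprev, h6', hc', h14', Nat.descFactorial_succ,
      Nat.cast_mul, pow_succ]
    push_cast
    ring
  rintro τ₂ ⟨hf₂, hfill₂⟩
  have hF (d : ℕ) (hd : d < N) : τ₂.rarr 14 0 d = (q.descFactorial d : ℝ) * (-(i : ℝ) * c) ^ d := by
    rcases d with - | d
    · rw [hfill₂.rest _ _ (by simp), hτ₁, State.rarr_setReal]; simp
    · exact hfill₂.done d (by omega)
  have hf02 : Frame [6, 7, 15] [] [2, 13, 14] σ τ₂ :=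
    hf₁.trans (hf₂.mono (by simp) (by simp) (by simp))
  have h6₂ : τ₂.nvar 6 = i := by simp [hf₂.nvar, hτ₁, h6]
  refine (Runs.sumFillLoop (by simp [NExp.cost]) (by simp [NExp.cost]) (N := N) (N' := N)
    (K := 8) (by simp [NExp.cost, RExp.cost]) (by simp [NExp.cost, RExp.cost]) i id
    (fun r d => q.descFactorial d * (-(i : ℝ) * c) ^ d * (lagrangePart r N).coeff d)
    (fun r => gridWeight N q c i r) (fun _ _ _ _ h => h) (by simp) (by simp) ?_ ?_ ?_ ?_).mono
      le_rfl ?_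
  · intro τ' hf'; simp [NExp.eval, hf'.nvar, hf02.nvar, h3]
  · intro τ' hf'; simp [NExp.eval, hf'.nvar, hf02.nvar, h3]
  · intro r d τ' hr hd hf' _ h7 h15
    simp [NExp.eval, RExp.eval, hf'.rarr, hf02.rarr, h7, h15, hF d hd, hL r hr d hd]
  · intro r τ' hr hf' _ h7 hsum
    simp [NExp.eval, RExp.eval, hf'.nvar, h6₂, h7, hsum, gridWeight]
  · rintro τ' ⟨hf', hfill⟩
    refine ⟨by simp [hf'.nvar, h6₂], (hf02.trans (hf'.mono (by simp) (by simp)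
      (by simp))).setVar (by simp) _, fun i' hi' r hr => ?_⟩
    rw [State.rarr_setVar]
    rcases Nat.lt_succ_iff_lt_or_eq.1 hi' with h' | h'
    · rw [hfill.row (by omega), hf₂.rarr _ (by simp), hτ₁, State.rarr_setReal, if_neg (by simp),
        hW i' h' r hr]
    · subst h'; exact hfill.done r hr

end RealRAM

namespace RealRAM

variable {n m : ℕ}

/-- The input of the column selection problem and the tables that depend only on it. -/
structure Ready (A : Matrix (Fin n) (Fin m) ℝ) (w : Fin m → ℝ) (k : ℕ) (σ : State) : Prop where
  rows : σ.nvar 0 = n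
  cols : σ.nvar 1 = m
  size : σ.nvar 2 = k
  nodes : σ.nvar 3 = n + 1
  origin : σ.nvar 19 = 0
  matrix : σ.rarr 0 = cell A
  weight : ∀ s : Fin m, σ.rarr 1 0 s = w s
  scale : σ.rarr 3 0 0 = (∑ j, (w j ^ 2)⁻¹)⁻¹
  table : ∀ i < n + 1, ∀ d < n + 1, σ.rarr 4 i d = (lagrangePart i (n + 1)).coeff d

theorem Ready.frame {A : Matrix (Fin n) (Fin m) ℝ} {w : Fin m → ℝ} {k : ℕ} {σ τ : State}
    {V N R : List ℕ} (h : Ready A w k σ) (hf : Frame V N R σ τ)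
    (hV : ∀ x ∈ [0, 1, 2, 3, 19], x ∉ V) (hR : ∀ a ∈ [0, 1, 3, 4], a ∉ R) : Ready A w k τ where
  rows := by rw [hf.nvar _ (hV 0 (by simp)), h.rows]
  cols := by rw [hf.nvar _ (hV 1 (by simp)), h.cols]
  size := by rw [hf.nvar _ (hV 2 (by simp)), h.size]
  nodes := by rw [hf.nvar _ (hV 3 (by simp)), h.nodes]
  origin := by rw [hf.nvar _ (hV 19 (by simp)), h.origin]
  matrix := by rw [hf.rarr _ (hR 0 (by simp)), h.matrix]
  weight s := by rw [hf.rarr _ (hR 1 (by simp)), h.weight]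
  scale := by rw [hf.rarr _ (hR 3 (by simp)), h.scale]
  table := by rw [hf.rarr _ (hR 4 (by simp))]; exact h.table

theorem rowPoly_eq {σ : State} {b r n : ℕ} {F : ℝ[X]} (hF : F.natDegree ≤ n)
    (h : ∀ t ≤ n, σ.rarr b r (n - t) = F.coeff (n - t)) : σ.rowPoly b r n = F := by
  ext d
  rw [State.rowPoly, finsetSum_coeff]
  simp_rw [coeff_C_mul_X_pow]
  rw [Finset.sum_ite_eq]
  split_ifs with hd
  · have h1 := h (n - d) (by omega)
    rwa [Nat.sub_sub_self (by simpa [Nat.lt_succ_iff] using hd)] at h1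
  · exact (coeff_eq_zero_of_natDegree_lt (by simp at hd; omega)).symm

theorem gridMat_append_singleton (A : Matrix (Fin n) (Fin m) ℝ) (w : Fin m → ℝ) (l : List (Fin m))
    (s : Fin m) (N e : ℕ) : gridMat A w (l ++ [s]) N e = gridMat A w l N e +
      (((e % N : ℕ) : ℝ) * w s ^ 2) • Matrix.vecMulVec (A.col s) (A.col s) := by
  rw [gridMat, gridMat, WeightedRI.listMat_append_singleton, smul_add, smul_smul]
  abel

/-- Compute in cell `(0, 0)` of array `17` the value of the column `s` in variable `5` for the greedy
rule. -/
def candidate : Cmd :=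
  .seq (gridLoop (.seq
    (sumLoop 8 (.var 0) 2
      (.mul (.get 0 (.var 8) (.var 5)) (.get 7 (.add (.var 10) (.var 5)) (.var 8))))
    (.setReal 20 (.var 6) (.var 7)
      (.mul (.mul (.get 13 (.var 6) (.var 7)) (.get 8 (.var 7) (.var 6)))
        (.add (.ofNat (.const 1)) (.mul (.mul (.ofNat (.var 6))
          (.mul (.get 1 (.const 0) (.var 5)) (.get 1 (.const 0) (.var 5))))
          (.get 2 (.const 0) (.const 0))))))))
  (.seq (sumFillLoop 6 (.var 3) 15 (.const 0) (.var 6) 7 (.var 3) 2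
    (.get 20 (.var 6) (.var 7)) (.get 2 (.const 0) (.const 0)))
  (.seq (sumFillLoop 15 (.var 3) 16 (.const 0) (.sub (.var 0) (.var 15)) 6 (.var 3) 2
    (.mul (.get 15 (.const 0) (.var 6)) (.get 4 (.var 6) (.var 15)))
    (.get 2 (.const 0) (.const 0)))
  (.root 17 (.const 0) (.const 0) 16 (.const 0) (.var 0) (.var 2))))

/-- Adding column s multiplies the grid determinant by 1 + i w_s² a_sᵀR⁻¹a_s, an inner product with
a stored vector. All grid points together cost O(n³), the two summations O(n²), and the root n³. -/
theorem Runs.candidate {σ : State} {A : Matrix (Fin n) (Fin m) ℝ} {w : Fin m → ℝ} {k q : ℕ}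
    (hw : ∀ i, w i ≠ 0) (hk : 1 ≤ k) (hkn : k ≤ n) {l : List (Fin m)} (hσ : Ready A w k σ)
    (hq : q = k - (l.length + 1))
    (hG : ∀ e < (n + 1) * (n + 1), GridAt A (gridMat A w l (n + 1) e) (n + 1) e σ)
    (hW : ∀ i < n + 1, ∀ r < n + 1, σ.rarr 13 i r =
      gridWeight (n + 1) q (∑ j, (w j ^ 2)⁻¹)⁻¹ i r) (s : Fin m) (h5 : σ.nvar 5 = s) :
    Runs candidate σ (300 * ((n + 1) * (n + 1) * (n + 1))) fun τ =>
      Frame [6, 7, 8, 10, 15] [] [2, 15, 16, 17, 20] σ τ ∧ τ.rarr 17 0 0 =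
        WeightedRI.kthLargestRoot k (WeightedRI.partialPoly A w k (l ++ [s])) := by
  have : Nonempty (Fin m) := ⟨s⟩
  set N := n + 1 with hN
  set c := (∑ j, (w j ^ 2)⁻¹)⁻¹ with hc
  let V : ℕ → ℕ → ℝ := fun i r =>
    gridWeight N q c i r * (gridMat A w (l ++ [s]) N (r * N + i)).det
  refine (Runs.seq ((Runs.gridLoop (N := N) (m := m) (T := (n * (9 + 20) + 20) + 30)
    (fun e τ => Frame [6, 7, 8, 10] [] [2, 20] σ τ ∧
      ∀ e' < e, τ.rarr 20 (e' % N) (e' / N) = V (e' % N) (e' / N)) ?_ ?_ ?_ ?_).mono le_rfl ?_)).le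
    (T := (N * (N * (((n * (9 + 20) + 20) + 30) + 14) + 20) + 12) +
      ((N * (N * (10 + 20) + 10 + 30) + 10) + ((N * (N * (10 + 20) + 10 + 30) + 10) +
        (6 + n ^ 3)))) ?_
  rotate_right
  · rw [hN]; ring_nf; omega
  · rintro e τ x v hx ⟨hf, hV⟩
    refine ⟨hf.setVar (by simp at hx ⊢; omega) _, hV⟩
  · rintro e τ ⟨hf, -⟩
    simp [hf.nvar, hσ.nodes, hσ.cols, hN]
  · exact ⟨Frame.refl _ _ _ _, by simp⟩
  · rintro r i τ hr hi ⟨hf, hV⟩ h7 h6 h10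
    have he : r * N + i < N * N :=
      calc r * N + i < (r + 1) * N := by rw [add_mul, one_mul]; omega
        _ ≤ N * N := Nat.mul_le_mul_right _ hr
    obtain ⟨hZ, hD⟩ := hG _ he
    rw [(add_div_of_lt hi).1, (add_div_of_lt hi).2] at hD
    set R := gridMat A w l N (r * N + i) with hR
    refine Runs.seq ((Runs.sumLoop (by simp [NExp.cost]) (N := n) (K := 9)
      (by simp [NExp.cost, RExp.cost])
      (fun x => cell A x s * σ.rarr 7 ((r * N + i) * m + s) x) ?_ ?_).mono le_rfl ?_)
    · intro τ' hf'; simp [NExp.eval, hf'.nvar, hf.nvar, hσ.rows]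
    · intro x τ' _ hf' h8
      simp [NExp.eval, RExp.eval, hf'.rarr, hf'.nvar, hf.rarr, hf.nvar, h5, h8, h10, hσ.matrix]
    rintro τ₁ ⟨hf₁, hsum⟩
    have hsum' : τ₁.rarr 2 0 0 = A.col s ⬝ᵥ R⁻¹.mulVec (A.col s) := by
      rw [hsum, Finset.sum_range]
      simp [dotProduct, hZ]
    refine (Runs.setReal ?_).le (by simp [NExp.cost, RExp.cost])
    have hval : gridWeight N q c i r * R.det * (1 + (i * (w s * w s)) *
        (A.col s ⬝ᵥ R⁻¹.mulVec (A.col s))) = V i r := by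
      simp only [V, gridMat_append_singleton]
      rw [(posDef_gridMat A w l N _).det_add_smul_vecMulVec, (add_div_of_lt hi).2, mul_assoc, pow_two]
    have hev1 : τ₁.nvar 6 = i := by simp [hf₁.nvar, h6]
    have hev2 : τ₁.nvar 7 = r := by simp [hf₁.nvar, h7]
    have hev3 : τ₁.nvar 5 = s := by simp [hf₁.nvar, hf.nvar, h5]
    have hev4 : τ₁.rarr 13 i r = gridWeight N q c i r := by simp [hf₁.rarr, hf.rarr, hW i hi r hr]
    have hev5 : τ₁.rarr 8 r i = R.det := by simp [hf₁.rarr, hf.rarr, hD]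
    have hev6 : τ₁.rarr 1 0 s = w s := by simp [hf₁.rarr, hf.rarr, hσ.weight]
    simp only [NExp.eval, RExp.eval, hev1, hev2, hev3, hev4, hev5, hev6, hsum', Nat.cast_one, hval]
    refine ⟨by simpa using hev2, by simpa using hev1, by simp [hf₁.nvar, h10],
      (hf.trans (hf₁.mono (by simp) (by simp) (by simp))).setReal (by simp) _ _ _, fun e' he' => ?_⟩
    rw [State.rarr_setReal]
    rcases Nat.lt_succ_iff_lt_or_eq.1 he' with h' | h'
    · rw [if_neg fun h => div_mod_ne h'.ne ⟨h.2.2, h.2.1⟩, hf₁.rarr _ (by simp), hV e' h']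
    · subst h'
      rw [(add_div_of_lt hi).1, (add_div_of_lt hi).2, if_pos (by simp)]
  rintro τ ⟨hf, hV⟩
  have hV' (i : ℕ) (hi : i < N) (r : ℕ) (hr : r < N) : τ.rarr 20 i r = V i r := by
    have := hV (r * N + i) (calc r * N + i < (r + 1) * N := by rw [add_mul, one_mul]; omega
        _ ≤ N * N := Nat.mul_le_mul_right _ hr)
    rwa [(add_div_of_lt hi).1, (add_div_of_lt hi).2] at this
  refine Runs.seq ((Runs.sumFillLoop (by simp [NExp.cost]) (by simp [NExp.cost]) (N := N) (N' := N)
    (K := 10) (by simp [NExp.cost, RExp.cost]) (by simp [NExp.cost, RExp.cost]) 0 id V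
    (fun i => ∑ r ∈ Finset.range N, V i r) (fun _ _ _ _ h => h) (by simp) (by simp)
    ?_ ?_ ?_ ?_).mono le_rfl ?_)
  · intro τ' hf'; simp [NExp.eval, hf'.nvar, hf.nvar, hσ.nodes, hN]
  · intro τ' hf'; simp [NExp.eval, hf'.nvar, hf.nvar, hσ.nodes, hN]
  · intro i r τ' hi hr hf' _ h6 h7
    simp [NExp.eval, RExp.eval, hf'.rarr, h6, h7, hV' i hi r hr]
  · intro i τ' hi hf' _ h6 hsum
    simp [NExp.eval, RExp.eval, h6, hsum]
  rintro τ₁ ⟨hf₁, hfill₁⟩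
  have hf01 : Frame [6, 7, 8, 10, 15] [] [2, 15, 16, 17, 20] σ τ₁ :=
    (hf.mono (by simp) (by simp) (by simp)).trans (hf₁.mono (by simp) (by simp) (by simp))
  have hR₁ : Ready A w k τ₁ := hσ.frame hf01 (by simp) (by simp)
  refine Runs.seq ((Runs.sumFillLoop (by simp [NExp.cost]) (by simp [NExp.cost]) (N := N) (N' := N)
    (K := 10) (by simp [NExp.cost, RExp.cost]) (by simp [NExp.cost, RExp.cost]) 0 (n - ·)
    (fun t i => (∑ r ∈ Finset.range N, V i r) * (lagrangePart i N).coeff t)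
    (fun t => (WeightedRI.monicPoly A w k (l ++ [s])).coeff (n - t)) ?_ (by simp) (by simp)
    ?_ ?_ ?_ ?_).mono le_rfl ?_)
  · intro t ht t' ht' h
    simp only [Set.mem_ofPred_eq] at ht ht'
    simp only at h
    omega
  · intro τ' hf'; simp [NExp.eval, hf'.nvar, hR₁.nodes, hN]
  · intro τ' hf'; simp [NExp.eval, hf'.nvar, hR₁.nodes, hN]
  · intro t i τ' ht hi hf' _ h15 h6
    have h15' : τ₁.rarr 15 0 i = _ := hfill₁.done i hi
    simp [NExp.eval, RExp.eval, hf'.rarr, h15, h6, h15', hR₁.table i hi t ht, ← hN]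
  · intro t τ' ht hf' _ h15 hsum
    refine ⟨rfl, by simp [NExp.eval, hf'.nvar, hR₁.rows, h15], ?_⟩
    simp only [RExp.eval, NExp.eval, hsum]
    rw [WeightedRI.monicPoly, coeff_expChar_sub (WeightedRI.sum_colProb hw)
      (WeightedRI.colProb_mul_sq hw) _ _ _ (by omega), List.length_append, List.length_singleton,
      ← hq, ← gramSum_eq]
    refine Finset.sum_congr rfl fun i hi => ?_
    congr 1
    refine Finset.sum_congr rfl fun r _ => ?_
    have hi' : (r * N + i) / N = r ∧ (r * N + i) % N = i := add_div_of_lt (Finset.mem_range.1 hi)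
    simp only [V, gridMat, hi'.1, hi'.2]
    rfl
  rintro τ₂ ⟨hf₂, hfill₂⟩
  have hf02 : Frame [6, 7, 8, 10, 15] [] [2, 15, 16, 17, 20] σ τ₂ :=
    hf01.trans (hf₂.mono (by simp) (by simp) (by simp))
  have hR₂ : Ready A w k τ₂ := hσ.frame hf02 (by simp) (by simp)
  have hdeg := WeightedRI.natDegree_monicPoly A hw k (l ++ [s])
  have hpoly : τ₂.rowPoly 16 0 n = WeightedRI.monicPoly A w k (l ++ [s]) :=
    rowPoly_eq hdeg.le fun t ht => hfill₂.done t (by omega)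
  have hlead : τ₂.rarr 16 0 n = 1 := by
    have h1 := hfill₂.done 0 (by omega)
    have h2 := (WeightedRI.monic_monicPoly A hw k (l ++ [s])).coeff_natDegree
    rw [hdeg] at h2
    simpa [h2] using h1
  -- The root instruction is legitimate: the stored row is a monic polynomial of degree n that
  -- splits by the stability argument.
  refine ⟨_, _, .root τ₂ 17 (.const 0) (.const 0) 16 (.const 0) (.var 0) (.var 2) ?_ ?_ ?_ ?_, ?_, ?_⟩
  · simp [NExp.eval, hR₂.rows, hlead]
  · simp only [NExp.eval, hR₂.rows, hpoly]
    exact WeightedRI.splits_monicPoly A hw k _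
  · simpa [NExp.eval, hR₂.size] using hk
  · simpa [NExp.eval, hR₂.size, hR₂.rows] using hkn
  · simp only [NExp.eval, NExp.cost, hR₂.rows]; omega
  · refine ⟨hf02.setReal (by simp) _ _ _, ?_⟩
    simp only [NExp.eval, hR₂.rows, hR₂.size, hpoly, State.rarr_setReal]
    simp [WeightedRI.kthLargestRoot_partialPoly A hw]

end RealRAM

/-! ### Selection of a column and update of the tables. -/

namespace RealRAM

variable {n m : ℕ}

/-- Find in variable `12` a column that is optimal among those not marked in array `1`. -/
def select : Cmd :=
  .seq (.setVar 13 (.const 0)) (forLoop 5 (.var 1)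
    (.ite (.natLt (.const 0) (.get 1 (.var 5))) .skip
      (.seq candidate
        (.ite (.and (.natLt (.const 0) (.var 13))
            (.realLe (.get 17 (.const 0) (.const 0)) (.get 21 (.const 0) (.const 0)))) .skip
          (.seq (.setReal 21 (.const 0) (.const 0) (.get 17 (.const 0) (.const 0)))
          (.seq (.setVar 12 (.var 5)) (.setVar 13 (.const 1))))))))

theorem Runs.select {σ : State} {A : Matrix (Fin n) (Fin m) ℝ} {w : Fin m → ℝ} {k q : ℕ}
    (hw : ∀ i, w i ≠ 0) (hk : 1 ≤ k) (hkn : k ≤ n) {l : List (Fin m)} (hσ : Ready A w k σ)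
    (hq : q = k - (l.length + 1))
    (hG : ∀ e < (n + 1) * (n + 1), GridAt A (gridMat A w l (n + 1) e) (n + 1) e σ)
    (hW : ∀ i < n + 1, ∀ r < n + 1, σ.rarr 13 i r =
      gridWeight (n + 1) q (∑ j, (w j ^ 2)⁻¹)⁻¹ i r)
    (hmark : ∀ t : Fin m, σ.narr 1 t = if t ∈ l then 1 else 0) (hl : ∃ t, t ∉ l) :
    Runs select σ (400 * (m * ((n + 1) * (n + 1) * (n + 1)))) fun τ =>
      Frame [5, 6, 7, 8, 10, 12, 13, 15] [] [2, 15, 16, 17, 20, 21] σ τ ∧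
      ∃ s : Fin m, τ.nvar 12 = s ∧ s ∉ l ∧ ∀ t ∉ l,
        WeightedRI.kthLargestRoot k (WeightedRI.partialPoly A w k (l ++ [t])) ≤
          WeightedRI.kthLargestRoot k (WeightedRI.partialPoly A w k (l ++ [s])) := by
  set B := (n + 1) * (n + 1) * (n + 1) with hB
  set f : Fin m → ℝ := fun t =>
    WeightedRI.kthLargestRoot k (WeightedRI.partialPoly A w k (l ++ [t])) with hf
  have hm : 1 ≤ m := by
    obtain ⟨t, -⟩ := hl
    exact t.pos
  have hmB : m ≤ m * B := Nat.le_mul_of_pos_right _ (by positivity)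
  refine (Runs.seq ((Runs.setVar ?_).le (T' := 2) (by simp [NExp.cost]))).le
    (T := 2 + (m * ((4 + (300 * B + (11 + (6 + (2 + 2)) + 1)) + 1) + 10) + 10))
    (by ring_nf at *; omega)
  set σ₁ := σ.setVar 13 ((NExp.const 0).eval σ) with hσ₁
  have hf₁ : Frame [5, 6, 7, 8, 10, 12, 13, 15] [] [2, 15, 16, 17, 20, 21] σ σ₁ :=
    (Frame.refl _ _ _ _).setVar (by simp) _
  refine (Runs.forLoop (N := m) (by simp [NExp.cost]) (fun x τ =>
    Frame [5, 6, 7, 8, 10, 12, 13, 15] [] [2, 15, 16, 17, 20, 21] σ τ ∧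
    -- Variable `13` tells whether a candidate has been met. Without this flag the first one would
    -- be compared with an undefined record.
    ((τ.nvar 13 = 0 ∧ ∀ t : Fin m, t.1 < x → t ∈ l) ∨
      (τ.nvar 13 = 1 ∧ ∃ s : Fin m, τ.nvar 12 = s ∧ s ∉ l ∧ τ.rarr 21 0 0 = f s ∧
        ∀ t : Fin m, t.1 < x → t ∉ l → f t ≤ f s)))
    ⟨hf₁.setVar (by simp) _, Or.inl ⟨by simp [hσ₁, NExp.eval], by simp⟩⟩ ?_ ?_).mono le_rfl ?_
  · rintro x τ - ⟨h, -⟩; simp [NExp.eval, h.nvar, hσ.cols]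
  · rintro x τ hx ⟨hfr, hinv⟩ h5
    have hmx : τ.narr 1 x = if (⟨x, hx⟩ : Fin m) ∈ l then 1 else 0 := by
      rw [hfr.narr 1 (by simp)]; exact hmark ⟨x, hx⟩
    refine (Runs.ite (T := 300 * B + (11 + (6 + (2 + 2)) + 1)) (fun hb => ?_) (fun hb => ?_)).le
      (by simp [BExp.cost, NExp.cost])
    · have hxl : (⟨x, hx⟩ : Fin m) ∈ l := by
        by_contra h
        simp [BExp.eval, NExp.eval, h5, hmx, h] at hb
      refine (Runs.skip ?_).le (by omega)
      refine ⟨h5, hfr.setVar (by simp) _, ?_⟩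
      simp only [State.nvar_setVar, State.rarr_setVar, Nat.reduceEqDiff,
        if_false]
      refine hinv.imp (fun h => ⟨h.1, fun t ht => ?_⟩) fun ⟨h, s, h1, h2, h3, h4⟩ =>
        ⟨h, s, h1, h2, h3, fun t ht htl => ?_⟩ <;>
      rcases Nat.lt_succ_iff_lt_or_eq.1 ht with h' | h'
      · exact h.2 t h'
      · exact (Fin.ext h' : t = ⟨x, hx⟩) ▸ hxl
      · exact h4 t h' htl
      · exact absurd hxl ((Fin.ext h' : t = ⟨x, hx⟩) ▸ htl)
    · have hxl : (⟨x, hx⟩ : Fin m) ∉ l := by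
        intro h
        simp [BExp.eval, NExp.eval, h5, hmx, h] at hb
      refine Runs.seq ((Runs.candidate hw hk hkn (hσ.frame hfr (by simp) (by simp)) hq
        (fun e he => (hG e he).congr (fun s _ => by rw [hfr.rarr _ (by simp)])
          (by rw [hfr.rarr _ (by simp)])) (fun i hi r hr => by rw [hfr.rarr _ (by simp), hW i hi r hr])
          ⟨x, hx⟩ h5).mono le_rfl ?_)
      rintro τ₁ ⟨hf₁, hval⟩
      have hfr₁ : Frame [5, 6, 7, 8, 10, 12, 13, 15] [] [2, 15, 16, 17, 20, 21] σ τ₁ :=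
        hfr.trans (hf₁.mono (by simp) (by simp) (by simp))
      change τ₁.rarr 17 0 0 = f ⟨x, hx⟩ at hval
      have h5₁ : τ₁.nvar 5 = x := by simp [hf₁.nvar, h5]
      rw [← hf₁.nvar 13 (by simp), ← hf₁.nvar 12 (by simp), ← hf₁.rarr 21 (by simp)] at hinv
      refine (Runs.ite (T := 6 + (2 + 2)) (fun hb => ?_) (fun hb => ?_)).le
        (by simp [BExp.cost, NExp.cost, RExp.cost])
      · simp only [BExp.eval, NExp.eval, RExp.eval, hval] at hb
        refine (Runs.skip ?_).le (by omega)
        refine ⟨h5₁, hfr₁.setVar (by simp) _, ?_⟩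
        simp only [State.nvar_setVar, State.rarr_setVar, Nat.reduceEqDiff,
          if_false]
        rcases hinv with h | ⟨h, s, h1, h2, h3, h4⟩
        · omega
        refine Or.inr ⟨h, s, h1, h2, h3, fun t ht htl => ?_⟩
        rcases Nat.lt_succ_iff_lt_or_eq.1 ht with h' | h'
        · exact h4 t h' htl
        · rw [(Fin.ext h' : t = ⟨x, hx⟩), ← h3]; exact hb.2
      · simp only [BExp.eval, NExp.eval, RExp.eval, hval] at hb
        refine Runs.seq ((Runs.setReal ?_).le (T' := 6) (by simp [NExp.cost, RExp.cost]))
        refine Runs.seq ((Runs.setVar ?_).le (T' := 2) (by simp [NExp.cost]))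
        refine (Runs.setVar ?_).le (by simp [NExp.cost])
        simp only [NExp.eval, RExp.eval, hval, State.nvar_setReal, h5₁]
        refine ⟨by simp [h5₁], (((hfr₁.setReal (by simp) _ _ _).setVar (by simp) _).setVar
          (by simp) _).setVar (by simp) _, Or.inr ⟨by simp, ⟨x, hx⟩, by simp, hxl,
          by simp [State.rarr_setReal], fun t ht htl => ?_⟩⟩
        rcases Nat.lt_succ_iff_lt_or_eq.1 ht with h' | h'
        · rcases hinv with h | ⟨h, s, h1, h2, h3, h4⟩
          · exact absurd (h.2 t h') htl
          · rw [h, h3] at hb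
            simp only [Nat.lt_one_iff, true_and, not_le] at hb
            exact (h4 t h' htl).trans hb.le
        · rw [(Fin.ext h' : t = ⟨x, hx⟩)]
  · rintro τ ⟨hfr, h | ⟨-, s, h1, h2, -, h4⟩⟩
    · obtain ⟨t, ht⟩ := hl
      exact absurd (h.2 t t.2) ht
    · exact ⟨hfr, s, h1, h2, fun t ht => h4 t t.2 ht⟩

/-- Update the arrays `7` and `8` when the column in variable `12` has been selected. -/
def update : Cmd :=
  .seq (fillLoop 8 (.var 0) 10 (.const 0) (.var 8)
    (.mul (.get 1 (.const 0) (.var 12)) (.get 0 (.var 8) (.var 12))))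
  (gridLoop (.seq (fillLoop 8 (.var 0) 11 (.const 0) (.var 8)
      (.mul (.get 1 (.const 0) (.var 12)) (.get 7 (.add (.var 10) (.var 12)) (.var 8))))
    (.seq (rankOneUpdate 7 10 1 6)
    (.setReal 8 (.var 7) (.var 6)
      (.mul (.get 8 (.var 7) (.var 6)) (.get 12 (.const 0) (.const 0)))))))

/-- Moving the weight into the vector makes the coefficient a natural number, as `rankOneUpdate`
takes it from a natural-number variable. -/
theorem gridMat_append_singleton' (A : Matrix (Fin n) (Fin m) ℝ) (w : Fin m → ℝ)
    (l : List (Fin m)) (s : Fin m) (N e : ℕ) : gridMat A w (l ++ [s]) N e = gridMat A w l N e +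
      ((e % N : ℕ) : ℝ) • Matrix.vecMulVec (w s • A.col s) (w s • A.col s) := by
  rw [gridMat_append_singleton]
  congr 1
  ext x y
  simp only [Matrix.smul_apply, Matrix.vecMulVec_apply, Pi.smul_apply, smul_eq_mul]
  ring

theorem Runs.update {σ : State} {A : Matrix (Fin n) (Fin m) ℝ} {w : Fin m → ℝ} {k : ℕ}
    (hn : 1 ≤ n) {l : List (Fin m)} (hσ : Ready A w k σ)
    (hG : ∀ e < (n + 1) * (n + 1), GridAt A (gridMat A w l (n + 1) e) (n + 1) e σ)
    (s : Fin m) (h12 : σ.nvar 12 = s) :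
    Runs update σ (400 * (m * ((n + 1) * (n + 1) * (n + 1)))) fun τ =>
      Frame [5, 6, 7, 8, 10] [] [2, 7, 8, 10, 11, 12] σ τ ∧
      ∀ e < (n + 1) * (n + 1), GridAt A (gridMat A w (l ++ [s]) (n + 1) e) (n + 1) e τ := by
  have hm : 1 ≤ m := s.pos
  set N := n + 1 with hN
  refine (Runs.seq ((Runs.fillLoop (by simp [NExp.cost]) (N := n) (K := 10)
    (by simp [NExp.cost, RExp.cost]) 0 id (fun x => w s * cell A x s) (fun _ _ _ _ h => h)
    ?_ ?_).mono le_rfl ?_)).le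
    (T := (n * (10 + 10) + 10) + (N * (N * (((n * (12 + 10) + 10) + (200 * (m * n) + 10)) + 14) + 20) + 12))
    ?_
  rotate_right
  · have hN1 : 1 ≤ N := by omega
    have hnN : n ≤ N := by omega
    have c0 : 1 ≤ N * N := Nat.mul_pos hN1 hN1
    have c1 : N * N ≤ m * (N * N * N) :=
      (Nat.le_mul_of_pos_right _ hN1).trans (Nat.le_mul_of_pos_left _ hm)
    have c2 : N ≤ N * N := Nat.le_mul_of_pos_left _ hN1
    have c3 : N * N * n ≤ m * (N * N * N) :=
      (Nat.mul_le_mul_left _ hnN).trans (Nat.le_mul_of_pos_left _ hm)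
    have c4 : m * (N * N * n) ≤ m * (N * N * N) :=
      Nat.mul_le_mul_left _ (Nat.mul_le_mul_left _ hnN)
    have e1 : N * (N * (((n * (12 + 10) + 10) + (200 * (m * n) + 10)) + 14) + 20) =
      22 * (N * N * n) + 200 * (m * (N * N * n)) + 34 * (N * N) + 20 * N := by ring
    omega
  · intro τ h; simp [NExp.eval, h.nvar, hσ.rows]
  · intro x τ _ hf _ h8
    simp [NExp.eval, RExp.eval, hf.rarr, hf.nvar, h8, h12, hσ.weight, hσ.matrix]
  rintro σ₁ ⟨hf₁, hfill⟩
  have hR₁ : Ready A w k σ₁ := hσ.frame hf₁ (by simp) (by simp)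
  refine (Runs.gridLoop (N := N) (m := m) (fun e τ =>
    Frame [5, 6, 7, 8, 10] [] [2, 7, 8, 11, 12] σ₁ τ ∧
    (∀ e' < e, GridAt A (gridMat A w (l ++ [s]) N e') N e' τ) ∧
    ∀ e' < N * N, e ≤ e' → GridAt A (gridMat A w l N e') N e' τ) ?_ ?_ ?_ ?_).mono le_rfl ?_
  · rintro e τ x v hx ⟨hf, hnew, hold⟩
    exact ⟨hf.setVar (by simp at hx ⊢; omega) _, hnew, hold⟩
  · rintro e τ ⟨hf, -⟩
    simp [hf.nvar, hR₁.nodes, hR₁.cols, hN]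
  · exact ⟨Frame.refl _ _ _ _, by simp, fun e he _ => (hG e he).congr
      (fun _ _ => by rw [hf₁.rarr _ (by simp)]) (by rw [hf₁.rarr _ (by simp)])⟩
  · rintro r i τ hr hi ⟨hf, hnew, hold⟩ h7 h6 h10
    have he : r * N + i < N * N :=
      calc r * N + i < (r + 1) * N := by rw [add_mul, one_mul]; omega
        _ ≤ N * N := Nat.mul_le_mul_right _ hr
    obtain ⟨hZ, hD⟩ := hold _ he le_rfl
    have hei := add_div_of_lt (r := r) hi
    rw [hei.1, hei.2] at hD
    have hPD := posDef_gridMat A w l N (r * N + i)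
    set R := gridMat A w l N (r * N + i) with hR
    set u := w s • A.col s with hu
    have hRu (x : Fin n) : R⁻¹.mulVec u x = w s * R⁻¹.mulVec (A.col s) x := by
      rw [hu, Matrix.mulVec_smul]; rfl
    refine Runs.seq ((Runs.fillLoop (by simp [NExp.cost]) (N := n) (K := 12)
      (by simp [NExp.cost, RExp.cost]) 0 id
      (fun x => w s * τ.rarr 7 ((r * N + i) * m + s) x) (fun _ _ _ _ h => h) ?_ ?_).mono le_rfl ?_)
    · intro τ' h; simp [NExp.eval, h.nvar, hf.nvar, hR₁.rows]
    · intro x τ' _ hf' _ h8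
      simp [NExp.eval, RExp.eval, hf'.rarr, hf'.nvar, hf.rarr, hf.nvar, hf₁.nvar, h8, h10, h12,
        hR₁.weight]
    rintro τ₁ ⟨hg₁, hfill₁⟩
    have hb (x : Fin n) : τ₁.rarr 10 0 x = u x := by
      rw [hg₁.rarr _ (by simp), hf.rarr _ (by simp)]
      exact (hfill.done x x.2).trans (by simp [hu])
    have hpv (x : Fin n) : τ₁.rarr 11 0 x = R⁻¹.mulVec u x := by
      rw [hRu, ← hZ]; exact hfill₁.done x x.2
    refine Runs.seq ((Runs.rankOneUpdate (arr := 7) (base := 10) (cnt := 1) (al := 6) (n := n)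
      (M := m) (p := (r * N + i) * m) (α := i) (g := u ⬝ᵥ R⁻¹.mulVec u) hn hm (by decide) (by decide) (by decide)
      (by decide) (by decide) (by decide) (by decide) (by decide) (by decide) (by decide)
      (by simp [hg₁.nvar, hf.nvar, hR₁.rows]) (by simp [hg₁.nvar, hf.nvar, hR₁.cols])
      (by simp [hg₁.nvar, h10]) (by simp [hg₁.nvar, h6]) ?_).mono le_rfl ?_)
    · rw [Finset.sum_range]
      simp [dotProduct, hb, hpv]
    rintro τ₂ ⟨hg₂, hden, hblock, hrest⟩
    have h7₂ : τ₂.nvar 7 = r := by simp [hg₂.nvar, hg₁.nvar, h7]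
    have h6₂ : τ₂.nvar 6 = i := by simp [hg₂.nvar, hg₁.nvar, h6]
    have hD₂ : τ₂.rarr 8 r i = R.det := by simp [hg₂.rarr, hg₁.rarr, hD]
    refine (Runs.setReal ?_).le (by simp [NExp.cost, RExp.cost])
    simp only [NExp.eval, RExp.eval, h7₂, h6₂, hD₂, hden]
    set τ₃ := τ₂.setReal 8 r i (R.det * (1 + i * (u ⬝ᵥ R⁻¹.mulVec u))) with hτ₃
    have h7row (j : ℕ) : τ₃.rarr 7 j = τ₂.rarr 7 j := by
      funext x; rw [hτ₃, State.rarr_setReal, if_neg (by simp)]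
    -- Different grid points own disjoint blocks of m rows, so the update of one leaves the others
    -- intact.
    have hother (e' : ℕ) (he' : e' ≠ r * N + i) {R' : Matrix (Fin n) (Fin n) ℝ}
        (h : GridAt A R' N e' τ) : GridAt A R' N e' τ₃ := by
      refine h.congr (fun t ht => ?_) ?_
      · rw [h7row, hrest _ ?_, hg₁.rarr _ (by simp)]
        rcases lt_or_gt_of_ne he' with h' | h'
        · exact Or.inl (mul_add_lt_mul ht h')
        · right
          have := Nat.mul_le_mul_right m (Nat.succ_le_of_lt h')
          rw [Nat.succ_mul] at this
          omega
      · rw [hτ₃, State.rarr_setReal, if_neg (by simpa using div_mod_ne he'), hg₂.rarr _ (by simp),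
          hg₁.rarr _ (by simp)]
    refine ⟨h7₂, h6₂, by simp [hτ₃, hg₂.nvar, hg₁.nvar, h10],
      ((hf.trans (hg₁.mono (by simp) (by simp) (by simp))).trans
        (hg₂.mono (by simp) (by simp) (by simp))).setReal (by simp) _ _ _, fun e' he' => ?_,
      fun e' he' hee' => hother e' (by omega) (hold e' he' (by omega))⟩
    rcases Nat.lt_succ_iff_lt_or_eq.1 he' with h' | h'
    · exact hother e' h'.ne (hnew e' h')
    · subst h'
      rw [gridMat_append_singleton', hei.2, ← hR, ← hu]
      refine ⟨fun t x => ?_, ?_⟩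
      · rw [h7row, hblock t t.2 x x.2, hPD.inv_add_smul_vecMulVec_mulVec u (Nat.cast_nonneg i),
          Pi.sub_apply, Pi.smul_apply, smul_eq_mul, hpv, hg₁.rarr 7 (by simp), hZ, Finset.sum_range]
        simp [dotProduct, hb, hZ]
      · rw [hei.1, hei.2, hτ₃, State.rarr_setReal, if_pos (by simp), hPD.det_add_smul_vecMulVec]
  · rintro τ ⟨hf, hnew, -⟩
    exact ⟨(hf₁.mono (by simp) (by simp) (by simp)).trans (hf.mono (by simp) (by simp) (by simp)),
      hnew⟩

end RealRAM

/-! ### The rounds, the whole algorithm and its cost. -/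

namespace RealRAM

variable {n m : ℕ}

/-- Round number `j` of the greedy algorithm, with `j` in variable `4`. -/
def round : Cmd :=
  .seq (.setVar 14 (.sub (.var 2) (.add (.var 4) (.const 1))))
  (.seq weights
  (.seq select
  (.seq (.setNat 0 (.var 4) (.var 12))
  (.seq (.setNat 1 (.var 12) (.const 1)) update))))

/-- The columns `l` have been selected by the greedy rule and all tables are up to date. -/
structure Selected (A : Matrix (Fin n) (Fin m) ℝ) (w : Fin m → ℝ) (k : ℕ) (l : List (Fin m))
    (σ : State) : Prop where
  ready : Ready A w k σ
  greedy : WeightedRI.GreedyRun A w k l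
  output : σ.output l.length = l.map Fin.val
  mark : ∀ t : Fin m, σ.narr 1 t = if t ∈ l then 1 else 0
  grid : ∀ e < (n + 1) * (n + 1), GridAt A (gridMat A w l (n + 1) e) (n + 1) e σ

theorem Runs.round {σ : State} {A : Matrix (Fin n) (Fin m) ℝ} {w : Fin m → ℝ} {k : ℕ}
    (hw : ∀ i, w i ≠ 0) (hkn : k ≤ n) (hkm : k ≤ m) {l : List (Fin m)} (hl : l.length < k)
    (hσ : Selected A w k l σ) (h4 : σ.nvar 4 = l.length) :
    Runs round σ (1200 * (m * ((n + 1) * (n + 1) * (n + 1)))) fun τ => τ.nvar 4 = l.length ∧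
      ∃ s, Selected A w k (l ++ [s]) τ := by
  have hm : 1 ≤ m := by omega
  set B := (n + 1) * (n + 1) * (n + 1) with hB
  have hB1 : 1 ≤ B := Nat.succ_le_of_lt (by positivity)
  have hmB : B ≤ m * B := Nat.le_mul_of_pos_left _ hm
  refine (Runs.seq ((Runs.setVar ?_).le (T' := 6) (by simp [NExp.cost]))).le
    (T := 6 + (300 * B + (400 * (m * B) + (3 + (3 + 400 * (m * B)))))) (by omega)
  set σ₁ := σ.setVar 14 ((NExp.sub (.var 2) (.add (.var 4) (.const 1))).eval σ) with hσ₁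
  have hf₁ : Frame [5, 6, 7, 8, 10, 12, 13, 14, 15] [] [2, 13, 14, 15, 16, 17, 20, 21] σ σ₁ :=
    (Frame.refl _ _ _ _).setVar (by simp) _
  have hR₁ : Ready A w k σ₁ := hσ.ready.frame hf₁ (by simp) (by simp)
  refine Runs.seq ((Runs.weights (N := n + 1) (by omega) hR₁.nodes rfl hR₁.scale hR₁.table).mono
    le_rfl ?_)
  rintro σ₂ ⟨hf₂, hW⟩
  have hq : σ₁.nvar 14 = k - (l.length + 1) := by
    simp [hσ₁, NExp.eval, hσ.ready.size, h4]
  have hf02 : Frame [5, 6, 7, 8, 10, 12, 13, 14, 15] [] [2, 13, 14, 15, 16, 17, 20, 21] σ σ₂ :=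
    hf₁.trans (hf₂.mono (by simp) (by simp) (by simp))
  refine Runs.seq ((Runs.select hw (by omega) hkn (hσ.ready.frame hf02 (by simp) (by simp)) hq
    (fun e he => (hσ.grid e he).congr (fun s _ => by rw [hf02.rarr _ (by simp)])
      (by rw [hf02.rarr _ (by simp)])) hW (fun t => by rw [hf02.narr _ (by simp), hσ.mark t])
      ?_).mono le_rfl ?_)
  -- Fewer than k ≤ m columns have been chosen, so an unmarked one exists.
  · by_contra! h
    have h1 : Finset.univ ⊆ l.toFinset := fun t _ => by simpa using h t
    have h2 := (Finset.card_le_card h1).trans l.toFinset_card_le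
    simp at h2
    omega
  rintro σ₃ ⟨hf₃, s, h12, hs, hmax⟩
  have hf03 : Frame [5, 6, 7, 8, 10, 12, 13, 14, 15] [] [2, 13, 14, 15, 16, 17, 20, 21] σ σ₃ :=
    hf02.trans (hf₃.mono (by simp) (by simp) (by simp))
  have h4₃ : σ₃.nvar 4 = l.length := by simp [hf03.nvar, h4]
  refine Runs.seq ((Runs.setNat ?_).le (T' := 3) (by simp [NExp.cost]))
  refine Runs.seq ((Runs.setNat ?_).le (T' := 3) (by simp [NExp.cost]))
  simp only [NExp.eval, State.nvar_setNat, h4₃, h12]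
  set σ₄ := (σ₃.setNat 0 l.length s).setNat 1 s 1 with hσ₄
  have hf04 : Frame [5, 6, 7, 8, 10, 12, 13, 14, 15] [0, 1] [2, 13, 14, 15, 16, 17, 20, 21] σ σ₄ :=
    ((hf03.mono (by simp) (by simp) (by simp)).setNat (by simp) _ _).setNat (by simp) _ _
  have hR₄ : Ready A w k σ₄ := hσ.ready.frame hf04 (by simp) (by simp)
  refine (Runs.update (by omega) hR₄ (fun e he => (hσ.grid e he).congr
    (fun s _ => by rw [hf04.rarr _ (by simp)]) (by rw [hf04.rarr _ (by simp)])) s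
    (by simpa [hσ₄] using h12)).mono le_rfl ?_
  rintro τ ⟨hf₅, hgrid⟩
  refine ⟨by simp [hf₅.nvar, hσ₄, h4₃], s, hR₄.frame hf₅ (by simp) (by simp), .snoc l s hσ.greedy hs hmax,
    ?_, fun t => ?_, hgrid⟩
  · rw [List.length_append, List.length_singleton, State.output, List.range_succ, List.map_append,
      List.map_append, ← hσ.output, State.output]
    congr 1
    · refine List.map_congr_left fun x hx => ?_
      rw [hf₅.narr _ (by simp), hσ₄, State.narr_setNat, if_neg (by simp), State.narr_setNat,
        if_neg (by simpa using (List.mem_range.1 hx).ne), hf03.narr _ (by simp)]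
    · simp [hf₅.narr, hσ₄, State.narr_setNat]
  · rw [hf₅.narr _ (by simp), hσ₄, State.narr_setNat, State.narr_setNat, hf03.narr _ (by simp),
      hσ.mark t]
    simp only [true_and, List.mem_append, List.mem_singleton, Fin.val_inj]
    split_ifs <;> simp_all

/-- The greedy algorithm. -/
def greedy : Cmd :=
  .seq constants (.seq lagrangeTable (.seq initGrid (forLoop 4 (.var 2) round)))

theorem Runs.greedy {A : Matrix (Fin n) (Fin m) ℝ} {w : Fin m → ℝ} {k : ℕ}
    (hw : ∀ i, w i ≠ 0) (hk : 1 ≤ k) (hkn : k ≤ n) (hkm : k ≤ m) :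
    Runs greedy (selectInput A w k) (3000 * (k * (m * ((n + 1) * (n + 1) * (n + 1))))) fun τ =>
      ∃ l, l.length = k ∧ Selected A w k l τ := by
  have hm : 1 ≤ m := by omega
  set B := (n + 1) * (n + 1) * (n + 1) with hB
  have hB1 : 1 ≤ B := Nat.succ_le_of_lt (by positivity)
  have hmB : B ≤ m * B := Nat.le_mul_of_pos_left _ hm
  have hmB' : m ≤ m * B := Nat.le_mul_of_pos_right _ hB1
  have hkB : m * B ≤ k * (m * B) := Nat.le_mul_of_pos_left _ hk
  have hkB' : k ≤ k * (m * B) := Nat.le_mul_of_pos_right _ (Nat.mul_pos hm hB1)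
  set σ := selectInput A w k with hσ
  have hs0 : σ.nvar 0 = n := rfl
  have hs1 : σ.nvar 1 = m := rfl
  have hs2 : σ.nvar 2 = k := rfl
  have hsA : σ.rarr 0 = cell A := rfl
  have hsw (s : Fin m) : σ.rarr 1 0 s = w s := by
    simp [hσ, selectInput, cell]
  refine (Runs.seq ((Runs.constants hm hs0 hs1).mono le_rfl ?_)).le
    (T := 100 * m + (200 * B + (1000 * (m * B) + (k * (1200 * (m * B) + 10) + 10))))
    (by have : k * (1200 * (m * B) + 10) = 1200 * (k * (m * B)) + 10 * k := by ring
        omega)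
  rintro σ₁ ⟨hf₁, h3, hc⟩
  refine Runs.seq ((Runs.lagrangeTable (N := n + 1) (by omega) h3
    (fun i j => by rw [hf₁.rarr _ (by simp)]; rfl)).mono le_rfl ?_)
  rintro σ₂ ⟨hf₂, hL⟩
  have hf02 : Frame [3, 5, 6, 15, 17] [] [2, 3, 4, 5] σ σ₂ :=
    (hf₁.mono (by simp) (by simp) (by simp)).trans (hf₂.mono (by simp) (by simp) (by simp))
  have hR₂ : Ready A w k σ₂ :=
    { rows := by simp [hf02.nvar, hs0]
      cols := by simp [hf02.nvar, hs1]
      size := by simp [hf02.nvar, hs2]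
      nodes := by simp [hf₂.nvar, h3]
      origin := by rw [hf02.nvar _ (by simp)]; rfl
      matrix := by simp [hf02.rarr, hsA]
      weight := fun s => by simp [hf02.rarr, hsw]
      scale := by
        rw [hf₂.rarr _ (by simp), hc, Finset.sum_range]
        exact congrArg _ (Finset.sum_congr rfl fun s _ => by rw [← hsw])
      table := hL }
  refine Runs.seq ((Runs.initGrid (N := n + 1) (by omega) hm (by omega) hR₂.rows hR₂.cols hR₂.nodes
    hR₂.origin A w hR₂.matrix).mono le_rfl ?_)
  rintro σ₃ ⟨hf₃, hgrid⟩
  have h0 : Selected A w k [] σ₃ :=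
    { ready := hR₂.frame hf₃ (by simp) (by simp)
      greedy := .nil
      output := rfl
      mark := fun t => by rw [hf₃.narr _ (by simp), hf02.narr _ (by simp)]; rfl
      grid := hgrid }
  have hset {l : List (Fin m)} {τ : State} (h : Selected A w k l τ) (v : ℕ) :
      Selected A w k l (τ.setVar 4 v) :=
    { ready := h.ready.frame (V := [4]) ((Frame.refl _ [] [] _).setVar (by simp) _) (by simp)
        (by simp)
      greedy := h.greedy
      output := h.output
      mark := h.mark
      grid := h.grid }
  refine (Runs.forLoop (e := .var 2) (N := k) (by simp [NExp.cost])
    (fun j τ => ∃ l, l.length = j ∧ Selected A w k l τ) ⟨[], rfl, hset h0 _⟩ ?_ ?_)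
  · rintro j τ - ⟨l, -, h⟩
    simp [NExp.eval, h.ready.size]
  · rintro j τ hj ⟨l, rfl, h⟩ h4
    refine (Runs.round hw hkn hkm hj h h4).mono le_rfl ?_
    rintro τ' ⟨h4', s, h'⟩
    exact ⟨h4', l ++ [s], by simp, hset h' _⟩

/-- The constant is 3000 · 8 · 2: n + 1 ≤ 2n gives the 8, k ≤ m gives m ≤ 2(m - k/2), and n³ ≤
n^(θ+1) because n ≥ 1 and θ > 2. -/
theorem cost_le {n m k t : ℕ} (hn : 1 ≤ n) (hkm : k ≤ m) {θ : ℝ} (hθ : 2 < θ)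
    (ht : t ≤ 3000 * (k * (m * ((n + 1) * (n + 1) * (n + 1))))) :
    (t : ℝ) ≤ 48000 * ((k : ℝ) * ((m : ℝ) - (k : ℝ) / 2) * (n : ℝ) ^ (θ + 1)) := by
  have hn' : (1 : ℝ) ≤ n := by exact_mod_cast hn
  have hkm' : (k : ℝ) ≤ m := by exact_mod_cast hkm
  have hpow : (n : ℝ) ^ 3 ≤ (n : ℝ) ^ (θ + 1) := by
    rw [← Real.rpow_natCast]
    exact Real.rpow_le_rpow_of_exponent_le hn' (by push_cast; linarith)
  have h1 : (t : ℝ) ≤ 3000 * (k * (m * (((n : ℝ) + 1) * (n + 1) * (n + 1)))) := by exact_mod_cast ht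
  have h2 : ((n : ℝ) + 1) * (n + 1) * (n + 1) ≤ 8 * (n : ℝ) ^ (θ + 1) := by
    refine le_trans ?_ (mul_le_mul_of_nonneg_left hpow (by norm_num))
    calc ((n : ℝ) + 1) * (n + 1) * (n + 1) ≤ (2 * n) * (2 * n) * (2 * n) := by gcongr <;> linarith
      _ = 8 * (n : ℝ) ^ 3 := by ring
  have h3 : (m : ℝ) ≤ 2 * (m - k / 2) := by linarith
  calc (t : ℝ) ≤ 3000 * (k * (m * (((n : ℝ) + 1) * (n + 1) * (n + 1)))) := h1
    _ ≤ 3000 * (k * ((2 * (m - k / 2)) * (8 * (n : ℝ) ^ (θ + 1)))) := by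
        gcongr
        linarith [(Nat.cast_nonneg m : (0 : ℝ) ≤ m)]
    _ = _ := by ring

end RealRAM

end

/-- Columns are numbered `0, …, m - 1` in the output of the program. -/
theorem theorem4p1 :
    -- the partial assignment polynomials are real-rooted of degree `n`, and each possible output
    -- of the greedy algorithm satisfies the bound
    (∀ (n m k : ℕ) (A : Matrix (Fin n) (Fin m) ℝ) (w : Fin m → ℝ),
      (∀ i, w i ≠ 0) → 1 ≤ k → k ≤ A.rank →
      (∀ l : List (Fin m), l.length ≤ k →
        (WeightedRI.partialPoly A w k l).Splits ∧
          (WeightedRI.partialPoly A w k l).natDegree = n) ∧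
      (∀ l : List (Fin m), WeightedRI.GreedyRun A w k l → l.length = k →
        l.toFinset.card = k ∧
        WeightedRI.kthLargestRoot k (WeightedRI.partialPoly A w k []) ≤
          WeightedRI.sigmaMin
            (WeightedRI.colsOf A l.toFinset * WeightedRI.weightsOf w l.toFinset) ^ 2)) ∧
    -- the greedy algorithm can be carried out in time `O(k (m - k/2) n ^ (θ + 1))`
    (∀ θ : ℝ, 2 < θ → RealRAM.IsMatMulExponent θ →
      ∃ (P : RealRAM.Cmd) (c : ℝ),
        ∀ (n m k : ℕ) (A : Matrix (Fin n) (Fin m) ℝ) (w : Fin m → ℝ),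
          (∀ i, w i ≠ 0) → 1 ≤ k → k ≤ A.rank →
          ∃ (l : List (Fin m)) (τ : RealRAM.State) (t : ℕ),
            WeightedRI.GreedyRun A w k l ∧ l.length = k ∧
            RealRAM.Exec P (RealRAM.selectInput A w k) τ t ∧
            τ.output k = l.map Fin.val ∧
            (t : ℝ) ≤ c * ((k : ℝ) * ((m : ℝ) - (k : ℝ) / 2) * (n : ℝ) ^ (θ + 1))) := by
  refine ⟨fun n m k A w hw hk hkr => ?_, fun θ hθ _ => ⟨RealRAM.greedy, 48000,
    fun n m k A w hw hk hkr => ?_⟩⟩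
  · have hkn : k ≤ n := hkr.trans A.rank_le_height
    have : Nonempty (Fin m) := ⟨⟨0, hk.trans (hkr.trans A.rank_le_width)⟩⟩
    exact ⟨fun l _ => ⟨WeightedRI.splits_partialPoly A hw k l,
      WeightedRI.natDegree_partialPoly A hw k l⟩, fun l h hl =>
      h.bound hw hk hkn hl⟩
  · have hkn : k ≤ n := hkr.trans A.rank_le_height
    have hkm : k ≤ m := hkr.trans A.rank_le_width
    obtain ⟨τ, t, hex, ht, l, hl, h⟩ := RealRAM.Runs.greedy (A := A) hw hk hkn hkm
    exact ⟨l, τ, t, h.greedy, hl, hex, by rw [← hl]; exact h.output,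
      RealRAM.cost_le (hk.trans hkn) hkm hθ ht⟩
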